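/- Let $d\ge 1$, $h>0$ and $\mu^\pm>0$. For each sign let $\Gamma^\pm$ be either empty or the graph of a (possibly unbounded) Lipschitz function $\underline b^\pm:\mathbb R^d\to\mathbb R$, let $\rho^\pm\in\mathbb R$, $\llbracket\rho\rrbracket=\rho^--\rho^+$, and let $\eta\in W^{1,\infty}(\mathbb R^d)\cap H^{1/2}(\mathbb R^d)$ with graph $\Sigma=\{y=\eta(x)\}$, such that $\underline b^-<\eta<\underline b^+$ and $\operatorname{dist}(\Sigma,\Gamma^\pm)>h$ (each condition only where $\Gamma^\pm\ne\emptyset$). Put $\Omega^+=\{\eta(x)<y<\underline b^+(x)\}$, $\Omega^-=\{\underline b^-(x)<y<\eta(x)\}$ (without the bound $\underline b^\pm$ if $\Gamma^\pm=\emptyset$). *Spaces.* For $\Theta:\mathbb R^d\to(0,\infty]$, $\widetilde H^{1/2}_\Theta(\mathbb R^d)$ is the space of $f\in\mathcal S'(\mathbb R^d)\cap L^2_{loc}(\mathbb R^d)$, modulo constants, with $$\|f\|_{\widetilde H^{1/2}_\Theta}^2=\int_{\mathbb R^d}\int_{|k|<\Theta(x)}\frac{|f(x+k)-f(x)|^2}{|k|^{d+1}}\,dk\,dx<\infty,$$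 and $\|\eta\|_{H^{1/2}}^2=\|\eta\|_{L^2}^2+\|\eta\|_{\widetilde H^{1/2}_\infty}^2$. Let $\dot H^1(U)=\{u\in L^2_{loc}(U):\nabla u\in L^2(U)\}/\mathbb R$. Put $L_\pm=\|\nabla\eta\|_{L^\infty}+\|\nabla\underline b^\pm\|_{L^\infty}$ (only $\|\nabla\eta\|_{L^\infty}$ if $\Gamma^\pm=\emptyset$) and $$\Theta_\pm(x)=\begin{cases}\infty&\text{if }\Gamma^\pm=\emptyset,\\[2pt] \dfrac{\mp(\eta(x)-\underline b^\pm(x))}{2L_\pm}&\text{otherwise}\end{cases}\qquad(=\infty\text{ if }L_\pm=0).$$ *System.* $G^\pm(\eta)f$ is the weak form of $\sqrt{1+|\nabla\eta|^2}\,\partial_n\phi|_\Sigma$, $n$ the upward unit normal, where $\phi\in\dot H^1(\Omega^\pm)$ is the variational solution of $\Delta\phi=0$ in $\Omega^\pm$, $\phi=f$ on $\Sigma$, $\partial_\nu\phi=0$ on $\Gamma^\pm$; that is, $\phi$ has trace $f$ on $\Sigma$, $\int_{\Omega^\pm}\nabla\phi\cdot\nabla v=0$ for all $v\in\dot H^1(\Omega^\pm)$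 with zero trace on $\Sigma$, and $\langle G^\pm(\eta)f,g\rangle=\mp\int_{\Omega^\pm}\nabla\phi\cdot\nabla v$ for every $v\in\dot H^1(\Omega^\pm)$ with trace $g$ on $\Sigma$. A variational solution of $$f^+-f^-=(\rho^+-\rho^-)\eta,\qquad \tfrac1{\mu^+}G^+(\eta)f^+-\tfrac1{\mu^-}G^-(\eta)f^-=0\qquad(\ast)$$ is a pair for which the Dirichlet problems with data $f^\pm$ have variational solutions, the first equation holds modulo constants, and the second holds when paired with every $g$ that is a trace on $\Sigma$ both of a function in $\dot H^1(\Omega^+)$ and of one in $\dot H^1(\Omega^-)$. **Claim.** The system $(\ast)$ has a unique variational solution $f^\pm\in\widetilde H^{1/2}_{\Theta_\pm}(\mathbb R^d)$ (unique modulo constants). Moreover there is a constant $C$ that depends only on $d$, $\mu^\pm$ and $h$ such that, for each sign, with $M_\pm=(1+\|\eta\|_{W^{1,\infty}})\,(1+L_\pm)\,|\llbracket\rho\rrbracket|\,\|\eta\|_{H^{1/2}}$, $$\|f^\pm\|_{\widetilde H^{1/2}_{\Theta'_\pm}}\le C\,M_\pm,\qquad \|f^\pm\|_{\widetilde H^{1/2}_{\Theta_\pm}}\le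 C\,\max\{1,L_\pm^{-1/2}\}\,M_\pm ,$$ where $\Theta'_\pm=\min\{\Theta_\pm,\mp(\eta-\underline b^\pm)\}$ if $\Gamma^\pm\neq\emptyset$ and $\Theta'_\pm=\Theta_\pm=\infty$ if $\Gamma^\pm=\emptyset$ (in the second bound the maximum is read as $1$ if $L_\pm=0$). In particular $\|f^\pm\|_{\widetilde H^{1/2}_{\Theta_\pm}}\le C\,M_\pm$ whenever $\Gamma^\pm=\emptyset$ or $L_\pm\ge\frac12$. -/

import Mathlib

open MeasureTheory Filter Topology Set
open scoped ENNReal ContDiff SchwartzMap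

noncomputable section

namespace Muskat

/-- The horizontal space `ℝ^d`. -/
abbrev Horiz (d : ℕ) : Type := EuclideanSpace ℝ (Fin d)

/-- The space `ℝ^d × ℝ` of points `(x, y)`. It is only used for its Lebesgue measure, topology and
smooth structure; Euclidean norms are taken in `Vec d`. -/
abbrev Pt (d : ℕ) : Type := Horiz d × ℝ

/-- `ℝ^d × ℝ` with the Euclidean inner product and norm. -/
abbrev Vec (d : ℕ) : Type := WithLp 2 (Horiz d × ℝ)

/-- The two fluids: `upper` carries the superscript `+`, `lower` the superscript `-`. -/
inductive Phase : Type
  | upper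
  | lower

/-- The sign `±1` of a phase. -/
def Phase.sgn : Phase → ℝ
  | .upper => 1
  | .lower => -1

/-! ### Function spaces -/

/-- `u ∈ L²_loc(U)`. -/
def MemL2Loc {X : Type*} [TopologicalSpace X] [MeasureSpace X] (U : Set X) (u : X → ℝ) : Prop :=
  ∀ K : Set X, IsCompact K → K ⊆ U → MemLp u 2 (volume.restrict K)

/-- `G` is the distributional gradient of `u` in the open set `U`. -/
def IsWeakGradient {d : ℕ} (U : Set (Pt d)) (u : Pt d → ℝ) (G : Pt d → Vec d) : Prop :=
  ∀ ψ : Pt d → ℝ, ContDiff ℝ ∞ ψ → HasCompactSupport ψ → tsupport ψ ⊆ U → ∀ e : Vec d,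
    ∫ p in U, u p * fderiv ℝ ψ p (WithLp.ofLp e) = -∫ p in U, inner ℝ (G p) e * ψ p

/-- `u` represents an element of the homogeneous Sobolev space
`Ḣ¹(U) = {u ∈ L²_loc(U) : ∇u ∈ L²(U)} / ℝ`, and `∇u = G`. -/
def MemHDotOne {d : ℕ} (U : Set (Pt d)) (u : Pt d → ℝ) (G : Pt d → Vec d) : Prop :=
  MemL2Loc U u ∧ MemLp G 2 (volume.restrict U) ∧ IsWeakGradient U u G

/-- The function `f` on `ℝ^d` is (agrees with) a tempered distribution. -/
def IsTempered {d : ℕ} (f : Horiz d → ℝ) : Prop :=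
  ∃ T : 𝓢'(Horiz d, ℂ), ∀ φ : 𝓢(Horiz d, ℂ), HasCompactSupport φ →
    T φ = ∫ x, (f x : ℂ) * φ x

/-- The norm of the screened space `H̃^{1/2}_Θ(ℝ^d)` (a seminorm on functions that vanishes on
constants),
`(∫_{ℝ^d} ∫_{|k| < Θ(x)} |f(x+k) - f(x)|² / |k|^{d+1} dk dx)^{1/2}`. -/
def screenedNorm {d : ℕ} (Θ : Horiz d → ℝ≥0∞) (f : Horiz d → ℝ) : ℝ≥0∞ :=
  (∫⁻ x, ∫⁻ k in {k : Horiz d | ‖k‖ₑ < Θ x}, ‖f (x + k) - f x‖ₑ ^ 2 / ‖k‖ₑ ^ (d + 1))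
    ^ (1 / 2 : ℝ)

/-- `f` represents an element of the screened space `H̃^{1/2}_Θ(ℝ^d)`, the quotient by the
constants of the functions in `S' ∩ L²_loc` whose screened norm is finite. -/
def MemScreened {d : ℕ} (Θ : Horiz d → ℝ≥0∞) (f : Horiz d → ℝ) : Prop :=
  IsTempered f ∧ MemL2Loc univ f ∧ screenedNorm Θ f < ⊤

/-- `f` and `g` agree modulo an additive constant, that is, they represent the same element of
`H̃^{1/2}_Θ(ℝ^d)`. -/
def EqModConst {d : ℕ} (f g : Horiz d → ℝ) : Prop :=
  ∃ c : ℝ, ∀ᵐ x, f x = g x + c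

/-- The Sobolev–Slobodeckij norm of `H^{1/2}(ℝ^d)`. -/
def hHalfNorm {d : ℕ} (f : Horiz d → ℝ) : ℝ≥0∞ :=
  (eLpNorm f 2 volume ^ 2 + screenedNorm (fun _ => ⊤) f ^ 2) ^ (1 / 2 : ℝ)

/-- `f ∈ H^{1/2}(ℝ^d)`. -/
def MemHHalf {d : ℕ} (f : Horiz d → ℝ) : Prop :=
  MemLp f 2 volume ∧ hHalfNorm f < ⊤

/-- `g ∈ Ẇ^{1,∞}(ℝ^d)`, for the continuous representative: `g` is Lipschitz. -/
def MemWDotOneInfty {d : ℕ} (g : Horiz d → ℝ) : Prop :=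
  ∃ K : NNReal, LipschitzWith K g

/-- `g ∈ W^{1,∞}(ℝ^d)`, for the continuous representative: `g` is bounded and Lipschitz. -/
def MemWOneInfty {d : ℕ} (g : Horiz d → ℝ) : Prop :=
  (∃ M : ℝ, ∀ x, |g x| ≤ M) ∧ MemWDotOneInfty g

/-- `‖g‖_{L^∞}`. -/
def supNorm {d : ℕ} (g : Horiz d → ℝ) : ℝ :=
  (eLpNorm g ⊤ volume).toReal

/-- `‖∇g‖_{L^∞}` for a Lipschitz function `g`, whose weak gradient is its almost everywhere defined
classical gradient. -/
def gradSupNorm {d : ℕ} (g : Horiz d → ℝ) : ℝ :=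
  (eLpNorm (fderiv ℝ g) ⊤ volume).toReal

/-! ### The fluid domains -/

/-- The fluid domain `Ω^±` between the interface `y = η(x)` and the rigid boundary `Γ^±`;
`b = none` stands for `Γ^± = ∅` and `b = some β` for the graph of `β`:
`Ω^+ = {η < y < β}` and `Ω^- = {β < y < η}`. -/
def fluidDomain {d : ℕ} (s : Phase) (η : Horiz d → ℝ) (b : Option (Horiz d → ℝ)) : Set (Pt d) :=
  {p | 0 < s.sgn * (p.2 - η p.1) ∧ ∀ β ∈ b, 0 < s.sgn * (β p.1 - p.2)}

/-- The standing assumption on `Γ^±`: it is empty, or the graph of a function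
`β ∈ Ẇ^{1,∞}(ℝ^d)` on the `±` side of the interface `Σ` with (Euclidean) `dist(Σ, Γ^±) > h`. -/
def AdmissibleBoundary {d : ℕ} (s : Phase) (h : ℝ) (η : Horiz d → ℝ)
    (b : Option (Horiz d → ℝ)) : Prop :=
  ∀ β ∈ b, MemWDotOneInfty β ∧ (∀ x, 0 < s.sgn * (β x - η x)) ∧
    ENNReal.ofReal h < ⨅ (x : Horiz d) (x' : Horiz d),
      edist (WithLp.toLp 2 (x, η x) : Vec d) (WithLp.toLp 2 (x', β x'))

/-- `‖∇η‖_{L^∞} + ‖∇b^±‖_{L^∞}`, without the second term if `Γ^± = ∅`. -/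
def slope {d : ℕ} (η : Horiz d → ℝ) : Option (Horiz d → ℝ) → ℝ
  | none => gradSupNorm η
  | some β => gradSupNorm η + gradSupNorm β

/-- The depth `∓(η - b^±)`, which is `∞` if `Γ^± = ∅`. -/
def depth {d : ℕ} (s : Phase) (η : Horiz d → ℝ) : Option (Horiz d → ℝ) → Horiz d → ℝ≥0∞
  | none => fun _ => ⊤
  | some β => fun x => ENNReal.ofReal (s.sgn * (β x - η x))

/-- The screening function `Θ_±`: it is `∞` if `Γ^± = ∅`, and otherwise
`∓(η - b^±) / (2 (‖∇η‖_{L^∞} + ‖∇b^±‖_{L^∞}))` (which is `∞` if the denominator vanishes). -/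
def screen {d : ℕ} (s : Phase) (η : Horiz d → ℝ) : Option (Horiz d → ℝ) → Horiz d → ℝ≥0∞
  | none => fun _ => ⊤
  | some β => fun x =>
      ENNReal.ofReal (s.sgn * (β x - η x)) / ENNReal.ofReal (2 * slope η (some β))

/-! ### The Dirichlet-Neumann operators and the transmission system -/

/-- The part of `Ω^±` over `K` at vertical distance less than `ε` from the interface (for `ε` less
than the depth). -/
def layer {d : ℕ} (s : Phase) (η : Horiz d → ℝ) (K : Set (Horiz d)) (ε : ℝ) : Set (Pt d) :=
  {p | p.1 ∈ K ∧ 0 < s.sgn * (p.2 - η p.1) ∧ s.sgn * (p.2 - η p.1) < ε}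

/-- The trace on the interface of a function `u` on `Ω^±` is `g`, that is `u(x, η(x)) = g(x)`:
the mean over `0 < t < ε` of `‖u(·, η ± t) - g‖²_{L²(K)}` tends to `0` as `ε → 0`, for every
compact `K`. -/
def HasTrace {d : ℕ} (s : Phase) (η : Horiz d → ℝ) (u : Pt d → ℝ) (g : Horiz d → ℝ) : Prop :=
  AEStronglyMeasurable g volume ∧ ∀ K : Set (Horiz d), IsCompact K →
    Tendsto (fun ε : ℝ => (∫⁻ p in layer s η K ε, ‖u p - g p.1‖ₑ ^ 2) / ENNReal.ofReal ε)
      (𝓝[>] 0) (𝓝 0)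

/-- `φ ∈ Ḣ¹(Ω^±)`, with gradient `Φ`, is the variational solution of
`Δφ = 0` in `Ω^±`, `φ = f` on the interface, `∂_ν φ = 0` on `Γ^±` (or `∇φ → 0` at infinity
if `Γ^± = ∅`). -/
def IsDirichletSolution {d : ℕ} (s : Phase) (η : Horiz d → ℝ) (b : Option (Horiz d → ℝ))
    (f : Horiz d → ℝ) (φ : Pt d → ℝ) (Φ : Pt d → Vec d) : Prop :=
  MemHDotOne (fluidDomain s η b) φ Φ ∧ HasTrace s η φ f ∧
    ∀ v V, MemHDotOne (fluidDomain s η b) v V → HasTrace s η v (fun _ => 0) →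
      ∫ p in fluidDomain s η b, inner ℝ (Φ p) (V p) = 0

/-- `a = ⟨G^±(η) f, g⟩`. Here `G^±(η) f = √(1+|∇η|²) ∂_n φ`, with `φ` the variational solution with
Dirichlet data `f` and `n` the upward normal, is taken in the weak sense: by Green's formula its
pairing with the trace `g` of `v ∈ Ḣ¹(Ω^±)` is `∓ ∫_{Ω^±} ∇φ · ∇v`, as `n` points out of `Ω^-` and
into `Ω^+`. -/
def IsDNPairing {d : ℕ} (s : Phase) (η : Horiz d → ℝ) (b : Option (Horiz d → ℝ))
    (f g : Horiz d → ℝ) (a : ℝ) : Prop :=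
  ∃ φ Φ v V, IsDirichletSolution s η b f φ Φ ∧
    MemHDotOne (fluidDomain s η b) v V ∧ HasTrace s η v g ∧
    a = -s.sgn * ∫ p in fluidDomain s η b, inner ℝ (Φ p) (V p)

/-- The pair `(f^+, f^-)` is a variational solution of
`f^+ - f^- = (ρ^+ - ρ^-) η`, `(1/μ^+) G^+(η) f^+ - (1/μ^-) G^-(η) f^- = 0`.
The first equation is modulo constants; the Dirichlet problems that define `G^±(η) f^±` are
required to be solvable; the second equation is tested against all `g` that are at the same time
traces of functions in `Ḣ¹(Ω^+)` and in `Ḣ¹(Ω^-)`. -/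
def IsTransmissionSolution {d : ℕ} (μ ρ : Phase → ℝ) (η : Horiz d → ℝ)
    (b : Phase → Option (Horiz d → ℝ)) (f : Phase → Horiz d → ℝ) : Prop :=
  EqModConst (fun x => f .upper x - f .lower x) (fun x => (ρ .upper - ρ .lower) * η x) ∧
  (∀ s, ∃ φ Φ, IsDirichletSolution s η (b s) (f s) φ Φ) ∧
  ∀ g a a', IsDNPairing .upper η (b .upper) (f .upper) g a →
    IsDNPairing .lower η (b .lower) (f .lower) g a' →
    1 / μ .upper * a - 1 / μ .lower * a' = 0

end Muskat

end

open MeasureTheory Filter Topology Set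
open scoped ENNReal ContDiff SchwartzMap

noncomputable section

namespace Muskat

variable {d : ℕ}

/-! The system is the Euler–Lagrange equation of a weighted Dirichlet energy. Put `J = ρ⁺ - ρ⁻` and
let `u` lift `η` to `Ω⁺`. In the Hilbert space of `L²` fields on `Ω⁺ ∪ Ω⁻` with measure `dx dy /
μ^±`, let `S` be the space of gradients of pairs of functions whose traces on `Σ` agree. The field
equal to `J ∇u` on `Ω⁺` and to `0` on `Ω⁻` splits as `Y + Z` with `Y ∈ S` and `Z ⊥ S`. Then `Z` is
the gradient of a pair whose traces `f^±` differ by `J η`. Orthogonality to pairs living in one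
phase is the Dirichlet problem there; orthogonality to all of `S` is the balance of the fluxes. The
projection also bounds the energy of `Z` by that of `J ∇u` (`exists_transmission_field`,
`isTransmissionSolution_of_field`). The difference of two solutions, after subtraction of a constant
in one phase, is an admissible test pair for itself, so its energy vanishes
(`IsTransmissionSolution.eqModConst`).

Two estimates turn this into bounds. Write `K = ‖∇η‖_∞`. Averaging `η` at the scale of the distance
to `Σ` gives a lift of energy at most `C (1 + K)² ‖η‖²_{H^{1/2}}` (`exists_lift`). Conversely, `f(x
+ k) - f(x)` is estimated by climbing vertically from `Σ` to a height between `(K + c)|k|` and `(K +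
2c)|k|`, crossing horizontally, and descending. The crossing stays in the fluid as long as `(L +
2c)|k|` is at most the depth. A Hardy inequality on the vertical parts and an average over the
height of the crossing give the trace inequality with constant of order `(K + c)/c²`
(`HasTrace.screenedNorm_sq_le`). The choice `c = 1/4` suits `Θ'`; the choice `c = min(1/4, L/4)`
suits `Θ` and produces the factor `max{1, L^{-1/2}}`. If `L = 0`, then `η` is constant and square
integrable, so it is zero and `f^±` are constants.

The projection needs `S` to be closed. The trace inequality with a constant screening length and a
Poincaré inequality with polynomial weight control a trace, up to its mean on a ball, by the energy
(`exists_weighted_trace_inequality`); hence potentials and traces converge along with the gradients.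
The same inequality makes the traces tempered, and constant when the energy vanishes. The separation
`h` is used in such qualitative steps and does not enter the value of `C`. -/

instance isAddHaarMeasure_volume_pt : (volume : Measure (Pt d)).IsAddHaarMeasure :=
  inferInstanceAs (((volume : Measure (Horiz d)).prod (volume : Measure ℝ)).IsAddHaarMeasure)

/-! ### Differences of functions with a weak gradient -/

/-- For each fixed `t` this is a translation, and `[0, 1]` has mass one. It lets a function that is
merely `L²` be evaluated along almost every segment. -/
lemma measurePreserving_segment (e : Pt d) :
    MeasurePreserving (fun q : ℝ × Pt d => q.2 + q.1 • e)
      ((volume.restrict (Icc (0 : ℝ) 1)).prod volume) volume := by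
  have : IsProbabilityMeasure (volume.restrict (Icc (0 : ℝ) 1)) := ⟨by simp⟩
  have h1 : MeasurePreserving (fun q : ℝ × Pt d => (q.1, q.2 + q.1 • e))
      ((volume.restrict (Icc (0 : ℝ) 1)).prod volume)
      ((volume.restrict (Icc (0 : ℝ) 1)).prod volume) := by
    refine (MeasurePreserving.id (volume.restrict (Icc (0 : ℝ) 1))).skew_product
      (g := fun t p => p + t • e) (by fun_prop) (ae_of_all _ fun t => ?_)
    exact map_add_right_eq_self volume (t • e)
  exact measurePreserving_snd.comp h1

lemma isOpen_segment_subset {U : Set (Pt d)} (hU : IsOpen U) (e : Pt d) :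
    IsOpen {p : Pt d | ∀ t ∈ Icc (0 : ℝ) 1, p + t • e ∈ U} := by
  rw [isOpen_iff_eventually]
  intro p hp
  refine isCompact_Icc.eventually_forall_of_forall_eventually fun t ht => ?_
  have : ContinuousAt (fun z : Pt d × ℝ => z.1 + z.2 • e) (p, t) := by fun_prop
  exact this.eventually_mem (hU.mem_nhds (hp t ht))

lemma integrable_mul_of_integrableOn {X : Type*} [TopologicalSpace X] [T2Space X] [MeasurableSpace X]
    [OpensMeasurableSpace X] {m : Measure X} {K : Set X} (hK : IsCompact K) {ψ g : X → ℝ}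
    (hψ : Continuous ψ) (hs : Function.support ψ ⊆ K) (hg : IntegrableOn g K m) :
    Integrable (fun p => ψ p * g p) m := by
  rw [← integrableOn_iff_integrable_of_support_subset (s := K)]
  · exact hg.continuousOn_mul hψ.continuousOn hK
  · exact (Function.support_mul_subset_left _ _).trans hs

lemma MemL2Loc.integrableOn {X : Type*} [TopologicalSpace X] [MeasureSpace X]
    [IsFiniteMeasureOnCompacts (volume : Measure X)] {U : Set X} {u : X → ℝ}
    (hu : MemL2Loc U u) {K : Set X} (hK : IsCompact K) (hKU : K ⊆ U) : IntegrableOn u K := by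
  have : IsFiniteMeasure (volume.restrict K) := ⟨by simpa using hK.measure_lt_top⟩
  exact (hu K hK hKU).integrable one_le_two

/-- The fundamental theorem of calculus along parallel segments, for weak gradients. Tested against
`ψ`, the translations move onto `ψ`; the weak gradient is applied to each translate `ψ(· - t e)`,
and the classical theorem for the smooth `ψ` together with Fubini integrates over `t`. -/
lemma MemHDotOne.ae_sub_eq {U : Set (Pt d)} (hU : IsOpen U) {u : Pt d → ℝ} {G : Pt d → Vec d}
    (h : MemHDotOne U u G) (e : Pt d) :
    ∀ᵐ p : Pt d, (∀ t ∈ Icc (0 : ℝ) 1, p + t • e ∈ U) →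
      u (p + e) - u p = ∫ t in Icc (0 : ℝ) 1,
        U.indicator (fun p => (inner ℝ (G p) (WithLp.toLp 2 e) : ℝ)) (p + t • e) := by
  obtain ⟨hu, hG, hw⟩ := h
  have : IsProbabilityMeasure (volume.restrict (Icc (0 : ℝ) 1)) := ⟨by simp⟩
  -- Extension by zero makes the integrand globally `L²`; on the segments of interest it changes
  -- nothing.
  set F : Pt d → ℝ := U.indicator (fun p => (inner ℝ (G p) (WithLp.toLp 2 e) : ℝ)) with hFdef
  set m : Measure ℝ := volume.restrict (Icc (0 : ℝ) 1) with hm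
  have hF : MemLp F 2 volume :=
    (memLp_indicator_iff_restrict hU.measurableSet).2 (hG.inner_const _)
  have hΦ := measurePreserving_segment e
  have hFΦ : MemLp (fun q : ℝ × Pt d => F (q.2 + q.1 • e)) 2 (m.prod volume) :=
    hF.comp_measurePreserving hΦ
  have hFK : ∀ K : Set (Pt d), IsCompact K →
      Integrable (fun q : ℝ × Pt d => F (q.2 + q.1 • e)) (m.prod (volume.restrict K)) := by
    intro K hK
    have : IsFiniteMeasure (volume.restrict K) := ⟨by simpa using hK.measure_lt_top⟩
    have h1 : m.prod (volume.restrict K) = (m.prod volume).restrict (univ ×ˢ K) := by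
      rw [← Measure.prod_restrict, Measure.restrict_univ]
    have h2 : MemLp (fun q : ℝ × Pt d => F (q.2 + q.1 • e)) 2 (m.prod (volume.restrict K)) := by
      rw [h1]; exact hFΦ.restrict _
    exact h2.integrable one_le_two
  have hUe := isOpen_segment_subset hU e
  set Ue : Set (Pt d) := {p : Pt d | ∀ t ∈ Icc (0 : ℝ) 1, p + t • e ∈ U} with hUedef
  have hUeU : Ue ⊆ U := fun p hp => by simpa using hp 0 (by simp)
  have hint1 : ∀ K ⊆ Ue, IsCompact K → IntegrableOn (fun p => u (p + e)) K := by
    intro K hK hKc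
    have hmp : MeasurePreserving (fun p : Pt d => p + e) volume volume :=
      measurePreserving_add_right volume e
    have := (hmp.integrableOn_image (f := u) (s := K) (measurableEmbedding_addRight e)).1
      (hu.integrableOn (hKc.image (by fun_prop)) (by
        rintro _ ⟨p, hp, rfl⟩
        simpa using hK hp 1 (by simp)))
    exact this
  have hint2 : ∀ K ⊆ Ue, IsCompact K → IntegrableOn u K := fun K hK hKc =>
    hu.integrableOn hKc (hK.trans hUeU)
  have hint3 : ∀ K ⊆ Ue, IsCompact K → IntegrableOn (fun p => ∫ t, F (p + t • e) ∂m) K := by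
    intro K hK hKc
    exact (hFK K hKc).integral_prod_right
  have key : ∀ᵐ p : Pt d, p ∈ Ue → u (p + e) - u p - ∫ t, F (p + t • e) ∂m = 0 := by
    refine hUe.ae_eq_zero_of_integral_contDiff_smul_eq_zero ?_ ?_
    · rw [locallyIntegrableOn_iff hUe.isLocallyClosed]
      intro K hK hKc
      exact ((hint1 K hK hKc).sub (hint2 K hK hKc)).sub (hint3 K hK hKc)
    · intro ψ hψ hψc hψs
      have hψcont := hψ.continuous
      have hdiff : Differentiable ℝ ψ := hψ.differentiable (by simp)
      have i1 := integrable_mul_of_integrableOn hψc hψcont (subset_tsupport ψ)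
        (hint1 _ hψs hψc)
      have i2 := integrable_mul_of_integrableOn hψc hψcont (subset_tsupport ψ)
        (hint2 _ hψs hψc)
      have i3 := integrable_mul_of_integrableOn hψc hψcont (subset_tsupport ψ)
        (hint3 _ hψs hψc)
      have hsplit : ∫ p, ψ p • (u (p + e) - u p - ∫ t, F (p + t • e) ∂m) =
          (∫ p, ψ p * u (p + e)) - (∫ p, ψ p * u p) - ∫ p, ψ p * ∫ t, F (p + t • e) ∂m := by
        have h1 := integral_sub (i1.sub i2) i3
        simp only [Pi.sub_apply] at h1
        rw [← integral_sub i1 i2, ← h1]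
        congr 1; ext p; simp only [smul_eq_mul]; ring
      have hshift : ∫ p, ψ p * u (p + e) = ∫ p, ψ (p - e) * u p := by
        rw [← integral_add_right_eq_self (fun p => ψ (p - e) * u p) e]
        simp
      -- the compact set swept out by the support of `ψ`
      set K' : Set (Pt d) := (fun q : ℝ × Pt d => q.2 + q.1 • e) '' (Icc (0 : ℝ) 1 ×ˢ tsupport ψ)
        with hK'
      have hK'c : IsCompact K' := (isCompact_Icc.prod hψc).image (by fun_prop)
      have hK'U : K' ⊆ U := by
        rintro _ ⟨⟨t, p⟩, ⟨ht, hp⟩, rfl⟩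
        exact hψs hp t ht
      have hmemK' : ∀ p, ∀ t ∈ Icc (0 : ℝ) 1, p - t • e ∈ tsupport ψ → p ∈ K' := by
        intro p t ht hp
        exact ⟨(t, p - t • e), ⟨ht, hp⟩, by simp⟩
      -- `u` is controlled only on compact subsets of `U`. All translates of `ψ` in play vanish off
      -- `K'`, so `u` may be cut off there before Fubini is applied.
      have huK' : Integrable (K'.indicator u) volume :=
        (integrable_indicator_iff hK'c.measurableSet).2 (hu.integrableOn hK'c hK'U)
      -- the derivative in direction `e`
      have hDcont : Continuous fun p => fderiv ℝ ψ p e :=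
        (hψ.continuous_fderiv (by simp)).clm_apply continuous_const
      have hDs : Function.support (fun p => fderiv ℝ ψ p e) ⊆ tsupport ψ := by
        intro p hp
        refine support_fderiv_subset ℝ (f := ψ) ?_
        intro h0
        exact hp (by simp [h0])
      have hDbdd : ∃ B, ∀ p, ‖fderiv ℝ ψ p e‖ ≤ B := by
        have : HasCompactSupport (fun p => fderiv ℝ ψ p e) :=
          HasCompactSupport.of_support_subset_isCompact hψc hDs
        exact this.exists_bound_of_continuous hDcont
      obtain ⟨B, hB⟩ := hDbdd
      have hf1 : Integrable (Function.uncurry fun (t : ℝ) (p : Pt d) =>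
          fderiv ℝ ψ (p - t • e) e * K'.indicator u p) (m.prod volume) := by
        refine Integrable.bdd_mul (c := B) (huK'.comp_snd m) ?_ ?_
        · exact (hDcont.comp (by fun_prop : Continuous fun q : ℝ × Pt d => q.2 - q.1 • e))
            |>.aestronglyMeasurable
        · exact ae_of_all _ fun q => hB _
      have hf2 : Integrable (Function.uncurry fun (t : ℝ) (p : Pt d) =>
          ψ p * F (p + t • e)) (m.prod volume) := by
        have h1 : m.prod (volume.restrict (tsupport ψ)) =
            (m.prod volume).restrict (univ ×ˢ tsupport ψ) := by
          rw [← Measure.prod_restrict, Measure.restrict_univ]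
        rw [← integrableOn_iff_integrable_of_support_subset (s := univ ×ˢ tsupport ψ),
          IntegrableOn, ← h1]
        · obtain ⟨B', hB'⟩ := hψc.exists_bound_of_continuous hψcont
          refine Integrable.bdd_mul (c := B') (hFK _ hψc) ?_ ?_
          · exact (hψcont.comp continuous_snd).aestronglyMeasurable
          · exact ae_of_all _ fun q => hB' _
        · rintro ⟨t, p⟩ hq
          refine ⟨mem_univ _, subset_tsupport ψ ?_⟩
          intro h0
          exact hq (by simp [Function.uncurry, h0])
      -- `ψ(· - t e)` is an admissible test function, because its support lies in `K' ⊆ U`.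
      have hweak : ∀ t ∈ Icc (0 : ℝ) 1,
          ∫ p, fderiv ℝ ψ (p - t • e) e * K'.indicator u p = -∫ p, ψ p * F (p + t • e) := by
        intro t ht
        have hts : tsupport (fun p => ψ (p - t • e)) ⊆ (fun p => p - t • e) ⁻¹' tsupport ψ :=
          closure_minimal (fun p hp => subset_tsupport ψ hp)
            ((isClosed_tsupport ψ).preimage (by fun_prop))
        have hcs : HasCompactSupport (fun p => ψ (p - t • e)) :=
          hψc.comp_homeomorph (Homeomorph.subRight (t • e))
        have h1 := hw (fun p => ψ (p - t • e)) (hψ.comp (by fun_prop)) hcs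
          (fun p hp => hK'U (hmemK' p t ht (hts hp))) (WithLp.toLp 2 e)
        have h2 : ∀ p, fderiv ℝ (fun p => ψ (p - t • e)) p = fderiv ℝ ψ (p - t • e) := fun p =>
          by
          simpa [sub_eq_add_neg] using fderiv_comp_add_right (f := ψ) (x := p) (-(t • e))
        simp only [h2] at h1
        have h3 : ∫ p, fderiv ℝ ψ (p - t • e) e * K'.indicator u p =
            ∫ p in U, u p * fderiv ℝ ψ (p - t • e) e := by
          rw [← integral_indicator hU.measurableSet]
          congr 1; ext p
          by_cases hp : p ∈ K'
          · simp [hp, hK'U hp, mul_comm]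
          · have : fderiv ℝ ψ (p - t • e) e = 0 := by
              by_contra h0
              exact hp (hmemK' p t ht (hDs h0))
            by_cases hpU : p ∈ U <;> simp [hpU, this]
        have h4 : ∫ p, ψ p * F (p + t • e) =
            ∫ p in U, inner ℝ (G p) (WithLp.toLp 2 e) * ψ (p - t • e) := by
          rw [← integral_indicator hU.measurableSet,
            ← integral_add_right_eq_self (U.indicator _) (t • e)]
          congr 1; ext p
          by_cases hp : p + t • e ∈ U
          · simp [hFdef, hp, mul_comm]
          · simp [hFdef, hp]
        rw [h3, h4, ← h1]
      have hswap1 := integral_integral_swap hf1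
      have hswap2 := integral_integral_swap hf2
      have hft : ∫ t, (∫ p, fderiv ℝ ψ (p - t • e) e * K'.indicator u p) ∂m =
          -∫ t, (∫ p, ψ p * F (p + t • e)) ∂m := by
        rw [← integral_neg]
        exact setIntegral_congr_fun measurableSet_Icc hweak
      have hFTC : ∀ p, ∫ t, fderiv ℝ ψ (p - t • e) e ∂m = ψ p - ψ (p - e) := by
        intro p
        rw [hm, integral_Icc_eq_integral_Ioc, ← intervalIntegral.integral_of_le zero_le_one]
        have hd : ∀ t ∈ uIcc (0 : ℝ) 1,
            HasDerivAt (fun t : ℝ => -ψ (p - t • e)) (fderiv ℝ ψ (p - t • e) e) t := by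
          intro t _
          have h1 : HasDerivAt (fun t : ℝ => p - t • e) (-e) t := by
            simpa using ((hasDerivAt_id t).smul_const e).const_sub p
          have h2 := ((hdiff (p - t • e)).hasFDerivAt.comp_hasDerivAt t h1).neg
          have h3 : -(fderiv ℝ ψ (p - t • e)) (-e) = fderiv ℝ ψ (p - t • e) e := by simp
          rw [h3] at h2
          exact h2
        rw [intervalIntegral.integral_eq_sub_of_hasDerivAt hd]
        · simp; ring
        · exact (hDcont.comp (by fun_prop : Continuous fun t : ℝ => p - t • e)).intervalIntegrable
            _ _
      have hL : ∫ p, ∫ t, fderiv ℝ ψ (p - t • e) e * K'.indicator u p ∂m =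
          (∫ p, ψ p * u p) - ∫ p, ψ (p - e) * u p := by
        have i1' : Integrable (fun p => ψ (p - e) * u p) := by
          have := i1.comp_sub_right e
          simpa using this
        rw [← integral_sub i2 i1']
        congr 1; ext p
        rw [integral_mul_const, hFTC]
        by_cases hp : p ∈ K'
        · simp [hp]; ring
        · have h0 : ψ p = 0 := by
            by_contra h0
            exact hp (hmemK' p 0 (by simp) (by simpa using subset_tsupport ψ h0))
          have h1 : ψ (p - e) = 0 := by
            by_contra h0
            exact hp (hmemK' p 1 (by simp) (by simpa using subset_tsupport ψ h0))
          simp [h0, h1]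
      have hR : ∫ p, ∫ t, ψ p * F (p + t • e) ∂m = ∫ p, ψ p * ∫ t, F (p + t • e) ∂m := by
        congr 1; ext p
        rw [integral_const_mul]
      rw [hsplit, hshift, ← hR, ← hswap2]
      have := hswap1.symm.trans hft
      rw [hL] at this
      linarith
  filter_upwards [key] with p hp hpe
  have := hp hpe
  linarith

/-! ### Elementary integral inequalities -/

lemma ennreal_add_sq_le (a b : ℝ≥0∞) : (a + b) ^ 2 ≤ 2 * (a ^ 2 + b ^ 2) := by
  have := ENNReal.rpow_add_le_mul_rpow_add_rpow a b (p := 2) (by norm_num)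
  norm_num at this
  exact this

lemma lintegral_mul_sq_le {X : Type*} [MeasurableSpace X] {m : Measure X} {f g : X → ℝ≥0∞}
    (hf : AEMeasurable f m) (hg : AEMeasurable g m) :
    (∫⁻ x, f x * g x ∂m) ^ 2 ≤ (∫⁻ x, f x ^ 2 ∂m) * ∫⁻ x, g x ^ 2 ∂m := by
  have h := ENNReal.lintegral_mul_le_Lp_mul_Lq m Real.HolderConjugate.two_two hf hg
  simp only [Pi.mul_apply, ENNReal.rpow_ofNat] at h
  calc (∫⁻ x, f x * g x ∂m) ^ 2
      ≤ ((∫⁻ x, f x ^ 2 ∂m) ^ (1 / 2 : ℝ) * (∫⁻ x, g x ^ 2 ∂m) ^ (1 / 2 : ℝ)) ^ 2 := by gcongr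
    _ = _ := by
      rw [mul_pow, ← ENNReal.rpow_natCast, ← ENNReal.rpow_natCast, ← ENNReal.rpow_mul,
        ← ENNReal.rpow_mul]
      norm_num

lemma setLIntegral_sq_le {X : Type*} [MeasurableSpace X] {m : Measure X} (s : Set X)
    {f : X → ℝ≥0∞} (hf : AEMeasurable f (m.restrict s)) :
    (∫⁻ x in s, f x ∂m) ^ 2 ≤ m s * ∫⁻ x in s, f x ^ 2 ∂m := by
  have := lintegral_mul_sq_le (aemeasurable_const (b := (1 : ℝ≥0∞))) hf
  simpa using this

lemma rpow_half_sq (a : ℝ≥0∞) : (a ^ (1 / 2 : ℝ)) ^ 2 = a := by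
  rw [← ENNReal.rpow_natCast, ← ENNReal.rpow_mul]
  norm_num

lemma eLpNorm_two_sq {X E : Type*} [MeasurableSpace X] [NormedAddCommGroup E] {m : Measure X}
    (f : X → E) : eLpNorm f 2 m ^ 2 = ∫⁻ x, ‖f x‖ₑ ^ 2 ∂m := by
  rw [eLpNorm_eq_lintegral_rpow_enorm_toReal (by norm_num) (by norm_num)]
  simp only [ENNReal.toReal_ofNat, ENNReal.rpow_ofNat]
  exact rpow_half_sq _

lemma memLp_two_iff {X E : Type*} [MeasurableSpace X] [NormedAddCommGroup E] {m : Measure X}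
    {f : X → E} : MemLp f 2 m ↔ AEStronglyMeasurable f m ∧ ∫⁻ x, ‖f x‖ₑ ^ 2 ∂m < ⊤ := by
  rw [← eLpNorm_two_sq, MemLp]
  simp [ENNReal.pow_lt_top_iff]

/-! ### Linear structure of the homogeneous Sobolev space -/

lemma MemL2Loc.locallyIntegrableOn {U : Set (Pt d)} (hU : IsOpen U) {u : Pt d → ℝ}
    (hu : MemL2Loc U u) : LocallyIntegrableOn u U := by
  rw [locallyIntegrableOn_iff hU.isLocallyClosed]
  exact fun K hK hKc => hu.integrableOn hKc hK

lemma MemL2Loc.aestronglyMeasurable {U : Set (Pt d)} (hU : IsOpen U) {u : Pt d → ℝ}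
    (hu : MemL2Loc U u) : AEStronglyMeasurable u (volume.restrict U) :=
  (hu.locallyIntegrableOn hU).aestronglyMeasurable

lemma integrable_mul_fderiv {U : Set (Pt d)} {u : Pt d → ℝ} (hu : MemL2Loc U u)
    {ψ : Pt d → ℝ} (hψ : ContDiff ℝ ∞ ψ) (hψc : HasCompactSupport ψ) (hψs : tsupport ψ ⊆ U)
    (e : Pt d) : IntegrableOn (fun p => u p * fderiv ℝ ψ p e) U := by
  have hDcont : Continuous fun p => fderiv ℝ ψ p e :=
    (hψ.continuous_fderiv (by simp)).clm_apply continuous_const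
  have hDs : Function.support (fun p => fderiv ℝ ψ p e) ⊆ tsupport ψ := by
    intro p hp
    refine support_fderiv_subset ℝ (f := ψ) ?_
    intro h0
    exact hp (by simp [h0])
  have := integrable_mul_of_integrableOn hψc hDcont hDs (hu.integrableOn hψc hψs)
  simpa [mul_comm] using this.integrableOn (s := U)

lemma integrable_inner_mul {U : Set (Pt d)} {G : Pt d → Vec d}
    (hG : MemLp G 2 (volume.restrict U))
    {ψ : Pt d → ℝ} (hψ : ContDiff ℝ ∞ ψ) (hψc : HasCompactSupport ψ) (e : Vec d) :
    IntegrableOn (fun p => inner ℝ (G p) e * ψ p) U :=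
  (hG.inner_const e).integrable_mul ((hψ.continuous.memLp_of_hasCompactSupport (p := 2) hψc).restrict U)

lemma MemHDotOne.add {U : Set (Pt d)} {u v : Pt d → ℝ} {G H : Pt d → Vec d}
    (hu : MemHDotOne U u G) (hv : MemHDotOne U v H) :
    MemHDotOne U (fun p => u p + v p) (fun p => G p + H p) := by
  refine ⟨fun K hK hKU => (hu.1 K hK hKU).add (hv.1 K hK hKU), hu.2.1.add hv.2.1, ?_⟩
  intro ψ hψ hψc hψs e
  have h1 := hu.2.2 ψ hψ hψc hψs e
  have h2 := hv.2.2 ψ hψ hψc hψs e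
  simp only [add_mul, inner_add_left]
  rw [integral_add (integrable_mul_fderiv hu.1 hψ hψc hψs _)
    (integrable_mul_fderiv hv.1 hψ hψc hψs _),
    integral_add (integrable_inner_mul hu.2.1 hψ hψc e) (integrable_inner_mul hv.2.1 hψ hψc e),
    h1, h2]
  ring

lemma MemHDotOne.const_mul {U : Set (Pt d)} {u : Pt d → ℝ} {G : Pt d → Vec d}
    (hu : MemHDotOne U u G) (c : ℝ) :
    MemHDotOne U (fun p => c * u p) (fun p => c • G p) := by
  refine ⟨fun K hK hKU => (hu.1 K hK hKU).const_mul c, hu.2.1.const_smul c, ?_⟩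
  intro ψ hψ hψc hψs e
  have h1 := hu.2.2 ψ hψ hψc hψs e
  simp only [mul_assoc, inner_smul_left, conj_trivial]
  rw [integral_const_mul, integral_const_mul, h1]
  ring

lemma MemHDotOne.sub {U : Set (Pt d)} {u v : Pt d → ℝ} {G H : Pt d → Vec d}
    (hu : MemHDotOne U u G) (hv : MemHDotOne U v H) :
    MemHDotOne U (fun p => u p - v p) (fun p => G p - H p) := by
  simpa [sub_eq_add_neg] using hu.add (hv.const_mul (-1))

lemma memHDotOne_const {U : Set (Pt d)} (c : ℝ) :
    MemHDotOne U (fun _ => c) (fun _ => 0) := by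
  refine ⟨fun K hK _ => ?_, by simp, ?_⟩
  · have : IsFiniteMeasure (volume.restrict K) := ⟨by simpa using hK.measure_lt_top⟩
    exact memLp_const c
  intro ψ hψ hψc hψs e
  have hDcont : Continuous fun p => fderiv ℝ ψ p (WithLp.ofLp e) :=
    (hψ.continuous_fderiv (by simp)).clm_apply continuous_const
  have hDs : Function.support (fun p => fderiv ℝ ψ p (WithLp.ofLp e)) ⊆ tsupport ψ := by
    intro p hp
    refine support_fderiv_subset ℝ (f := ψ) ?_
    intro h0
    exact hp (by simp [h0])
  have hint : Integrable (fun p => fderiv ℝ ψ p (WithLp.ofLp e)) :=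
    hDcont.integrable_of_hasCompactSupport
      (HasCompactSupport.of_support_subset_isCompact hψc hDs)
  have h := integral_mul_fderiv_eq_neg_fderiv_mul_of_integrable (μ := (volume : Measure (Pt d)))
    (f := fun _ : Pt d => (1 : ℝ)) (g := ψ) (v := WithLp.ofLp e)
    (by simp) (by simpa using hint)
    (by simpa using hψ.continuous.integrable_of_hasCompactSupport hψc)
    (fun x _ => differentiableAt_const _) (fun x _ => hψ.differentiable (by simp) x)
  simp only [one_mul, fderiv_fun_const, Pi.zero_apply, zero_apply, zero_mul,
    integral_zero, neg_zero] at h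
  have h2 : ∫ p in U, fderiv ℝ ψ p (WithLp.ofLp e) = ∫ p, fderiv ℝ ψ p (WithLp.ofLp e) :=
    setIntegral_eq_integral_of_forall_compl_eq_zero fun p hp => by
      by_contra h0
      exact hp (hψs (hDs h0))
  rw [integral_const_mul, h2, h]
  simp

lemma MemHDotOne.congr {U : Set (Pt d)} {u v : Pt d → ℝ} {G H : Pt d → Vec d}
    (hu : MemHDotOne U u G) (huv : u =ᵐ[volume.restrict U] v) (hGH : G =ᵐ[volume.restrict U] H) :
    MemHDotOne U v H := by
  refine ⟨fun K hK hKU => (memLp_congr_ae (ae_restrict_of_ae_restrict_of_subset hKU huv)).1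
    (hu.1 K hK hKU), (memLp_congr_ae hGH).1 hu.2.1, ?_⟩
  intro ψ hψ hψc hψs e
  have h := hu.2.2 ψ hψ hψc hψs e
  have e1 : ∫ p in U, u p * fderiv ℝ ψ p (WithLp.ofLp e) =
      ∫ p in U, v p * fderiv ℝ ψ p (WithLp.ofLp e) :=
    integral_congr_ae (huv.mono fun p hp => by simp only [hp])
  have e2 : ∫ p in U, inner ℝ (G p) e * ψ p = ∫ p in U, inner ℝ (H p) e * ψ p :=
    integral_congr_ae (hGH.mono fun p hp => by simp only [hp])
  rw [← e1, ← e2, h]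

/-! ### The sheared coordinates `(x, z) ↦ (x, η(x) ± z)` -/

lemma Phase.sgn_mul_sgn (s : Phase) : s.sgn * s.sgn = 1 := by cases s <;> simp [Phase.sgn]

lemma Phase.abs_sgn (s : Phase) : |s.sgn| = 1 := by cases s <;> simp [Phase.sgn]

/-- The map `(x, z) ↦ (x, η(x) ± z)`. -/
def shear (s : Phase) (η : Horiz d → ℝ) (q : Pt d) : Pt d := (q.1, η q.1 + s.sgn * q.2)

/-- The distance to the interface in the vertical direction, positive in `Ω^±`. -/
def height (s : Phase) (η : Horiz d → ℝ) (p : Pt d) : ℝ := s.sgn * (p.2 - η p.1)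

@[simp] lemma height_shear (s : Phase) (η : Horiz d → ℝ) (q : Pt d) :
    height s η (shear s η q) = q.2 := by
  simp only [height, shear, add_sub_cancel_left, ← mul_assoc, s.sgn_mul_sgn, one_mul]

lemma shear_height (s : Phase) (η : Horiz d → ℝ) (p : Pt d) :
    shear s η (p.1, height s η p) = p := by
  simp only [height, shear, ← mul_assoc, s.sgn_mul_sgn, one_mul, add_sub_cancel]

/-- `shear` as a homeomorphism. -/
def shearHomeo (s : Phase) {η : Horiz d → ℝ} (hη : Continuous η) : Pt d ≃ₜ Pt d where
  toFun := shear s η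
  invFun p := (p.1, height s η p)
  left_inv q := by ext <;> simp [shear, height, ← mul_assoc, s.sgn_mul_sgn]
  right_inv p := shear_height s η p
  continuous_toFun := by unfold shear; fun_prop
  continuous_invFun := by unfold height; fun_prop

/-- Each vertical line is only translated and possibly reflected, so no derivative of `η` enters.
Integrals over the fluid domains are computed in these flattened coordinates. -/
lemma measurePreserving_shear (s : Phase) {η : Horiz d → ℝ} (hη : Continuous η) :
    MeasurePreserving (shear s η) volume volume := by
  refine (MeasurePreserving.id (volume : Measure (Horiz d))).skew_product
    (g := fun x z => η x + s.sgn * z) (by fun_prop) (ae_of_all _ fun x => ?_)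
  have h1 : MeasurePreserving (fun z : ℝ => η x + z) volume volume :=
    measurePreserving_add_left volume (η x)
  have h2 : MeasurePreserving (fun z : ℝ => s.sgn * z) volume volume := by
    cases s
    · simp only [Phase.sgn, one_mul]
      exact MeasurePreserving.id (volume : Measure ℝ)
    · simpa [Phase.sgn] using Measure.measurePreserving_neg (volume : Measure ℝ)
  exact (h1.comp h2).map_eq

lemma measurableEmbedding_shear (s : Phase) {η : Horiz d → ℝ} (hη : Continuous η) :
    MeasurableEmbedding (shear s η) := (shearHomeo s hη).measurableEmbedding

lemma lintegral_shear (s : Phase) {η : Horiz d → ℝ} (hη : Continuous η) (f : Pt d → ℝ≥0∞) :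
    ∫⁻ q, f (shear s η q) = ∫⁻ p, f p :=
  (measurePreserving_shear s hη).lintegral_comp_emb (measurableEmbedding_shear s hη) f

lemma setLIntegral_shear (s : Phase) {η : Horiz d → ℝ} (hη : Continuous η) (f : Pt d → ℝ≥0∞)
    (U : Set (Pt d)) :
    ∫⁻ q in shear s η ⁻¹' U, f (shear s η q) = ∫⁻ p in U, f p :=
  (measurePreserving_shear s hη).setLIntegral_comp_preimage_emb (measurableEmbedding_shear s hη) f U

lemma isOpen_fluidDomain (s : Phase) {η : Horiz d → ℝ} (hη : Continuous η)
    {b : Option (Horiz d → ℝ)} (hb : ∀ β ∈ b, Continuous β) : IsOpen (fluidDomain s η b) := by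
  have h1 : IsOpen {p : Pt d | 0 < s.sgn * (p.2 - η p.1)} :=
    isOpen_lt continuous_const (by fun_prop)
  cases b with
  | none => simpa [fluidDomain] using h1
  | some β =>
    have hβ : Continuous β := hb β rfl
    have h2 : IsOpen {p : Pt d | 0 < s.sgn * (β p.1 - p.2)} :=
      isOpen_lt continuous_const (by fun_prop)
    simpa [fluidDomain, ofPred_and] using h1.inter h2

lemma shear_mem_fluidDomain {s : Phase} {η : Horiz d → ℝ} {b : Option (Horiz d → ℝ)} {q : Pt d} :
    shear s η q ∈ fluidDomain s η b ↔
      0 < q.2 ∧ ∀ β ∈ b, q.2 < s.sgn * (β q.1 - η q.1) := by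
  have h1 : s.sgn * ((shear s η q).2 - η (shear s η q).1) = q.2 := height_shear s η q
  have h2 : ∀ β : Horiz d → ℝ, s.sgn * (β (shear s η q).1 - (shear s η q).2) =
      s.sgn * (β q.1 - η q.1) - q.2 := by
    intro β
    have : s.sgn * (s.sgn * q.2) = q.2 := by rw [← mul_assoc, s.sgn_mul_sgn, one_mul]
    simp only [shear]; linarith
  simp only [fluidDomain, mem_ofPred_eq, h1, h2, sub_pos]

lemma mem_fluidDomain_iff {s : Phase} {η : Horiz d → ℝ} {b : Option (Horiz d → ℝ)} {p : Pt d} :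
    p ∈ fluidDomain s η b ↔
      0 < height s η p ∧ ∀ β ∈ b, height s η p < s.sgn * (β p.1 - η p.1) := by
  conv_lhs => rw [← shear_height s η p]
  exact shear_mem_fluidDomain

lemma shear_mem_layer {s : Phase} {η : Horiz d → ℝ} {K : Set (Horiz d)} {ε : ℝ} {q : Pt d} :
    shear s η q ∈ layer s η K ε ↔ q.1 ∈ K ∧ 0 < q.2 ∧ q.2 < ε := by
  have h1 : s.sgn * ((shear s η q).2 - η (shear s η q).1) = q.2 := height_shear s η q
  simp only [layer, mem_ofPred_eq, h1]
  rfl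

lemma mem_layer_iff {s : Phase} {η : Horiz d → ℝ} {K : Set (Horiz d)} {ε : ℝ} {p : Pt d} :
    p ∈ layer s η K ε ↔ p.1 ∈ K ∧ 0 < height s η p ∧ height s η p < ε := Iff.rfl

lemma layer_subset {s : Phase} {η : Horiz d → ℝ} {b : Option (Horiz d → ℝ)} {h : ℝ}
    (hb : ∀ β ∈ b, ∀ x, h ≤ s.sgn * (β x - η x)) {ε : ℝ} (hε : ε ≤ h) (K : Set (Horiz d)) :
    layer s η K ε ⊆ fluidDomain s η b := by
  intro p hp
  rw [mem_layer_iff] at hp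
  exact mem_fluidDomain_iff.2 ⟨hp.2.1, fun β hβ => by linarith [hb β hβ p.1]⟩

lemma measurableSet_layer (s : Phase) {η : Horiz d → ℝ} (hη : Continuous η) {K : Set (Horiz d)}
    (hK : MeasurableSet K) (ε : ℝ) : MeasurableSet (layer s η K ε) := by
  have h1 : Measurable (height s η) := by unfold height; fun_prop
  exact (measurable_fst hK).inter
    ((measurableSet_lt measurable_const h1).inter (measurableSet_lt h1 measurable_const))

/-! ### Linearity of the trace -/

lemma hasTrace_const (s : Phase) (η : Horiz d → ℝ) (c : ℝ) :
    HasTrace s η (fun _ => c) (fun _ => c) := by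
  refine ⟨aestronglyMeasurable_const, fun K _ => ?_⟩
  simp

lemma HasTrace.const_mul {s : Phase} {η : Horiz d → ℝ} {u : Pt d → ℝ} {g : Horiz d → ℝ}
    (hu : HasTrace s η u g) (c : ℝ) : HasTrace s η (fun p => c * u p) (fun x => c * g x) := by
  refine ⟨hu.1.const_mul c, fun K hK => ?_⟩
  have h := ENNReal.Tendsto.const_mul (a := ‖c‖ₑ ^ 2) (hu.2 K hK) (Or.inr (by simp))
  rw [mul_zero] at h
  refine h.congr fun ε => ?_
  have : ∀ p : Pt d, ‖c * u p - c * g p.1‖ₑ ^ 2 = ‖c‖ₑ ^ 2 * ‖u p - g p.1‖ₑ ^ 2 := by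
    intro p
    rw [← mul_sub, enorm_mul, mul_pow]
  simp only [this]
  rw [lintegral_const_mul' _ _ (by simp), mul_div_assoc]

lemma aestronglyMeasurable_fst {g : Horiz d → ℝ} (hg : AEStronglyMeasurable g volume) :
    AEStronglyMeasurable (fun p : Pt d => g p.1) volume :=
  hg.comp_quasiMeasurePreserving Measure.quasiMeasurePreserving_fst

/-- The depth bound puts every thin layer inside the domain, where `u` is measurable; this is what
permits splitting the integral of the sum. -/
lemma HasTrace.add {s : Phase} {η : Horiz d → ℝ}
    {b : Option (Horiz d → ℝ)} {h : ℝ} (hh : 0 < h)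
    (hb : ∀ β ∈ b, ∀ x, h ≤ s.sgn * (β x - η x)) {u v : Pt d → ℝ} {f g : Horiz d → ℝ}
    (hum : AEStronglyMeasurable u (volume.restrict (fluidDomain s η b)))
    (hu : HasTrace s η u f) (hv : HasTrace s η v g) :
    HasTrace s η (fun p => u p + v p) (fun x => f x + g x) := by
  refine ⟨hu.1.add hv.1, fun K hK => ?_⟩
  have hlim := ENNReal.Tendsto.const_mul (a := 2) ((hu.2 K hK).add (hv.2 K hK)) (Or.inr (by simp))
  rw [add_zero, mul_zero] at hlim
  refine tendsto_of_tendsto_of_tendsto_of_le_of_le' tendsto_const_nhds hlim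
    (Eventually.of_forall fun _ => zero_le) ?_
  have hev : ∀ᶠ ε : ℝ in 𝓝[>] 0, ε < h := (eventually_lt_nhds hh).filter_mono nhdsWithin_le_nhds
  filter_upwards [hev] with ε hε
  have hum' : AEMeasurable (fun p : Pt d => ‖u p - f p.1‖ₑ ^ 2)
      (volume.restrict (layer s η K ε)) := by
    have h1 := hum.mono_measure (Measure.restrict_mono (layer_subset hb hε.le K) le_rfl)
    exact (h1.sub (aestronglyMeasurable_fst hu.1).restrict).enorm.pow_const 2
  rw [← ENNReal.add_div, ← lintegral_add_left' hum', ← mul_div_assoc,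
    ← lintegral_const_mul' _ _ (by simp)]
  gcongr with p
  calc ‖u p + v p - (f p.1 + g p.1)‖ₑ ^ 2 = ‖(u p - f p.1) + (v p - g p.1)‖ₑ ^ 2 := by
        congr 2; ring
    _ ≤ (‖u p - f p.1‖ₑ + ‖v p - g p.1‖ₑ) ^ 2 := by gcongr; exact enorm_add_le _ _
    _ ≤ _ := ennreal_add_sq_le _ _

lemma HasTrace.sub {s : Phase} {η : Horiz d → ℝ}
    {b : Option (Horiz d → ℝ)} {h : ℝ} (hh : 0 < h)
    (hb : ∀ β ∈ b, ∀ x, h ≤ s.sgn * (β x - η x)) {u v : Pt d → ℝ} {f g : Horiz d → ℝ}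
    (hum : AEStronglyMeasurable u (volume.restrict (fluidDomain s η b)))
    (hu : HasTrace s η u f) (hv : HasTrace s η v g) :
    HasTrace s η (fun p => u p - v p) (fun x => f x - g x) := by
  simpa [sub_eq_add_neg] using hu.add hh hb hum (hv.const_mul (-1))

lemma HasTrace.congr {s : Phase} {η : Horiz d → ℝ} {u : Pt d → ℝ} {f g : Horiz d → ℝ}
    (hu : HasTrace s η u f) (hfg : f =ᵐ[volume] g) : HasTrace s η u g := by
  refine ⟨hu.1.congr hfg, fun K hK => (hu.2 K hK).congr fun ε => ?_⟩
  congr 1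
  refine lintegral_congr_ae (ae_restrict_of_ae ?_)
  have : ∀ᵐ p : Pt d, f p.1 = g p.1 := Measure.quasiMeasurePreserving_fst.ae hfg
  exact this.mono fun p hp => by simp only [hp]

lemma MemHDotOne.exists_stronglyMeasurable {U : Set (Pt d)} {u : Pt d → ℝ} {G : Pt d → Vec d}
    (hu : MemHDotOne U u G) :
    ∃ G' : Pt d → Vec d, StronglyMeasurable G' ∧ G =ᵐ[volume.restrict U] G' ∧ MemHDotOne U u G' :=
  ⟨hu.2.1.1.mk G, hu.2.1.1.stronglyMeasurable_mk, hu.2.1.1.ae_eq_mk,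
    hu.congr (ae_eq_refl _) hu.2.1.1.ae_eq_mk⟩

lemma MemHDotOne.ae_enorm_sub_le {U : Set (Pt d)} (hU : IsOpen U) {u : Pt d → ℝ} {G : Pt d → Vec d}
    (h : MemHDotOne U u G) (e : Pt d) :
    ∀ᵐ p : Pt d, (∀ t ∈ Icc (0 : ℝ) 1, p + t • e ∈ U) →
      ‖u (p + e) - u p‖ₑ ≤
        ∫⁻ t in Icc (0 : ℝ) 1, ‖G (p + t • e)‖ₑ * ‖(WithLp.toLp 2 e : Vec d)‖ₑ := by
  filter_upwards [h.ae_sub_eq hU e] with p hp hpe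
  rw [hp hpe]
  refine (enorm_integral_le_lintegral_enorm _).trans ?_
  refine setLIntegral_mono_ae' measurableSet_Icc (ae_of_all _ fun t ht => ?_)
  rw [indicator_of_mem (hpe t ht)]
  have := norm_inner_le_norm (𝕜 := ℝ) (G (p + t • e)) (WithLp.toLp 2 e)
  rw [← ofReal_norm, ← ofReal_norm, ← ofReal_norm, ← ENNReal.ofReal_mul (norm_nonneg _)]
  exact ENNReal.ofReal_le_ofReal this

/-! ### Estimates along the vertical direction -/

lemma shear_add_smul (s : Phase) (η : Horiz d → ℝ) (q : Pt d) (t δ : ℝ) :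
    shear s η q + t • ((0, s.sgn * δ) : Pt d) = shear s η (q.1, q.2 + t * δ) := by
  ext
  · simp [shear]
  · simp [shear]; ring

lemma enorm_toLp_vertical (s : Phase) {δ : ℝ} (hδ : 0 ≤ δ) :
    ‖(WithLp.toLp 2 ((0, s.sgn * δ) : Pt d) : Vec d)‖ₑ = ENNReal.ofReal δ := by
  rw [← ofReal_norm]
  congr 1
  rw [WithLp.prod_norm_eq_of_L2]
  simp [s.abs_sgn, Real.sqrt_sq hδ]

/-- The segment formula with `e = (0, ±δ)`, the parameter of the segment being rescaled to the
height. -/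
lemma MemHDotOne.ae_enorm_sub_le_vertical {s : Phase} {η : Horiz d → ℝ}
    {b : Option (Horiz d → ℝ)} (hη : Continuous η) (hb : ∀ β ∈ b, Continuous β)
    {u : Pt d → ℝ} {G : Pt d → Vec d} (h : MemHDotOne (fluidDomain s η b) u G) {δ : ℝ}
    (hδ : 0 < δ) :
    ∀ᵐ q : Pt d, 0 < q.2 → shear s η (q.1, q.2 + δ) ∈ fluidDomain s η b →
      ‖u (shear s η (q.1, q.2 + δ)) - u (shear s η q)‖ₑ ≤
        ∫⁻ z in Icc q.2 (q.2 + δ), ‖G (shear s η (q.1, z))‖ₑ := by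
  have h1 := (measurePreserving_shear s hη).quasiMeasurePreserving.ae
    (h.ae_enorm_sub_le (isOpen_fluidDomain s hη hb) (0, s.sgn * δ))
  filter_upwards [h1] with q hq hq0 hqΩ
  have h2 : shear s η q + ((0, s.sgn * δ) : Pt d) = shear s η (q.1, q.2 + δ) := by
    simpa using shear_add_smul s η q 1 δ
  simp only [shear_add_smul, h2, enorm_toLp_vertical s hδ.le] at hq
  rw [shear_mem_fluidDomain] at hqΩ
  refine (hq fun t ht => ?_).trans ?_
  · rw [shear_mem_fluidDomain]
    have : t * δ ≤ δ := mul_le_of_le_one_left hδ.le ht.2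
    have : 0 ≤ t * δ := mul_nonneg ht.1 hδ.le
    refine ⟨by simp only; linarith, fun β hβ => ?_⟩
    have := hqΩ.2 β hβ
    simp only at this ⊢
    linarith
  · have hd : ∀ t ∈ Icc (0 : ℝ) 1, HasDerivWithinAt (fun t : ℝ => q.2 + t * δ) δ (Icc 0 1) t := by
      intro t _
      simpa using (((hasDerivAt_id t).mul_const δ).const_add q.2).hasDerivWithinAt
    have hinj : InjOn (fun t : ℝ => q.2 + t * δ) (Icc 0 1) := by
      intro t _ t' _ htt
      simpa [hδ.ne'] using htt
    have := lintegral_image_eq_lintegral_abs_deriv_mul measurableSet_Icc hd hinj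
      (fun z => ‖G (shear s η (q.1, z))‖ₑ)
    rw [abs_of_pos hδ] at this
    simp only [mul_comm _ (ENNReal.ofReal δ)]
    rw [← this]
    refine lintegral_mono_set ?_
    rintro _ ⟨t, ht, rfl⟩
    exact ⟨by nlinarith [ht.1], by nlinarith [ht.2]⟩

/-- The integral of `g` over the vertical segment between the interface and `(x, η(x) ± z)`. -/
def columnIntegral (s : Phase) (η : Horiz d → ℝ) (G : Pt d → Vec d) (q : Pt d) : ℝ≥0∞ :=
  ∫⁻ z in Ioo 0 q.2, ‖G (shear s η (q.1, z))‖ₑ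

lemma measurable_columnIntegral (s : Phase) {η : Horiz d → ℝ} (hη : Continuous η)
    {G : Pt d → Vec d} (hG : StronglyMeasurable G) : Measurable (columnIntegral s η G) := by
  have h1 : columnIntegral s η G = fun q : Pt d =>
      ∫⁻ z, {r : Pt d × ℝ | r.2 ∈ Ioo 0 r.1.2}.indicator
        (fun r => ‖G (shear s η (r.1.1, r.2))‖ₑ) (q, z) := by
    ext q
    rw [columnIntegral, ← lintegral_indicator measurableSet_Ioo]
    rfl
  rw [h1]
  refine Measurable.lintegral_prod_right' (Measurable.indicator ?_ ?_)
  · have : Continuous fun r : Pt d × ℝ => shear s η (r.1.1, r.2) := by unfold shear; fun_prop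
    exact hG.enorm.comp this.measurable
  · exact (measurableSet_lt measurable_const measurable_snd).inter
      (measurableSet_lt measurable_snd (by fun_prop))

lemma columnIntegral_mono {s : Phase} {η : Horiz d → ℝ} {G : Pt d → Vec d} {x : Horiz d}
    {z z' : ℝ} (h : z ≤ z') : columnIntegral s η G (x, z) ≤ columnIntegral s η G (x, z') :=
  lintegral_mono_set (Ioo_subset_Ioo_right h)

/-- The definition of the trace in the form needed for summation: `n + 1` copies of the integral
over a layer of thickness `Z/(n+1)` are together negligible. -/
lemma HasTrace.tendsto_mul {s : Phase} {η : Horiz d → ℝ} {u : Pt d → ℝ} {f : Horiz d → ℝ}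
    (hf : HasTrace s η u f) {K : Set (Horiz d)} (hK : IsCompact K) {Z : ℝ} (hZ : 0 < Z) :
    Tendsto (fun n : ℕ => ((n + 1 : ℕ) : ℝ≥0∞) *
      ∫⁻ p in layer s η K (Z / ((n + 1 : ℕ) : ℝ)), ‖u p - f p.1‖ₑ ^ 2) atTop (𝓝 0) := by
  have h1 : Tendsto (fun n : ℕ => Z / ((n + 1 : ℕ) : ℝ)) atTop (𝓝[>] 0) := by
    refine tendsto_nhdsWithin_iff.2 ⟨?_, Eventually.of_forall fun n => ?_⟩
    · exact (tendsto_const_div_atTop_nhds_zero_nat Z).comp (tendsto_add_atTop_nat 1)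
    · exact div_pos hZ (by positivity)
  have h2 := ENNReal.Tendsto.const_mul (a := ENNReal.ofReal Z) ((hf.2 K hK).comp h1)
    (Or.inr (by simp))
  rw [mul_zero] at h2
  refine h2.congr fun n => ?_
  simp only [Function.comp]
  have hn : (0 : ℝ) < ((n + 1 : ℕ) : ℝ) := by positivity
  rw [ENNReal.ofReal_div_of_pos hn, ENNReal.ofReal_natCast, ← mul_div_assoc, mul_comm,
    mul_div_assoc, mul_comm]
  congr 1
  have hZ' : ENNReal.ofReal Z ≠ 0 := by simpa using hZ
  rw [ENNReal.div_eq_inv_mul, ENNReal.inv_div (by simp) (by simp), mul_comm, ← mul_div_assoc,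
    mul_comm, mul_div_assoc, ENNReal.div_self hZ' (by simp), mul_one]

/-- The trace is only an averaged limit, so one cannot simply let the lower end of a segment tend to
the interface. Instead, the part of `|u - f|` exceeding the column integral does not grow under an
upward shift. Its square integral over any slab of width `ε` is thus bounded by that of `|u - f|`
over a layer at the interface, and the sum over all slabs tends to zero by the definition of the
trace. -/
lemma HasTrace.ae_enorm_sub_le {s : Phase} {η : Horiz d → ℝ}
    {b : Option (Horiz d → ℝ)} (hη : Continuous η) (hb : ∀ β ∈ b, Continuous β)
    {u : Pt d → ℝ} {G : Pt d → Vec d} (h : MemHDotOne (fluidDomain s η b) u G)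
    (hG : StronglyMeasurable G) {f : Horiz d → ℝ} (hf : HasTrace s η u f) :
    ∀ᵐ q : Pt d, shear s η q ∈ fluidDomain s η b →
      ‖u (shear s η q) - f q.1‖ₑ ≤ columnIntegral s η G q := by
  set Ω := fluidDomain s η b with hΩ
  have hΩo : IsOpen Ω := isOpen_fluidDomain s hη hb
  set D : Set (Pt d) := shear s η ⁻¹' Ω with hD
  have hDm : MeasurableSet D := (measurePreserving_shear s hη).measurable hΩo.measurableSet
  set A := columnIntegral s η G with hA
  have hAm : Measurable A := measurable_columnIntegral s hη hG
  set w : Pt d → ℝ≥0∞ := fun q => ‖u (shear s η q) - f q.1‖ₑ with hw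
  have hwm : AEMeasurable w (volume.restrict D) := by
    have h1 : AEStronglyMeasurable (fun q => u (shear s η q)) (volume.restrict D) := by
      refine (h.1.aestronglyMeasurable hΩo).comp_quasiMeasurePreserving ?_
      exact ((measurePreserving_shear s hη).restrict_preimage
        hΩo.measurableSet).quasiMeasurePreserving
    exact (h1.sub (aestronglyMeasurable_fst hf.1).restrict).enorm
  -- the excess of `w` over the column integral
  have hshift : ∀ (K : Set (Horiz d)) (δ ε : ℝ), 0 ≤ δ → MeasurableSet K →
      ∫⁻ q in {q : Pt d | q ∈ D ∧ q.1 ∈ K ∧ δ < q.2 ∧ q.2 ≤ δ + ε}, (w q - A q) ^ 2 ≤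
        ∫⁻ p in layer s η K (2 * ε), ‖u p - f p.1‖ₑ ^ 2 := by
    intro K δ ε hδ hK
    set S : Set (Pt d) := {q : Pt d | q ∈ D ∧ q.1 ∈ K ∧ δ < q.2 ∧ q.2 ≤ δ + ε} with hS
    have hSm : MeasurableSet S := hDm.inter ((measurable_fst hK).inter
      ((measurableSet_lt measurable_const measurable_snd).inter
        (measurableSet_le measurable_snd measurable_const)))
    have hlayer : MeasurableSet (shear s η ⁻¹' layer s η K (2 * ε)) :=
      (measurePreserving_shear s hη).measurable (measurableSet_layer s hη hK _)
    rw [← setLIntegral_shear s hη _ (layer s η K (2 * ε)), ← lintegral_indicator hSm, ← lintegral_indicator hlayer,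
      ← lintegral_add_right_eq_self _ ((0, δ) : Pt d)]
    -- Moving up by `δ` changes `u` by at most the integral of `|G|` over the segment crossed, which
    -- is part of the column integral at the upper end. The subtraction is truncated at zero.
    have hkey : ∀ᵐ q : Pt d, 0 < q.2 → shear s η (q.1, q.2 + δ) ∈ Ω →
        w (q.1, q.2 + δ) - A (q.1, q.2 + δ) ≤ w q := by
      rcases hδ.eq_or_lt with h0 | h0
      · refine ae_of_all _ fun q _ _ => ?_
        simp only [← h0, add_zero]
        exact tsub_le_self
      · filter_upwards [h.ae_enorm_sub_le_vertical hη hb h0] with q hq hq0 hqΩ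
        have h1 := hq hq0 hqΩ
        rw [tsub_le_iff_right]
        have h2 : ∫⁻ z in Icc q.2 (q.2 + δ), ‖G (shear s η (q.1, z))‖ₑ ≤ A (q.1, q.2 + δ) := by
          rw [hA, columnIntegral, ← restrict_Ioo_eq_restrict_Icc]
          exact lintegral_mono_set (Ioo_subset_Ioo_left hq0.le)
        calc w (q.1, q.2 + δ) = ‖(u (shear s η q) - f q.1) +
              (u (shear s η (q.1, q.2 + δ)) - u (shear s η q))‖ₑ := by
              simp only [hw]; congr 1; ring
          _ ≤ w q + ‖u (shear s η (q.1, q.2 + δ)) - u (shear s η q)‖ₑ := enorm_add_le _ _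
          _ ≤ _ := by gcongr; exact h1.trans h2
    refine lintegral_mono_ae ?_
    filter_upwards [hkey] with q hq
    by_cases hqS : q + (0, δ) ∈ S
    · have hq' : q + (0, δ) = (q.1, q.2 + δ) := by ext <;> simp
      rw [hq'] at hqS ⊢
      obtain ⟨h1, h2, h3, h4⟩ := hqS
      simp only at h2 h3 h4
      -- The shifted slab is `0 < z ≤ ε`, whereas a layer is open at its top; this is why the
      -- thickness is `2 * ε`.
      have h5 : q ∈ shear s η ⁻¹' layer s η K (2 * ε) := by
        rw [mem_preimage, shear_mem_layer]
        exact ⟨h2, by linarith, by linarith⟩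
      rw [indicator_of_mem (show (q.1, q.2 + δ) ∈ S from ⟨h1, h2, h3, h4⟩), indicator_of_mem h5]
      gcongr
      exact hq (by linarith) h1
    · rw [indicator_of_notMem hqS]
      exact zero_le
  have hzero : ∀ N : ℕ, ∫⁻ q in {q : Pt d | q ∈ D ∧ q.1 ∈ Metric.closedBall (0 : Horiz d) N ∧
      q.2 ≤ N + 1}, (w q - A q) ^ 2 = 0 := by
    intro N
    set K := Metric.closedBall (0 : Horiz d) N with hK
    have hKc : IsCompact K := isCompact_closedBall _ _
    have hZ : (0 : ℝ) < 2 * (N + 1) := by positivity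
    refine le_antisymm (ge_of_tendsto' (hf.tendsto_mul hKc hZ) fun n => ?_) zero_le
    have hn : (0 : ℝ) < ((n + 1 : ℕ) : ℝ) := by positivity
    set ε : ℝ := (N + 1) / ((n + 1 : ℕ) : ℝ) with hε
    have hε0 : 0 < ε := by positivity
    -- The slabs are half-open on the left, so height `z` belongs to the slab of index `⌈z/ε⌉ - 1`,
    -- a natural number since `z > 0`.
    have hsub : {q : Pt d | q ∈ D ∧ q.1 ∈ K ∧ q.2 ≤ N + 1} ⊆ ⋃ j : Fin (n + 1),
        {q : Pt d | q ∈ D ∧ q.1 ∈ K ∧ (j : ℝ) * ε < q.2 ∧ q.2 ≤ (j : ℝ) * ε + ε} := by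
      rintro q ⟨hqD, hqK, hqN⟩
      have hq0 : 0 < q.2 := (shear_mem_fluidDomain.1 hqD).1
      have hqε : 0 < q.2 / ε := div_pos hq0 hε0
      have hc0 : 0 < ⌈q.2 / ε⌉₊ := Nat.ceil_pos.2 hqε
      have hc1 : ⌈q.2 / ε⌉₊ ≤ n + 1 := by
        rw [Nat.ceil_le, div_le_iff₀ hε0, hε, mul_div_cancel₀ _ hn.ne']
        exact hqN
      have hc2 : ((⌈q.2 / ε⌉₊ - 1 : ℕ) : ℝ) + 1 = ⌈q.2 / ε⌉₊ := by
        exact_mod_cast Nat.sub_add_cancel hc0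
      refine mem_iUnion.2 ⟨⟨⌈q.2 / ε⌉₊ - 1, by omega⟩, hqD, hqK, ?_, ?_⟩
      · have := Nat.ceil_lt_add_one hqε.le
        rw [← lt_div_iff₀ hε0]
        simp only
        linarith
      · have := Nat.le_ceil (q.2 / ε)
        rw [div_le_iff₀ hε0] at this
        simp only
        nlinarith
    calc _ ≤ ∫⁻ q in ⋃ j : Fin (n + 1),
        {q : Pt d | q ∈ D ∧ q.1 ∈ K ∧ (j : ℝ) * ε < q.2 ∧ q.2 ≤ (j : ℝ) * ε + ε},
          (w q - A q) ^ 2 := lintegral_mono_set hsub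
      _ ≤ ∑' j : Fin (n + 1), ∫⁻ q in
        {q : Pt d | q ∈ D ∧ q.1 ∈ K ∧ (j : ℝ) * ε < q.2 ∧ q.2 ≤ (j : ℝ) * ε + ε},
          (w q - A q) ^ 2 := lintegral_iUnion_le _ _
      _ ≤ ∑' _ : Fin (n + 1), ∫⁻ p in layer s η K (2 * ε), ‖u p - f p.1‖ₑ ^ 2 :=
        ENNReal.tsum_le_tsum fun j => hshift K _ ε (by positivity) hKc.measurableSet
      _ = _ := by
        have : 2 * ε = 2 * (N + 1) / ((n + 1 : ℕ) : ℝ) := by rw [hε, mul_div_assoc]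
        rw [tsum_fintype, Finset.sum_const, Finset.card_univ, Fintype.card_fin, nsmul_eq_mul, this]
  have hae : ∀ N : ℕ, ∀ᵐ q : Pt d, q ∈ D → q.1 ∈ Metric.closedBall (0 : Horiz d) N →
      q.2 ≤ N + 1 → w q ≤ A q := by
    intro N
    set S := {q : Pt d | q ∈ D ∧ q.1 ∈ Metric.closedBall (0 : Horiz d) N ∧ q.2 ≤ N + 1} with hS
    have hSm : MeasurableSet S := hDm.inter ((measurable_fst Metric.isClosed_closedBall.measurableSet).inter
      (measurableSet_le measurable_snd measurable_const))
    have hSD : S ⊆ D := fun q hq => hq.1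
    have hm : AEMeasurable (fun q => (w q - A q) ^ 2) (volume.restrict S) :=
      ((hwm.mono_measure (Measure.restrict_mono hSD le_rfl)).sub hAm.aemeasurable).pow_const 2
    have h1 := (lintegral_eq_zero_iff' hm).1 (hzero N)
    rw [Filter.EventuallyEq, ae_restrict_iff' hSm] at h1
    filter_upwards [h1] with q hq h2 h3 h4
    have h5 := hq ⟨h2, h3, h4⟩
    simpa [tsub_eq_zero_iff_le] using h5
  filter_upwards [ae_all_iff.2 hae] with q hq hqD
  obtain ⟨N, hN⟩ := exists_nat_ge (max ‖q.1‖ q.2)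
  refine hq N hqD ?_ ?_
  · simpa using (le_max_left _ _).trans hN
  · linarith [(le_max_right ‖q.1‖ q.2).trans hN]

/-! ### Radial integrals -/

lemma lintegral_comp_smul (F : Horiz d → ℝ≥0∞) {ρ : ℝ} (hρ : 0 < ρ) :
    ENNReal.ofReal (ρ ^ d) * ∫⁻ k, F (ρ • k) = ∫⁻ k, F k := by
  have h1 : ∫⁻ k, F (ρ • k) = ∫⁻ k, F k ∂(Measure.map (ρ • ·) (volume : Measure (Horiz d))) :=
    ((Homeomorph.smulOfNeZero ρ hρ.ne').measurableEmbedding.lintegral_map F).symm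
  rw [h1, Measure.map_addHaar_smul volume hρ.ne', lintegral_smul_measure, finrank_euclideanSpace_fin,
    smul_eq_mul, ← mul_assoc, ← ENNReal.ofReal_mul (by positivity), abs_of_pos (by positivity),
    mul_inv_cancel₀ (by positivity), ENNReal.ofReal_one, one_mul]

/-- The integral of `|k|^{-d-α}` over `|k| > 1`. -/
def radialConst (d : ℕ) (α : ℝ) : ℝ≥0∞ :=
  ∫⁻ k in {k : Horiz d | 1 < ‖k‖}, ENNReal.ofReal (‖k‖ ^ (-(d + α)))

lemma radialConst_lt_top {α : ℝ} (hα : 0 < α) : radialConst d α < ⊤ := by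
  have h1 := finite_integral_one_add_norm (E := Horiz d) (μ := volume) (r := d + α)
    (by rw [finrank_euclideanSpace_fin]; linarith)
  have h2 : radialConst d α ≤ ∫⁻ k : Horiz d, ENNReal.ofReal (2 ^ (d + α)) *
      ENNReal.ofReal ((1 + ‖k‖) ^ (-(d + α))) := by
    refine (setLIntegral_mono' (measurableSet_lt measurable_const (by fun_prop))
      fun k hk => ?_).trans (setLIntegral_le_lintegral _ _)
    have hk : 1 < ‖k‖ := hk
    rw [← ENNReal.ofReal_mul (by positivity)]
    refine ENNReal.ofReal_le_ofReal ?_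
    have h3 : (2 : ℝ) ^ (d + α) * (1 + ‖k‖) ^ (-(d + α)) = ((1 + ‖k‖) / 2) ^ (-(d + α)) := by
      rw [Real.div_rpow (by positivity) (by norm_num), Real.rpow_neg (by norm_num : (0:ℝ) ≤ 2)]
      field_simp
    rw [h3]
    exact Real.rpow_le_rpow_of_nonpos (by positivity) (by linarith)
      (by have : (0:ℝ) ≤ d := by positivity
          linarith)
  refine h2.trans_lt ?_
  rw [lintegral_const_mul' _ _ ENNReal.ofReal_ne_top]
  exact ENNReal.mul_lt_top ENNReal.ofReal_lt_top h1

lemma lintegral_radial {α ρ : ℝ} (hρ : 0 < ρ) :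
    ∫⁻ k in {k : Horiz d | ρ < ‖k‖}, ENNReal.ofReal (‖k‖ ^ (-(d + α))) =
      ENNReal.ofReal (ρ ^ (-α)) * radialConst d α := by
  have hm : ∀ ρ : ℝ, MeasurableSet {k : Horiz d | ρ < ‖k‖} := fun ρ =>
    measurableSet_lt measurable_const (by fun_prop)
  rw [radialConst, ← lintegral_indicator (hm ρ), ← lintegral_indicator (hm 1),
    ← lintegral_comp_smul _ hρ]
  have h1 : ∀ k : Horiz d, {k : Horiz d | ρ < ‖k‖}.indicator
      (fun k => ENNReal.ofReal (‖k‖ ^ (-(d + α)))) (ρ • k) =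
      ENNReal.ofReal (ρ ^ (-(d + α))) * {k : Horiz d | 1 < ‖k‖}.indicator
        (fun k => ENNReal.ofReal (‖k‖ ^ (-(d + α)))) k := by
    intro k
    have h2 : ‖ρ • k‖ = ρ * ‖k‖ := by rw [norm_smul, Real.norm_of_nonneg hρ.le]
    have h3 : ρ < ρ * ‖k‖ ↔ 1 < ‖k‖ := lt_mul_iff_one_lt_right hρ
    by_cases hk : 1 < ‖k‖
    · rw [indicator_of_mem (show ρ • k ∈ {k : Horiz d | ρ < ‖k‖} by
        simp only [mem_ofPred_eq, h2, h3, hk]), indicator_of_mem (show k ∈ {k : Horiz d | 1 < ‖k‖}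
        from hk), h2, Real.mul_rpow hρ.le (norm_nonneg _), ENNReal.ofReal_mul (by positivity)]
    · rw [indicator_of_notMem (show ρ • k ∉ {k : Horiz d | ρ < ‖k‖} by
        simp only [mem_ofPred_eq, h2, h3, hk, not_false_eq_true]),
        indicator_of_notMem (show k ∉ {k : Horiz d | 1 < ‖k‖} from hk), mul_zero]
  simp only [h1]
  rw [lintegral_const_mul' _ _ ENNReal.ofReal_ne_top, ← mul_assoc,
    ← ENNReal.ofReal_mul (by positivity)]
  congr 2
  rw [← Real.rpow_natCast, ← Real.rpow_add hρ]
  congr 1; ring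

/-! ### A Hardy inequality -/

lemma lintegral_Ioo_rpow_neg_half {B : ℝ} (hB : 0 ≤ B) :
    ∫⁻ z in Ioo 0 B, ENNReal.ofReal (z ^ (-(1 / 2) : ℝ)) = ENNReal.ofReal (2 * √B) := by
  rw [restrict_Ioo_eq_restrict_Ioc, ← ofReal_integral_eq_lintegral_ofReal]
  · rw [← intervalIntegral.integral_of_le hB, integral_rpow (by left; norm_num), Real.sqrt_eq_rpow]
    congr 1
    norm_num
    ring
  · exact (intervalIntegral.intervalIntegrable_rpow' (by norm_num)).1
  · exact (ae_restrict_mem measurableSet_Ioc).mono fun z hz => Real.rpow_nonneg hz.1.le _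

/-- Cauchy–Schwarz with the factors `z^{-1/4}` and `z^{1/4} g`. The unweighted version would make
the later integral over `|k|` diverge logarithmically; the weight `√z` gains the missing half power.
-/
lemma setLIntegral_Ioo_sq_le {g : ℝ → ℝ≥0∞} (hg : Measurable g) {B : ℝ} (hB : 0 ≤ B) :
    (∫⁻ z in Ioo 0 B, g z) ^ 2 ≤
      ENNReal.ofReal (2 * √B) * ∫⁻ z in Ioo 0 B, ENNReal.ofReal (√z) * g z ^ 2 := by
  have h1 : ∫⁻ z in Ioo 0 B, g z = ∫⁻ z in Ioo 0 B, ENNReal.ofReal (z ^ (-(1 / 4) : ℝ)) *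
      (ENNReal.ofReal (z ^ (1 / 4 : ℝ)) * g z) := by
    refine setLIntegral_congr_fun measurableSet_Ioo fun z hz => ?_
    rw [← mul_assoc, ← ENNReal.ofReal_mul (Real.rpow_nonneg hz.1.le _), ← Real.rpow_add hz.1]
    norm_num
  rw [h1]
  refine (lintegral_mul_sq_le ?_ ?_).trans (le_of_eq ?_)
  · exact (by fun_prop : Measurable fun z : ℝ => ENNReal.ofReal (z ^ (-(1 / 4) : ℝ))).aemeasurable
  · exact ((by fun_prop : Measurable fun z : ℝ => ENNReal.ofReal (z ^ (1 / 4 : ℝ))).mul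
      hg).aemeasurable
  congr 1
  · rw [← lintegral_Ioo_rpow_neg_half hB]
    refine setLIntegral_congr_fun measurableSet_Ioo fun z hz => ?_
    rw [← ENNReal.ofReal_pow (Real.rpow_nonneg hz.1.le _), ← Real.rpow_natCast,
      ← Real.rpow_mul hz.1.le]
    norm_num
  · refine setLIntegral_congr_fun measurableSet_Ioo fun z hz => ?_
    rw [mul_pow, ← ENNReal.ofReal_pow (Real.rpow_nonneg hz.1.le _), ← Real.rpow_natCast,
      ← Real.rpow_mul hz.1.le, Real.sqrt_eq_rpow]
    norm_num

/-! ### Screened norms -/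

lemma screenedNorm_sq (Θ : Horiz d → ℝ≥0∞) (f : Horiz d → ℝ) :
    screenedNorm Θ f ^ 2 = ∫⁻ x, ∫⁻ k in {k : Horiz d | ‖k‖ₑ < Θ x},
      ‖f (x + k) - f x‖ₑ ^ 2 / ‖k‖ₑ ^ (d + 1) := rpow_half_sq _

lemma screenedNorm_congr (Θ : Horiz d → ℝ≥0∞) {f g : Horiz d → ℝ} (h : f =ᵐ[volume] g) :
    screenedNorm Θ f = screenedNorm Θ g := by
  unfold screenedNorm
  congr 1
  refine lintegral_congr_ae ?_
  filter_upwards [h] with x hx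
  refine lintegral_congr_ae (ae_restrict_of_ae ?_)
  have h1 : ∀ᵐ k, f (x + k) = g (x + k) :=
    (measurePreserving_add_left volume x).quasiMeasurePreserving.ae h
  filter_upwards [h1] with k hk
  rw [hk, hx]

lemma screenedNorm_const (Θ : Horiz d → ℝ≥0∞) (c : ℝ) :
    screenedNorm Θ (fun _ : Horiz d => c) = 0 := by
  simp [screenedNorm]

/-- Tonelli's theorem for the screened norm. -/
lemma screenedNorm_sq_eq {Θ : Horiz d → ℝ≥0∞} (hΘ : Measurable Θ) {f : Horiz d → ℝ}
    (hf : Measurable f) :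
    screenedNorm Θ f ^ 2 = ∫⁻ k : Horiz d, (‖k‖ₑ ^ (d + 1))⁻¹ *
      ∫⁻ x in {x | ‖k‖ₑ < Θ x}, ‖f (x + k) - f x‖ₑ ^ 2 := by
  have hS : MeasurableSet {q : Horiz d × Horiz d | ‖q.2‖ₑ < Θ q.1} :=
    measurableSet_lt (by fun_prop) (by fun_prop)
  have hF : Measurable fun q : Horiz d × Horiz d =>
      ‖f (q.1 + q.2) - f q.1‖ₑ ^ 2 / ‖q.2‖ₑ ^ (d + 1) := by fun_prop
  have hS1 : ∀ x, MeasurableSet {k : Horiz d | ‖k‖ₑ < Θ x} := fun x =>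
    measurableSet_lt (by fun_prop) (by fun_prop)
  have hS2 : ∀ k : Horiz d, MeasurableSet {x : Horiz d | ‖k‖ₑ < Θ x} := fun k =>
    measurableSet_lt (by fun_prop) (by fun_prop)
  rw [screenedNorm_sq]
  have h1 : ∀ x, ∫⁻ k in {k : Horiz d | ‖k‖ₑ < Θ x}, ‖f (x + k) - f x‖ₑ ^ 2 / ‖k‖ₑ ^ (d + 1) =
      ∫⁻ k, {q : Horiz d × Horiz d | ‖q.2‖ₑ < Θ q.1}.indicator (fun q =>
      ‖f (q.1 + q.2) - f q.1‖ₑ ^ 2 / ‖q.2‖ₑ ^ (d + 1)) (x, k) := by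
    intro x
    rw [← lintegral_indicator (hS1 x)]; rfl
  simp only [h1]
  rw [lintegral_lintegral_swap (f := fun x k => {q : Horiz d × Horiz d | ‖q.2‖ₑ < Θ q.1}.indicator
    (fun q => ‖f (q.1 + q.2) - f q.1‖ₑ ^ 2 / ‖q.2‖ₑ ^ (d + 1)) (x, k))
    (hF.indicator hS).aemeasurable]
  refine lintegral_congr fun k => ?_
  rw [← lintegral_const_mul _ (by fun_prop), ← lintegral_indicator (hS2 k)]
  refine lintegral_congr fun x => ?_
  by_cases hx : ‖k‖ₑ < Θ x
  · rw [indicator_of_mem (show (x, k) ∈ {q : Horiz d × Horiz d | ‖q.2‖ₑ < Θ q.1} from hx),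
      indicator_of_mem (show x ∈ {x | ‖k‖ₑ < Θ x} from hx), ENNReal.div_eq_inv_mul]
  · rw [indicator_of_notMem (show (x, k) ∉ {q : Horiz d × Horiz d | ‖q.2‖ₑ < Θ q.1} from hx),
      indicator_of_notMem (show x ∉ {x | ‖k‖ₑ < Θ x} from hx)]

/-! ### The trace inequality -/

lemma continuous_of_abs_sub_le {η : Horiz d → ℝ} {L : ℝ}
    (h : ∀ x y, |η x - η y| ≤ L * ‖x - y‖) : Continuous η := by
  have : LipschitzWith (Real.toNNReal L) η := LipschitzWith.of_dist_le' fun x y => by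
    rw [Real.dist_eq, dist_eq_norm]; exact h x y
  exact this.continuous

lemma HasTrace.ae_enorm_sub_le_height {s : Phase} {η : Horiz d → ℝ}
    {b : Option (Horiz d → ℝ)} (hη : Continuous η) (hb : ∀ β ∈ b, Continuous β)
    {u : Pt d → ℝ} {G : Pt d → Vec d} (h : MemHDotOne (fluidDomain s η b) u G)
    (hG : StronglyMeasurable G) {f : Horiz d → ℝ} (hf : HasTrace s η u f) :
    ∀ᵐ p : Pt d, p ∈ fluidDomain s η b →
      ‖u p - f p.1‖ₑ ≤ columnIntegral s η G (p.1, height s η p) := by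
  have h1 : MeasurePreserving (shearHomeo s hη).toMeasurableEquiv volume volume :=
    measurePreserving_shear s hη
  have h2 := h1.symm.quasiMeasurePreserving.ae (hf.ae_enorm_sub_le hη hb h hG)
  filter_upwards [h2] with p hp
  have h3 : (shearHomeo s hη).toMeasurableEquiv.symm p = (p.1, height s η p) := rfl
  simpa only [h3, shear_height] using hp

lemma measurable_height (s : Phase) {η : Horiz d → ℝ} (hη : Continuous η) :
    Measurable (height s η) := by unfold height; fun_prop

lemma setLIntegral_band (s : Phase) {η : Horiz d → ℝ} (hη : Continuous η) {W : Set (Horiz d)}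
    {F : Horiz d → ℝ≥0∞} (hF : Measurable F) (l l' : ℝ) :
    ∫⁻ p in {p : Pt d | p.1 ∈ W ∧ l < height s η p ∧ height s η p < l'}, F p.1 =
      ENNReal.ofReal (l' - l) * ∫⁻ x in W, F x := by
  rw [← setLIntegral_shear s hη]
  have h1 : shear s η ⁻¹' {p : Pt d | p.1 ∈ W ∧ l < height s η p ∧ height s η p < l'} =
      W ×ˢ Ioo l l' := by
    ext q
    simp only [mem_preimage, mem_ofPred_eq, height_shear, mem_prod, mem_Ioo]
    rfl
  rw [h1, Measure.volume_eq_prod, ← Measure.prod_restrict, lintegral_prod _ ?_]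
  · have : ∀ q : Pt d, (shear s η q).1 = q.1 := fun _ => rfl
    simp only [this, lintegral_const, Measure.restrict_apply_univ, Real.volume_Ioo]
    rw [lintegral_mul_const _ hF, mul_comm]
  · exact (hF.comp measurable_fst).aemeasurable

/-- The kernel that controls translates of the trace. -/
def traceKernel (a c z r : ℝ) : ℝ≥0∞ :=
  (if 0 < z ∧ z < a * r then ENNReal.ofReal (4 * √(a * r) * √z) else 0) +
    if c * r < z ∧ z < a * r then ENNReal.ofReal (r / c) else 0

lemma measurable_traceKernel (a c : ℝ) :
    Measurable fun q : ℝ × ℝ => traceKernel a c q.1 q.2 := by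
  unfold traceKernel
  refine Measurable.add (Measurable.ite ?_ (by fun_prop) measurable_const)
    (Measurable.ite ?_ (by fun_prop) measurable_const)
  · exact (measurableSet_lt measurable_const measurable_fst).inter
      (measurableSet_lt measurable_fst (by fun_prop))
  · exact (measurableSet_lt (by fun_prop) measurable_fst).inter
      (measurableSet_lt measurable_fst (by fun_prop))

/-- Both terms live on `|k| > z/a`. There `√(a|k|) √z` against `|k|^{-d-1}` integrates to a multiple
of `a`, by scaling. In the second term `c|k| < z` replaces `|k|/c` by `z/c²`, and the integral of
`|k|^{-d-1}` contributes a multiple of `a/z`. The bound is therefore uniform in `z`. -/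
lemma lintegral_traceKernel_le {a c : ℝ} (ha : 0 < a) (hc : 0 < c) (hc1 : c ≤ 1) (z : ℝ) :
    ∫⁻ k : Horiz d, (‖k‖ₑ ^ (d + 1))⁻¹ * traceKernel a c z ‖k‖ ≤
      ENNReal.ofReal (a / c ^ 2) * (4 * radialConst d (1 / 2) + radialConst d 1) := by
  rcases le_or_gt z 0 with hz | hz
  · have : ∀ k : Horiz d, traceKernel a c z ‖k‖ = 0 := by
      intro k
      have h1 : ¬ (0 < z) := not_lt.2 hz
      have h2 : ¬ (c * ‖k‖ < z) := not_lt.2 (hz.trans (by positivity))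
      simp [traceKernel, h1, h2]
    simp [this]
  have hm : MeasurableSet {k : Horiz d | z / a < ‖k‖} :=
    measurableSet_lt measurable_const (by fun_prop)
  have hza : 0 < z / a := by positivity
  have hinv : ∀ k : Horiz d, 0 < ‖k‖ → (‖k‖ₑ ^ (d + 1))⁻¹ =
      ENNReal.ofReal (‖k‖ ^ (-((d : ℝ) + 1))) := by
    intro k hk
    rw [← ofReal_norm, ← ENNReal.ofReal_pow (norm_nonneg _), ← ENNReal.ofReal_inv_of_pos
      (by positivity), Real.rpow_neg hk.le]
    norm_cast
  have key : ∀ k : Horiz d, (‖k‖ₑ ^ (d + 1))⁻¹ * traceKernel a c z ‖k‖ ≤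
      {k : Horiz d | z / a < ‖k‖}.indicator (fun k => ENNReal.ofReal (4 * √a * √z) *
        ENNReal.ofReal (‖k‖ ^ (-((d : ℝ) + 1 / 2))) +
        ENNReal.ofReal (z / c ^ 2) * ENNReal.ofReal (‖k‖ ^ (-((d : ℝ) + 1)))) k := by
    intro k
    by_cases hk : z / a < ‖k‖
    · have hk0 : 0 < ‖k‖ := hza.trans hk
      rw [indicator_of_mem (show k ∈ {k : Horiz d | z / a < ‖k‖} from hk), hinv k hk0, traceKernel,
        mul_add]
      refine add_le_add ?_ ?_
      · split_ifs
        · rw [← ENNReal.ofReal_mul (by positivity), ← ENNReal.ofReal_mul (by positivity)]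
          refine ENNReal.ofReal_le_ofReal (le_of_eq ?_)
          have h1 : ‖k‖ ^ (-((d : ℝ) + 1 / 2)) = ‖k‖ ^ (-((d : ℝ) + 1)) * √‖k‖ := by
            rw [Real.sqrt_eq_rpow, ← Real.rpow_add hk0]; congr 1; ring
          rw [h1, Real.sqrt_mul ha.le]; ring
        · simp
      · split_ifs with h1
        · have h2 : ‖k‖ / c ≤ z / c ^ 2 := by
            rw [sq, ← div_div]
            refine div_le_div_of_nonneg_right ?_ hc.le
            rw [le_div_iff₀ hc]
            linarith [h1.1]
          rw [mul_comm]
          exact mul_le_mul' (ENNReal.ofReal_le_ofReal h2) le_rfl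
        · simp
    · rw [indicator_of_notMem (show k ∉ {k : Horiz d | z / a < ‖k‖} from hk), traceKernel]
      have h1 : ¬ (z < a * ‖k‖) := by
        rw [div_lt_iff₀ ha] at hk
        linarith
      simp [h1]
  refine (lintegral_mono key).trans ?_
  rw [lintegral_indicator hm, lintegral_add_left (by fun_prop),
    lintegral_const_mul' _ _ ENNReal.ofReal_ne_top, lintegral_const_mul' _ _ ENNReal.ofReal_ne_top,
    lintegral_radial hza, lintegral_radial hza, ← mul_assoc, ← mul_assoc,
    ← ENNReal.ofReal_mul (by positivity), ← ENNReal.ofReal_mul (by positivity), mul_add,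
    ← mul_assoc]
  gcongr
  · have h4 : (4 : ℝ≥0∞) = ENNReal.ofReal 4 := by norm_num
    rw [h4, ← ENNReal.ofReal_mul (by positivity)]
    refine ENNReal.ofReal_le_ofReal ?_
    have h1 : (z / a) ^ (-(1 / 2) : ℝ) = √a / √z := by
      rw [Real.rpow_neg hza.le, ← Real.sqrt_eq_rpow, Real.sqrt_div hz.le, inv_div]
    have h2 : 0 < √z := Real.sqrt_pos.2 hz
    have h3 : 4 * √a * √z * (√a / √z) = 4 * a := by
      field_simp
      rw [Real.sq_sqrt ha.le]
    rw [h1, h3]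
    have : a ≤ a / c ^ 2 := le_div_self ha.le (by positivity) (by nlinarith)
    linarith
  · rw [Real.rpow_neg_one]
    refine le_of_eq ?_
    field_simp

section Translate

variable {s : Phase} {η : Horiz d → ℝ} {b : Option (Horiz d → ℝ)} {Lη Lβ c : ℝ}
  {u : Pt d → ℝ} {G : Pt d → Vec d} {f : Horiz d → ℝ}

lemma height_add_horizontal (hLη : ∀ x y, |η x - η y| ≤ Lη * ‖x - y‖) (k : Horiz d) {t : ℝ}
    (ht : t ∈ Icc (0 : ℝ) 1) (p : Pt d) :
    |height s η (p + t • ((k, 0) : Pt d)) - height s η p| ≤ Lη * ‖k‖ := by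
  have hL : 0 ≤ Lη * ‖k‖ := by
    have := (abs_nonneg _).trans (hLη k 0)
    simpa using this
  have h1 : height s η (p + t • ((k, 0) : Pt d)) - height s η p =
      s.sgn * (η p.1 - η (p.1 + t • k)) := by
    simp [height]; ring
  rw [h1, abs_mul, s.abs_sgn, one_mul]
  refine (hLη _ _).trans ?_
  have h2 : ‖p.1 - (p.1 + t • k)‖ = t * ‖k‖ := by
    rw [sub_add_cancel_left, norm_neg, norm_smul, Real.norm_of_nonneg ht.1]
  rw [h2]
  nlinarith [ht.2]

/-- Along the segment the height above the interface varies by at most `Lη |k|`, and the rigid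
boundary moves by at most `Lβ |k|`. The first is absorbed by the lower bound on the height, the
second by the gap between depth and height at `p`. -/
lemma segment_subset_fluidDomain (hLη : ∀ x y, |η x - η y| ≤ Lη * ‖x - y‖)
    (hLβ : ∀ β ∈ b, ∀ x y, |β x - β y| ≤ Lβ * ‖x - y‖) {k : Horiz d} {p : Pt d}
    (h1 : Lη * ‖k‖ < height s η p) (h2 : height s η p < (Lη + 2 * c) * ‖k‖)
    (hW : ∀ β ∈ b, (Lη + Lβ + 2 * c) * ‖k‖ ≤ s.sgn * (β p.1 - η p.1)) {t : ℝ}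
    (ht : t ∈ Icc (0 : ℝ) 1) : p + t • ((k, 0) : Pt d) ∈ fluidDomain s η b := by
  have h3 := abs_le.1 (height_add_horizontal (s := s) hLη k ht p)
  refine mem_fluidDomain_iff.2 ⟨by linarith, fun β hβ => ?_⟩
  have h4 : s.sgn * (β (p + t • ((k, 0) : Pt d)).1 - η (p + t • ((k, 0) : Pt d)).1) -
      height s η (p + t • ((k, 0) : Pt d)) =
      s.sgn * (β p.1 - η p.1) - height s η p + s.sgn * (β (p.1 + t • k) - β p.1) := by
    simp [height]; ring
  have h5 : |s.sgn * (β (p.1 + t • k) - β p.1)| ≤ Lβ * ‖k‖ := by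
    have hL : 0 ≤ Lβ * ‖k‖ := by
      have := (abs_nonneg _).trans (hLβ β hβ k 0)
      simpa using this
    rw [abs_mul, s.abs_sgn, one_mul]
    refine (hLβ β hβ _ _).trans ?_
    rw [add_sub_cancel_left, norm_smul, Real.norm_of_nonneg ht.1]
    nlinarith [ht.2]
  have h6 := hW β hβ
  have h7 := (abs_le.1 h5).1
  nlinarith

/-- The path from the interface at `x` to the interface at `x + k` goes up, across and down. The
crossing is averaged over heights in a band of width `c|k|`: this turns integrals along segments
into an integral over the fluid, and the division by the width explains the factor `|k|/c` in the
kernel. The Hardy inequality handles the two vertical pieces. -/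
lemma lintegral_translate_le (hLη : ∀ x y, |η x - η y| ≤ Lη * ‖x - y‖)
    (hLβ : ∀ β ∈ b, ∀ x y, |β x - β y| ≤ Lβ * ‖x - y‖) (hLη0 : 0 ≤ Lη) (hc : 0 < c)
    (h : MemHDotOne (fluidDomain s η b) u G) (hG : StronglyMeasurable G)
    (hf : HasTrace s η u f) (hfm : Measurable f) {k : Horiz d} (hk : k ≠ 0)
    {W : Set (Horiz d)} (hWm : MeasurableSet W)
    (hW : ∀ x ∈ W, ∀ β ∈ b, (Lη + Lβ + 2 * c) * ‖k‖ ≤ s.sgn * (β x - η x)) :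
    ∫⁻ x in W, ‖f (x + k) - f x‖ₑ ^ 2 ≤
      4 * ∫⁻ q : Pt d, traceKernel (2 * (Lη + c)) c q.2 ‖k‖ * ‖G (shear s η q)‖ₑ ^ 2 := by
  have hη : Continuous η := continuous_of_abs_sub_le hLη
  have hb : ∀ β ∈ b, Continuous β := fun β hβ => continuous_of_abs_sub_le (hLβ β hβ)
  set r := ‖k‖ with hr
  have hr0 : 0 < r := norm_pos_iff.2 hk
  set a := 2 * (Lη + c) with ha
  have ha0 : 0 < a := by positivity
  set e : Pt d := (k, 0) with he
  have hshear : Continuous (shear s η) := (shearHomeo s hη).continuous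
  -- The Hardy bound of a vertical piece, taken up to height `a r` so that it depends on `x` alone.
  set Q : Horiz d → ℝ≥0∞ := fun x => ENNReal.ofReal (2 * √(a * r)) *
    ∫⁻ z in Ioo 0 (a * r), ENNReal.ofReal (√z) * ‖G (shear s η (x, z))‖ₑ ^ 2 with hQ
  have hγm : Measurable fun q : Pt d => ‖G (shear s η q)‖ₑ ^ 2 :=
    (hG.enorm.comp hshear.measurable).pow_const 2
  have hQm : Measurable Q := by
    refine Measurable.const_mul ?_ _
    refine Measurable.lintegral_prod_right' (f := fun q : Pt d => ENNReal.ofReal (√q.2) *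
      ‖G (shear s η q)‖ₑ ^ 2) ?_
    exact (by fun_prop : Measurable fun q : Pt d => ENNReal.ofReal (√q.2)).mul hγm
  have hV : ∀ᵐ p : Pt d, p ∈ fluidDomain s η b → height s η p < a * r →
      ‖u p - f p.1‖ₑ ^ 2 ≤ Q p.1 := by
    filter_upwards [hf.ae_enorm_sub_le_height hη hb h hG] with p hp hpΩ hpa
    calc ‖u p - f p.1‖ₑ ^ 2 ≤ columnIntegral s η G (p.1, height s η p) ^ 2 := by
          gcongr; exact hp hpΩ
      _ ≤ columnIntegral s η G (p.1, a * r) ^ 2 := by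
          gcongr; exact columnIntegral_mono hpa.le
      _ ≤ Q p.1 := by
        refine setLIntegral_Ioo_sq_le (g := fun z => ‖G (shear s η (p.1, z))‖ₑ) ?_ (by positivity)
        exact hG.enorm.comp (hshear.measurable.comp (by fun_prop))
  have hVe := (measurePreserving_add_right volume e).quasiMeasurePreserving.ae hV
  set P : Set (Pt d) := {p : Pt d | p.1 ∈ W ∧ (Lη + c) * r < height s η p ∧
    height s η p < (Lη + 2 * c) * r} with hP
  have hPm : MeasurableSet P := (measurable_fst hWm).inter
    ((measurableSet_lt measurable_const (measurable_height s hη)).inter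
      (measurableSet_lt (measurable_height s hη) measurable_const))
  set R : Pt d → ℝ≥0∞ := fun p => ∫⁻ t in Icc (0 : ℝ) 1, ‖G (p + t • e)‖ₑ ^ 2 with hR
  have hGtm : Measurable fun q : Pt d × ℝ => ‖G (q.1 + q.2 • e)‖ₑ ^ 2 :=
    (hG.enorm.comp (by fun_prop : Measurable fun q : Pt d × ℝ => q.1 + q.2 • e)).pow_const 2
  have hRm : Measurable R := Measurable.lintegral_prod_right' hGtm
  have hnorm : ‖(WithLp.toLp 2 e : Vec d)‖ₑ = ENNReal.ofReal r := by
    rw [← ofReal_norm]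
    congr 1
    rw [WithLp.prod_norm_eq_of_L2]
    simp [he, hr]
  -- A crossing that starts at height between `(Lη + c) r` and `(Lη + 2c) r` varies in height by at
  -- most `Lη r`; hence the limits `c r` and `2 (Lη + c) r = a r`.
  have hband : ∀ p ∈ P, ∀ t ∈ Icc (0 : ℝ) 1,
      c * r < height s η (p + t • e) ∧ height s η (p + t • e) < a * r := by
    rintro p ⟨_, hp2, hp3⟩ t ht
    have := abs_le.1 (height_add_horizontal (s := s) hLη k ht p)
    exact ⟨by nlinarith, by rw [ha]; nlinarith⟩
  have hpt : ∀ᵐ p : Pt d, p ∈ P → ‖f (p.1 + k) - f p.1‖ₑ ^ 2 ≤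
      4 * ((Q p.1 + Q (p.1 + k)) + ENNReal.ofReal (r ^ 2) * R p) := by
    filter_upwards [hV, hVe, h.ae_enorm_sub_le (isOpen_fluidDomain s hη hb) e] with p h1 h2 h3 hp
    have hseg : ∀ t ∈ Icc (0 : ℝ) 1, p + t • e ∈ fluidDomain s η b := fun t ht =>
      segment_subset_fluidDomain hLη hLβ (by nlinarith [hp.2.1]) hp.2.2 (hW _ hp.1) ht
    have b0 := hband p hp 0 (by simp)
    have b1 := hband p hp 1 (by simp)
    have s0 := hseg 0 (by simp)
    have s1 := hseg 1 (by simp)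
    simp only [zero_smul, add_zero, one_smul] at b0 b1 s0 s1
    have i1 := h1 s0 b0.2
    have i2 := h2 s1 b1.2
    have i3 : ‖u (p + e) - u p‖ₑ ^ 2 ≤ ENNReal.ofReal (r ^ 2) * R p := by
      have hm1 : Measurable fun t : ℝ => ‖G (p + t • e)‖ₑ :=
        hG.enorm.comp (by fun_prop : Measurable fun t : ℝ => p + t • e)
      calc ‖u (p + e) - u p‖ₑ ^ 2 ≤ (∫⁻ t in Icc (0 : ℝ) 1, ‖G (p + t • e)‖ₑ * ENNReal.ofReal r) ^ 2
            := by gcongr; rw [← hnorm]; exact h3 hseg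
        _ = ENNReal.ofReal (r ^ 2) * (∫⁻ t in Icc (0 : ℝ) 1, ‖G (p + t • e)‖ₑ) ^ 2 := by
            rw [lintegral_mul_const _ hm1, mul_pow, ENNReal.ofReal_pow hr0.le, mul_comm]
        _ ≤ _ := by
            gcongr
            refine (setLIntegral_sq_le _ hm1.aemeasurable).trans (le_of_eq ?_)
            simp [hR]
    have hp1 : (p + e).1 = p.1 + k := by simp [he]
    rw [hp1] at i2
    set x1 := ‖u p - f p.1‖ₑ
    set x2 := ‖u (p + e) - f (p.1 + k)‖ₑ
    set x3 := ‖u (p + e) - u p‖ₑ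
    have tri : ‖f (p.1 + k) - f p.1‖ₑ ≤ (x1 + x2) + x3 := by
      have e1 : f (p.1 + k) - f p.1 =
          ((u p - f p.1) - (u (p + e) - f (p.1 + k))) + (u (p + e) - u p) := by ring
      rw [e1]
      exact (enorm_add_le _ _).trans (by gcongr; exact enorm_sub_le)
    calc ‖f (p.1 + k) - f p.1‖ₑ ^ 2 ≤ ((x1 + x2) + x3) ^ 2 := by gcongr
      _ ≤ 2 * ((x1 + x2) ^ 2 + x3 ^ 2) := ennreal_add_sq_le _ _
      _ ≤ 2 * (2 * (x1 ^ 2 + x2 ^ 2) + 2 * x3 ^ 2) := by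
          gcongr
          · exact ennreal_add_sq_le _ _
          · exact le_mul_of_one_le_left zero_le (by norm_num)
      _ = 4 * ((x1 ^ 2 + x2 ^ 2) + x3 ^ 2) := by ring
      _ ≤ _ := by gcongr
  have hcr : (Lη + 2 * c) * r - (Lη + c) * r = c * r := by ring
  have hQ1 : Measurable fun p : Pt d => Q p.1 := hQm.comp measurable_fst
  have hFm : Measurable fun x : Horiz d => ‖f (x + k) - f x‖ₑ ^ 2 := by fun_prop
  have hQk : Measurable fun x : Horiz d => Q (x + k) := hQm.comp (by fun_prop)
  set B : ℝ≥0∞ := ∫⁻ p in {p : Pt d | c * r < height s η p ∧ height s η p < a * r}, ‖G p‖ₑ ^ 2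
    with hB
  have hbm : MeasurableSet {p : Pt d | c * r < height s η p ∧ height s η p < a * r} :=
    (measurableSet_lt measurable_const (measurable_height s hη)).inter
      (measurableSet_lt (measurable_height s hη) measurable_const)
  -- For each `t` the translate of `P` by `t e` stays in the band, so Fubini over `t` costs no
  -- constant.
  have hRB : ∫⁻ p in P, R p ≤ B := by
    have hsw : ∫⁻ p in P, R p = ∫⁻ t in Icc (0 : ℝ) 1, ∫⁻ p in P, ‖G (p + t • e)‖ₑ ^ 2 :=
      lintegral_lintegral_swap (f := fun (p : Pt d) (t : ℝ) => ‖G (p + t • e)‖ₑ ^ 2)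
        hGtm.aemeasurable
    rw [hsw]
    have : ∀ t ∈ Icc (0 : ℝ) 1, ∫⁻ p in P, ‖G (p + t • e)‖ₑ ^ 2 ≤ B := by
      intro t ht
      rw [hB, ← lintegral_indicator hPm, ← lintegral_indicator hbm,
        ← lintegral_add_right_eq_self ({p : Pt d | c * r < height s η p ∧
          height s η p < a * r}.indicator fun p => ‖G p‖ₑ ^ 2) (t • e)]
      refine lintegral_mono fun p => ?_
      by_cases hp : p ∈ P
      · rw [indicator_of_mem hp, indicator_of_mem (show p + t • e ∈ {p : Pt d | c * r < height s η p ∧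
          height s η p < a * r} from
          hband p hp t ht)]
      · rw [indicator_of_notMem hp]; exact zero_le
    refine (setLIntegral_mono' measurableSet_Icc this).trans ?_
    simp
  have hmain : ENNReal.ofReal (c * r) * ∫⁻ x in W, ‖f (x + k) - f x‖ₑ ^ 2 ≤
      ENNReal.ofReal (c * r) * (4 * (2 * ∫⁻ x, Q x) + 4 * (ENNReal.ofReal (r / c) * B)) := by
    rw [← hcr, ← setLIntegral_band s hη hFm, hcr]
    calc ∫⁻ p in P, ‖f (p.1 + k) - f p.1‖ₑ ^ 2
        ≤ ∫⁻ p in P, 4 * ((Q p.1 + Q (p.1 + k)) + ENNReal.ofReal (r ^ 2) * R p) :=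
          setLIntegral_mono_ae' hPm hpt
      _ = 4 * ((∫⁻ p in P, Q p.1) + (∫⁻ p in P, Q (p.1 + k)) +
          ENNReal.ofReal (r ^ 2) * ∫⁻ p in P, R p) := by
          rw [lintegral_const_mul' _ _ (by simp), lintegral_add_right _ (hRm.const_mul _),
            lintegral_add_left hQ1,
            lintegral_const_mul _ hRm]
      _ ≤ 4 * (ENNReal.ofReal (c * r) * (∫⁻ x, Q x) + ENNReal.ofReal (c * r) * (∫⁻ x, Q x) +
          ENNReal.ofReal (r ^ 2) * B) := by
          have q1 : ∫⁻ p in P, Q p.1 ≤ ENNReal.ofReal (c * r) * ∫⁻ x, Q x := by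
            rw [setLIntegral_band s hη hQm, hcr]
            exact mul_le_mul' le_rfl (setLIntegral_le_lintegral _ _)
          have q2 : ∫⁻ p in P, Q (p.1 + k) ≤ ENNReal.ofReal (c * r) * ∫⁻ x, Q x := by
            rw [setLIntegral_band s hη hQk, hcr, ← lintegral_add_right_eq_self Q k]
            exact mul_le_mul' le_rfl (setLIntegral_le_lintegral _ _)
          gcongr
      _ = _ := by
          have : ENNReal.ofReal (r ^ 2) = ENNReal.ofReal (c * r) * ENNReal.ofReal (r / c) := by
            rw [← ENNReal.ofReal_mul (by positivity)]
            congr 1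
            field_simp
          rw [this]; ring
  have hcr0 : 0 < c * r := by positivity
  -- The width `c r` of the band of crossings appears on both sides and is cancelled.
  rw [ENNReal.mul_le_mul_iff_right (by simpa using hcr0) ENNReal.ofReal_ne_top] at hmain
  refine hmain.trans (le_of_eq ?_)
  rw [← mul_add]
  congr 1
  have hk1 : Measurable fun q : Pt d => (if 0 < q.2 ∧ q.2 < a * r then
      ENNReal.ofReal (4 * √(a * r) * √q.2) else 0) * ‖G (shear s η q)‖ₑ ^ 2 := by
    refine Measurable.mul (Measurable.ite ?_ (by fun_prop) measurable_const) hγm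
    exact (measurableSet_lt measurable_const measurable_snd).inter
      (measurableSet_lt measurable_snd measurable_const)
  simp only [traceKernel, add_mul]
  rw [lintegral_add_left hk1]
  congr 1
  · rw [Measure.volume_eq_prod, lintegral_prod _ hk1.aemeasurable, ← lintegral_const_mul _ hQm]
    refine lintegral_congr fun x => ?_
    have hm2 : Measurable fun z : ℝ => ‖G (shear s η (x, z))‖ₑ ^ 2 :=
      hγm.comp (by fun_prop : Measurable fun z : ℝ => (x, z))
    simp only [hQ]
    rw [← mul_assoc, ← lintegral_const_mul _ (by fun_prop), ← lintegral_indicator measurableSet_Ioo]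
    refine lintegral_congr fun z => ?_
    by_cases hz : 0 < z ∧ z < a * r
    · rw [indicator_of_mem (show z ∈ Ioo 0 (a * r) from hz), if_pos hz, ← mul_assoc]
      congr 1
      have h2 : (2 : ℝ≥0∞) = ENNReal.ofReal 2 := by norm_num
      rw [h2, ← ENNReal.ofReal_mul (by positivity), ← ENNReal.ofReal_mul (by positivity)]
      congr 1; ring
    · rw [indicator_of_notMem (show z ∉ Ioo 0 (a * r) from hz), if_neg hz, zero_mul]
  · rw [hB, ← setLIntegral_shear s hη, ← lintegral_const_mul' _ _ ENNReal.ofReal_ne_top,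
      ← lintegral_indicator ((measurePreserving_shear s hη).measurable hbm)]
    refine lintegral_congr fun q => ?_
    by_cases hq : c * r < q.2 ∧ q.2 < a * r
    · rw [indicator_of_mem (by simpa using hq), if_pos hq]
    · rw [indicator_of_notMem (by simpa using hq), if_neg hq, zero_mul]

end Translate

/-- The constant of the trace inequality. -/
def traceConst (d : ℕ) : ℝ≥0∞ := 4 * (4 * radialConst d (1 / 2) + radialConst d 1)

lemma traceConst_lt_top : traceConst d < ⊤ :=
  ENNReal.mul_lt_top (by simp) (ENNReal.add_lt_top.2
    ⟨ENNReal.mul_lt_top (by simp) (radialConst_lt_top (by norm_num)),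
      radialConst_lt_top (by norm_num)⟩)

/-- The bound on translates is integrated against `|k|^{-d-1}`. By Tonelli the kernel can be
integrated in `k` first, and its integral is bounded uniformly in the height. The parameter `c` is
left free: a large `c` improves the constant but demands a smaller screening function. -/
theorem HasTrace.screenedNorm_sq_le {s : Phase} {η : Horiz d → ℝ} {b : Option (Horiz d → ℝ)}
    {Lη Lβ c : ℝ} {u : Pt d → ℝ} {G : Pt d → Vec d} {f : Horiz d → ℝ}
    (hLη : ∀ x y, |η x - η y| ≤ Lη * ‖x - y‖)
    (hLβ : ∀ β ∈ b, ∀ x y, |β x - β y| ≤ Lβ * ‖x - y‖) (hLη0 : 0 ≤ Lη) (hc : 0 < c) (hc1 : c ≤ 1)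
    (h : MemHDotOne (fluidDomain s η b) u G) (hf : HasTrace s η u f)
    {Θ : Horiz d → ℝ≥0∞} (hΘ : Measurable Θ)
    (hW : ∀ (x k : Horiz d), ‖k‖ₑ < Θ x → ∀ β ∈ b,
      (Lη + Lβ + 2 * c) * ‖k‖ ≤ s.sgn * (β x - η x)) :
    screenedNorm Θ f ^ 2 ≤ traceConst d * ENNReal.ofReal (2 * (Lη + c) / c ^ 2) *
      ∫⁻ p in fluidDomain s η b, ‖G p‖ₑ ^ 2 := by
  have hη : Continuous η := continuous_of_abs_sub_le hLη
  have hb : ∀ β ∈ b, Continuous β := fun β hβ => continuous_of_abs_sub_le (hLβ β hβ)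
  set Ω := fluidDomain s η b with hΩ
  have hΩm : MeasurableSet Ω := (isOpen_fluidDomain s hη hb).measurableSet
  -- Tonelli needs genuinely measurable representatives of the trace and of the gradient, the latter
  -- extended by zero.
  set f' := hf.1.mk f with hf'
  have hff' : f =ᵐ[volume] f' := hf.1.ae_eq_mk
  have hf'm : Measurable f' := hf.1.stronglyMeasurable_mk.measurable
  obtain ⟨G₀, hG₀, hGG₀, -⟩ := h.exists_stronglyMeasurable
  set G' := Ω.indicator G₀ with hG'
  have hGG' : G =ᵐ[volume.restrict Ω] G' := by
    filter_upwards [hGG₀, ae_restrict_mem hΩm] with p hp hpΩ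
    rw [hp, hG', indicator_of_mem hpΩ]
  have h' : MemHDotOne Ω u G' := h.congr (ae_eq_refl _) hGG'
  have hG'm : StronglyMeasurable G' := hG₀.indicator hΩm
  have hS : ∫⁻ p in Ω, ‖G p‖ₑ ^ 2 = ∫⁻ q, ‖G' (shear s η q)‖ₑ ^ 2 := by
    rw [lintegral_shear s hη (fun p => ‖G' p‖ₑ ^ 2), ← lintegral_indicator hΩm]
    have h1 : ∫⁻ p in Ω, ‖G p‖ₑ ^ 2 = ∫⁻ p in Ω, ‖G' p‖ₑ ^ 2 :=
      lintegral_congr_ae (hGG'.mono fun p hp => by simp only [hp])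
    rw [lintegral_indicator hΩm, h1, ← lintegral_indicator hΩm]
    refine lintegral_congr fun p => ?_
    by_cases hp : p ∈ Ω
    · rw [indicator_of_mem hp]
    · rw [indicator_of_notMem hp, hG', indicator_of_notMem hp]; simp
  have hshear : Continuous (shear s η) := (shearHomeo s hη).continuous
  have hγm : Measurable fun q : Pt d => ‖G' (shear s η q)‖ₑ ^ 2 :=
    (hG'm.enorm.comp hshear.measurable).pow_const 2
  have ha0 : 0 < 2 * (Lη + c) := by positivity
  have hKm : Measurable fun r : Horiz d × Pt d => (‖r.1‖ₑ ^ (d + 1))⁻¹ *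
      (traceKernel (2 * (Lη + c)) c r.2.2 ‖r.1‖ * ‖G' (shear s η r.2)‖ₑ ^ 2) := by
    refine Measurable.mul (by fun_prop) (Measurable.mul ?_ (hγm.comp measurable_snd))
    exact (measurable_traceKernel _ c).comp
      (by fun_prop : Measurable fun r : Horiz d × Pt d => (r.2.2, ‖r.1‖))
  rw [screenedNorm_congr Θ hff', screenedNorm_sq_eq hΘ hf'm, hS]
  calc ∫⁻ k : Horiz d, (‖k‖ₑ ^ (d + 1))⁻¹ * ∫⁻ x in {x | ‖k‖ₑ < Θ x}, ‖f' (x + k) - f' x‖ₑ ^ 2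
      ≤ ∫⁻ k : Horiz d, 4 * ∫⁻ q : Pt d, (‖k‖ₑ ^ (d + 1))⁻¹ *
        (traceKernel (2 * (Lη + c)) c q.2 ‖k‖ * ‖G' (shear s η q)‖ₑ ^ 2) := by
        refine lintegral_mono fun k => ?_
        rcases eq_or_ne k 0 with rfl | hk
        · simp
        · have h1 := lintegral_translate_le hLη hLβ hLη0 hc h' hG'm (hf.congr hff') hf'm hk
            (measurableSet_lt (by fun_prop) hΘ : MeasurableSet {x : Horiz d | ‖k‖ₑ < Θ x})
            (fun x hx => hW x k hx)
          have hne : (‖k‖ₑ ^ (d + 1))⁻¹ ≠ ⊤ := by simp [hk]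
          rw [lintegral_const_mul' _ _ hne]
          calc _ ≤ (‖k‖ₑ ^ (d + 1))⁻¹ * (4 * ∫⁻ q : Pt d, traceKernel (2 * (Lη + c)) c q.2 ‖k‖ *
              ‖G' (shear s η q)‖ₑ ^ 2) := by gcongr
            _ = _ := by ring
    _ = 4 * ∫⁻ q : Pt d, ∫⁻ k : Horiz d, (‖k‖ₑ ^ (d + 1))⁻¹ *
        (traceKernel (2 * (Lη + c)) c q.2 ‖k‖ * ‖G' (shear s η q)‖ₑ ^ 2) := by
        rw [lintegral_const_mul' _ _ (by simp), lintegral_lintegral_swap hKm.aemeasurable]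
    _ ≤ 4 * ∫⁻ q : Pt d, ENNReal.ofReal (2 * (Lη + c) / c ^ 2) *
        (4 * radialConst d (1 / 2) + radialConst d 1) * ‖G' (shear s η q)‖ₑ ^ 2 := by
        gcongr with q
        simp only [← mul_assoc]
        rw [lintegral_mul_const]
        · gcongr
          exact (lintegral_traceKernel_le ha0 hc hc1 q.2).trans (by rw [mul_comm])
        · refine Measurable.mul (by fun_prop) ?_
          exact (measurable_traceKernel _ c).comp
            (by fun_prop : Measurable fun k : Horiz d => (q.2, ‖k‖))
    _ = _ := by
        rw [lintegral_const_mul _ hγm, traceConst]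
        ring

/-! ### A weighted Poincaré inequality for the screened spaces -/

/-- The weight `(1 + |x|²)^{-(d+2)}`. -/
def decayWeight (d : ℕ) (x : Horiz d) : ℝ := ((1 + ‖x‖ ^ 2) ^ (d + 2))⁻¹

lemma decayWeight_pos (x : Horiz d) : 0 < decayWeight d x := by unfold decayWeight; positivity

lemma decayWeight_le_one (x : Horiz d) : decayWeight d x ≤ 1 := by
  unfold decayWeight
  refine inv_le_one_of_one_le₀ (one_le_pow₀ ?_)
  nlinarith [sq_nonneg ‖x‖]

lemma continuous_decayWeight : Continuous (decayWeight d) := by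
  unfold decayWeight
  refine Continuous.inv₀ (by fun_prop) fun x => by positivity

lemma decayWeight_le (x : Horiz d) :
    decayWeight d x ≤ 2 ^ (d + 2) * ((1 + ‖x‖) ^ (2 * (d + 2)))⁻¹ := by
  unfold decayWeight
  rw [← div_eq_mul_inv, le_div_iff₀ (by positivity), inv_mul_le_iff₀ (by positivity), pow_mul,
    ← mul_pow]
  refine pow_le_pow_left₀ (by positivity) ?_ _
  nlinarith [sq_nonneg (1 - ‖x‖)]

/-- The uniform probability measure on the ball of radius `r` about the origin. -/
def ballMeasure (d : ℕ) (r : ℝ) : Measure (Horiz d) :=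
  (volume (Metric.ball (0 : Horiz d) r))⁻¹ • volume.restrict (Metric.ball 0 r)

lemma volume_ball_ne {r : ℝ} (hr : 0 < r) : volume (Metric.ball (0 : Horiz d) r) ≠ 0 ∧
    volume (Metric.ball (0 : Horiz d) r) ≠ ⊤ :=
  ⟨(Metric.measure_ball_pos _ _ hr).ne', measure_ball_lt_top.ne⟩

lemma isProbabilityMeasure_ballMeasure {r : ℝ} (hr : 0 < r) :
    IsProbabilityMeasure (ballMeasure d r) := by
  constructor
  obtain ⟨h1, h2⟩ := volume_ball_ne (d := d) hr
  simp [ballMeasure, ENNReal.inv_mul_cancel h1 h2]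

lemma lintegral_ballMeasure (r : ℝ) (F : Horiz d → ℝ≥0∞) :
    ∫⁻ k, F k ∂(ballMeasure d r) =
      (volume (Metric.ball (0 : Horiz d) r))⁻¹ * ∫⁻ k in Metric.ball 0 r, F k := by
  rw [ballMeasure, lintegral_smul_measure, smul_eq_mul]

/-- The mean of `f` over the ball of radius `r` about `x`. -/
def localMean (r : ℝ) (f : Horiz d → ℝ) (x : Horiz d) : ℝ := ∫ k, f (x + k) ∂(ballMeasure d r)

lemma MemL2Loc.integrable_ballMeasure {f : Horiz d → ℝ} (hf : MemL2Loc univ f) {r : ℝ}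
    (hr : 0 < r) (x : Horiz d) : Integrable (fun k => f (x + k)) (ballMeasure d r) := by
  have h1 : IntegrableOn f ((fun k => x + k) '' Metric.closedBall 0 r) :=
    hf.integrableOn ((isCompact_closedBall _ _).image (by fun_prop)) (subset_univ _)
  have h2 : IntegrableOn (fun k => f (x + k)) (Metric.closedBall 0 r) :=
    ((measurePreserving_add_left volume x).integrableOn_image
      (measurableEmbedding_addLeft x)).1 h1
  exact (h2.mono_set Metric.ball_subset_closedBall).integrable.smul_measure
    (ENNReal.inv_ne_top.2 (volume_ball_ne hr).1)

lemma localMean_sub {f g : Horiz d → ℝ} (hf : MemL2Loc univ f) (hg : MemL2Loc univ g) {r : ℝ}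
    (hr : 0 < r) (x : Horiz d) :
    localMean r (fun y => f y - g y) x = localMean r f x - localMean r g x :=
  integral_sub (hf.integrable_ballMeasure hr x) (hg.integrable_ballMeasure hr x)

lemma enorm_sub_integral_sq_le {X : Type*} [MeasurableSpace X] {P : Measure X}
    [IsProbabilityMeasure P] {F : X → ℝ} (hF : Integrable F P) (c : ℝ) :
    ‖c - ∫ x, F x ∂P‖ₑ ^ 2 ≤ ∫⁻ x, ‖c - F x‖ₑ ^ 2 ∂P := by
  have h1 : c - ∫ x, F x ∂P = ∫ x, (c - F x) ∂P := by
    rw [integral_sub (integrable_const c) hF]; simp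
  rw [h1]
  calc ‖∫ x, (c - F x) ∂P‖ₑ ^ 2 ≤ (∫⁻ x, ‖c - F x‖ₑ ∂P) ^ 2 := by
        gcongr; exact enorm_integral_le_lintegral_enorm _
    _ = (∫⁻ x in univ, ‖c - F x‖ₑ ∂P) ^ 2 := by rw [setLIntegral_univ]
    _ ≤ P univ * ∫⁻ x in univ, ‖c - F x‖ₑ ^ 2 ∂P :=
        setLIntegral_sq_le _ (((integrable_const c).sub hF).1.enorm.restrict)
    _ = _ := by simp

/-- The inner integral of the screened norm bounds the unweighted one. -/
lemma lintegral_ball_sq_le (f : Horiz d → ℝ) (x : Horiz d) {δ : ℝ} :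
    ∫⁻ k in Metric.ball (0 : Horiz d) δ, ‖f (x + k) - f x‖ₑ ^ 2 ≤
      ENNReal.ofReal δ ^ (d + 1) * ∫⁻ k in {k : Horiz d | ‖k‖ₑ < ENNReal.ofReal δ},
        ‖f (x + k) - f x‖ₑ ^ 2 / ‖k‖ₑ ^ (d + 1) := by
  have hset : {k : Horiz d | ‖k‖ₑ < ENNReal.ofReal δ} = Metric.ball 0 δ := by
    ext k
    rw [mem_ofPred_eq, mem_ball_zero_iff, ← ofReal_norm, ENNReal.ofReal_lt_ofReal_iff']
    exact ⟨fun h => h.1, fun h => ⟨h, (norm_nonneg k).trans_lt h⟩⟩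
  rw [hset, ← lintegral_const_mul' _ _ (ENNReal.pow_ne_top ENNReal.ofReal_ne_top)]
  refine setLIntegral_mono' measurableSet_ball fun k hk => ?_
  rcases eq_or_ne k 0 with rfl | hk0
  · simp
  · have h1 : ‖k‖ₑ ≤ ENNReal.ofReal δ := by
      rw [← ofReal_norm]
      exact ENNReal.ofReal_le_ofReal (mem_ball_zero_iff.1 hk).le
    have h2 : ‖k‖ₑ ^ (d + 1) ≠ 0 := by simp [hk0]
    have h3 : ‖k‖ₑ ^ (d + 1) ≠ ⊤ := by simp
    calc ‖f (x + k) - f x‖ₑ ^ 2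
        = ‖k‖ₑ ^ (d + 1) * (‖f (x + k) - f x‖ₑ ^ 2 / ‖k‖ₑ ^ (d + 1)) :=
          (ENNReal.mul_div_cancel h2 h3).symm
      _ ≤ _ := by gcongr

section Mean

variable {f : Horiz d → ℝ} {δ : ℝ}

/-- Jensen's inequality, and `|k|^{d+1} ≤ δ^{d+1}` on the range of the screened norm. -/
lemma lintegral_sub_localMean_sq_le (hf : MemL2Loc univ f) (hδ : 0 < δ) :
    ∫⁻ x, ‖f x - localMean (δ / 3) f x‖ₑ ^ 2 ≤
      (volume (Metric.ball (0 : Horiz d) (δ / 3)))⁻¹ * ENNReal.ofReal δ ^ (d + 1) *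
        screenedNorm (fun _ => ENNReal.ofReal δ) f ^ 2 := by
  have hr : 0 < δ / 3 := by positivity
  have := isProbabilityMeasure_ballMeasure (d := d) hr
  have hne : (volume (Metric.ball (0 : Horiz d) (δ / 3)))⁻¹ * ENNReal.ofReal δ ^ (d + 1) ≠ ⊤ :=
    ENNReal.mul_ne_top (ENNReal.inv_ne_top.2 (volume_ball_ne hr).1)
      (ENNReal.pow_ne_top ENNReal.ofReal_ne_top)
  rw [screenedNorm_sq, ← lintegral_const_mul' _ _ hne]
  refine lintegral_mono fun x => ?_
  refine (enorm_sub_integral_sq_le (hf.integrable_ballMeasure hr x) (f x)).trans ?_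
  rw [lintegral_ballMeasure, mul_assoc]
  gcongr
  calc ∫⁻ k in Metric.ball 0 (δ / 3), ‖f x - f (x + k)‖ₑ ^ 2
      = ∫⁻ k in Metric.ball 0 (δ / 3), ‖f (x + k) - f x‖ₑ ^ 2 := by
        simp only [enorm_sub_rev]
    _ ≤ ∫⁻ k in Metric.ball 0 δ, ‖f (x + k) - f x‖ₑ ^ 2 :=
        lintegral_mono_set (Metric.ball_subset_ball (by linarith))
    _ ≤ _ := lintegral_ball_sq_le f x

/-- The constant in the modulus of continuity of local means. -/
def meanConst (d : ℕ) (δ : ℝ) : ℝ≥0∞ :=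
  (volume (Metric.ball (0 : Horiz d) (δ / 3)))⁻¹ ^ 2 * ENNReal.ofReal δ ^ (d + 1)

/-- Jensen's inequality in each of the two averages. The points `x + k` and `x' + k'` are less than
`δ` apart, since `k`, `k'` and `x' - x` each have length at most `δ/3`; so every difference is seen
by the screened norm. -/
lemma localMean_sub_sq_le (hf : MemL2Loc univ f) (hδ : 0 < δ) {x x' : Horiz d}
    (hx : ‖x' - x‖ ≤ δ / 3) :
    ‖localMean (δ / 3) f x' - localMean (δ / 3) f x‖ₑ ^ 2 ≤
      meanConst d δ * screenedNorm (fun _ => ENNReal.ofReal δ) f ^ 2 := by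
  have hr : 0 < δ / 3 := by positivity
  have := isProbabilityMeasure_ballMeasure (d := d) hr
  have hV : (volume (Metric.ball (0 : Horiz d) (δ / 3)))⁻¹ ≠ ⊤ :=
    ENNReal.inv_ne_top.2 (volume_ball_ne hr).1
  have h1 : ∀ k ∈ Metric.ball (0 : Horiz d) (δ / 3),
      ‖localMean (δ / 3) f x' - f (x + k)‖ₑ ^ 2 ≤
      (volume (Metric.ball (0 : Horiz d) (δ / 3)))⁻¹ * (ENNReal.ofReal δ ^ (d + 1) *
        ∫⁻ k' in {k' : Horiz d | ‖k'‖ₑ < ENNReal.ofReal δ},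
        ‖f (x + k + k') - f (x + k)‖ₑ ^ 2 / ‖k'‖ₑ ^ (d + 1)) := by
    intro k hk
    rw [enorm_sub_rev]
    refine (enorm_sub_integral_sq_le (hf.integrable_ballMeasure hr x') (f (x + k))).trans ?_
    rw [lintegral_ballMeasure]
    gcongr
    refine le_trans ?_ (lintegral_ball_sq_le f (x + k))
    rw [← lintegral_indicator measurableSet_ball, ← lintegral_indicator measurableSet_ball,
      ← lintegral_add_right_eq_self ((Metric.ball (0 : Horiz d) δ).indicator
        fun k' => ‖f (x + k + k') - f (x + k)‖ₑ ^ 2) (x' - x - k)]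
    refine lintegral_mono fun k' => ?_
    by_cases hk' : k' ∈ Metric.ball (0 : Horiz d) (δ / 3)
    · have h2 : k' + (x' - x - k) ∈ Metric.ball (0 : Horiz d) δ := by
        rw [mem_ball_zero_iff] at hk hk' ⊢
        have h3 := norm_add_le k' (x' - x - k)
        have h4 := norm_sub_le (x' - x) k
        linarith
      have h5 : x + k + (k' + (x' - x - k)) = x' + k' := by abel
      rw [indicator_of_mem hk', indicator_of_mem h2, h5, enorm_sub_rev]
    · rw [indicator_of_notMem hk']; exact zero_le
  refine (enorm_sub_integral_sq_le (hf.integrable_ballMeasure hr x) _).trans ?_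
  rw [lintegral_ballMeasure]
  calc _ ≤ (volume (Metric.ball (0 : Horiz d) (δ / 3)))⁻¹ * ∫⁻ k in Metric.ball 0 (δ / 3),
      (volume (Metric.ball (0 : Horiz d) (δ / 3)))⁻¹ * (ENNReal.ofReal δ ^ (d + 1) *
        ∫⁻ k' in {k' : Horiz d | ‖k'‖ₑ < ENNReal.ofReal δ},
        ‖f (x + k + k') - f (x + k)‖ₑ ^ 2 / ‖k'‖ₑ ^ (d + 1)) :=
        mul_le_mul' le_rfl (setLIntegral_mono' measurableSet_ball h1)
    _ ≤ (volume (Metric.ball (0 : Horiz d) (δ / 3)))⁻¹ * ∫⁻ k,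
      (volume (Metric.ball (0 : Horiz d) (δ / 3)))⁻¹ * (ENNReal.ofReal δ ^ (d + 1) *
        ∫⁻ k' in {k' : Horiz d | ‖k'‖ₑ < ENNReal.ofReal δ},
        ‖f (x + k + k') - f (x + k)‖ₑ ^ 2 / ‖k'‖ₑ ^ (d + 1)) :=
        mul_le_mul' le_rfl (setLIntegral_le_lintegral _ _)
    _ = _ := by
        rw [lintegral_const_mul' _ _ hV, lintegral_const_mul' _ _
          (ENNReal.pow_ne_top ENNReal.ofReal_ne_top), screenedNorm_sq,
          lintegral_add_left_eq_self (fun y => ∫⁻ k' in {k' : Horiz d | ‖k'‖ₑ < ENNReal.ofReal δ},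
            ‖f (y + k') - f y‖ₑ ^ 2 / ‖k'‖ₑ ^ (d + 1)) x, meanConst]
        ring

/-- A chain of `n` steps of length at most `δ/3` on the ray from the origin. The induction passes
from `n x/(n+1)` to `x`. -/
lemma localMean_sub_le_nat (hf : MemL2Loc univ f) (hδ : 0 < δ) {B : ℝ≥0∞}
    (hB : meanConst d δ * screenedNorm (fun _ => ENNReal.ofReal δ) f ^ 2 ≤ B ^ 2) (n : ℕ) :
    ∀ x : Horiz d, ‖x‖ ≤ n * (δ / 3) →
      ‖localMean (δ / 3) f x - localMean (δ / 3) f 0‖ₑ ≤ n * B := by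
  induction n with
  | zero =>
    intro x hx
    have : x = 0 := by simpa using hx
    simp [this]
  | succ n ih =>
    intro x hx
    have hn : (0 : ℝ) < (n : ℝ) + 1 := by positivity
    push_cast at hx
    set x' : Horiz d := ((n : ℝ) / (n + 1)) • x with hx'
    have h1 : ‖x'‖ ≤ n * (δ / 3) := by
      rw [hx', norm_smul, Real.norm_of_nonneg (by positivity), div_mul_eq_mul_div,
        div_le_iff₀ hn]
      nlinarith [(by positivity : (0 : ℝ) ≤ n)]
    have h2 : ‖x - x'‖ ≤ δ / 3 := by
      have : x - x' = ((1 : ℝ) / (n + 1)) • x := by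
        nth_rewrite 1 [hx', ← one_smul ℝ x]
        rw [← sub_smul]
        congr 1
        field_simp
        ring
      rw [this, norm_smul, Real.norm_of_nonneg (by positivity), div_mul_eq_mul_div,
        div_le_iff₀ hn]
      linarith
    have h3 : ‖localMean (δ / 3) f x - localMean (δ / 3) f x'‖ₑ ≤ B :=
      (ENNReal.pow_le_pow_left_iff two_ne_zero).1 ((localMean_sub_sq_le hf hδ h2).trans hB)
    calc ‖localMean (δ / 3) f x - localMean (δ / 3) f 0‖ₑ
        = ‖(localMean (δ / 3) f x' - localMean (δ / 3) f 0) +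
          (localMean (δ / 3) f x - localMean (δ / 3) f x')‖ₑ := by congr 1; ring
      _ ≤ n * B + B := (enorm_add_le _ _).trans (add_le_add (ih x' h1) h3)
      _ = _ := by push_cast; ring

lemma localMean_sub_zero_sq_le (hf : MemL2Loc univ f) (hδ : 0 < δ) (x : Horiz d) :
    ‖localMean (δ / 3) f x - localMean (δ / 3) f 0‖ₑ ^ 2 ≤
      ENNReal.ofReal ((3 / δ + 1) ^ 2 * (1 + ‖x‖) ^ 2) *
        (meanConst d δ * screenedNorm (fun _ => ENNReal.ofReal δ) f ^ 2) := by
  set N := meanConst d δ * screenedNorm (fun _ => ENNReal.ofReal δ) f ^ 2 with hN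
  have h1 := localMean_sub_le_nat hf hδ (B := N ^ (1 / 2 : ℝ)) (rpow_half_sq N).ge
    ⌈‖x‖ / (δ / 3)⌉₊ x (by
      rw [← div_le_iff₀ (by positivity)]
      exact Nat.le_ceil _)
  calc _ ≤ ((⌈‖x‖ / (δ / 3)⌉₊ : ℝ≥0∞) * N ^ (1 / 2 : ℝ)) ^ 2 := by gcongr
    _ = (⌈‖x‖ / (δ / 3)⌉₊ : ℝ≥0∞) ^ 2 * N := by rw [mul_pow, rpow_half_sq]
    _ ≤ _ := by
      gcongr
      rw [← ENNReal.ofReal_natCast, ← ENNReal.ofReal_pow (by positivity), ← mul_pow]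
      refine ENNReal.ofReal_le_ofReal (pow_le_pow_left₀ (by positivity) ?_ 2)
      have h2 := Nat.ceil_lt_add_one (a := ‖x‖ / (δ / 3)) (by positivity)
      have h3 : ‖x‖ / (δ / 3) = (3 / δ) * ‖x‖ := by field_simp
      have h4 : 0 < 3 / δ := by positivity
      rw [h3] at h2 ⊢
      nlinarith [norm_nonneg x]

end Mean

lemma lintegral_weight_lt_top :
    ∫⁻ x : Horiz d, ENNReal.ofReal (decayWeight d x * (1 + ‖x‖) ^ 2) < ⊤ := by
  have h1 := finite_integral_one_add_norm (E := Horiz d) (μ := volume) (r := (2 * d + 2 : ℕ))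
    (by rw [finrank_euclideanSpace_fin]; push_cast; linarith [(by positivity : (0:ℝ) ≤ d)])
  have h2 : ∀ x : Horiz d, ENNReal.ofReal (decayWeight d x * (1 + ‖x‖) ^ 2) ≤
      ENNReal.ofReal (2 ^ (d + 2)) * ENNReal.ofReal ((1 + ‖x‖) ^ (-((2 * d + 2 : ℕ) : ℝ))) := by
    intro x
    rw [← ENNReal.ofReal_mul (by positivity)]
    refine ENNReal.ofReal_le_ofReal ?_
    calc decayWeight d x * (1 + ‖x‖) ^ 2
        ≤ 2 ^ (d + 2) * ((1 + ‖x‖) ^ (2 * (d + 2)))⁻¹ * (1 + ‖x‖) ^ 2 := by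
          gcongr; exact decayWeight_le x
      _ = _ := by
        have hx : (1 + ‖x‖) ≠ 0 := by positivity
        rw [Real.rpow_neg (by positivity), Real.rpow_natCast]
        have : 2 * (d + 2) = (2 * d + 2) + 2 := by ring
        rw [this, pow_add _ (2 * d + 2)]
        field_simp
  refine (lintegral_mono h2).trans_lt ?_
  rw [lintegral_const_mul' _ _ ENNReal.ofReal_ne_top]
  exact ENNReal.mul_lt_top ENNReal.ofReal_lt_top h1

lemma enorm_decayWeight_sq_le (x : Horiz d) :
    ‖decayWeight d x‖ₑ ^ 2 ≤ ENNReal.ofReal (decayWeight d x) := by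
  rw [← ofReal_norm, Real.norm_of_nonneg (decayWeight_pos x).le,
    ← ENNReal.ofReal_pow (decayWeight_pos x).le]
  refine ENNReal.ofReal_le_ofReal ?_
  nlinarith [decayWeight_pos x, decayWeight_le_one x]

lemma memLp_decayWeight : MemLp (decayWeight d) 2 volume := by
  refine memLp_two_iff.2 ⟨continuous_decayWeight.aestronglyMeasurable, ?_⟩
  refine (lintegral_mono fun x => (enorm_decayWeight_sq_le x).trans
    (ENNReal.ofReal_le_ofReal ?_)).trans_lt (lintegral_weight_lt_top (d := d))
  exact le_mul_of_one_le_right (decayWeight_pos x).le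
    (one_le_pow₀ (by linarith [norm_nonneg x]))

/-- A function differs from its local means by an `L²` function, while the local means grow at most
linearly, by chaining. The weight makes linear growth square integrable, with room to spare for the
dimension. -/
theorem exists_weighted_poincare {δ : ℝ} (hδ : 0 < δ) :
    ∃ C : ℝ≥0∞, C ≠ ⊤ ∧ ∀ f : Horiz d → ℝ, MemL2Loc univ f →
      ∫⁻ x, ‖decayWeight d x * (f x - localMean (δ / 3) f 0)‖ₑ ^ 2 ≤
        C * screenedNorm (fun _ => ENNReal.ofReal δ) f ^ 2 := by
  have hr : 0 < δ / 3 := by positivity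
  have hV : (volume (Metric.ball (0 : Horiz d) (δ / 3)))⁻¹ ≠ ⊤ :=
    ENNReal.inv_ne_top.2 (volume_ball_ne hr).1
  set A := (volume (Metric.ball (0 : Horiz d) (δ / 3)))⁻¹ * ENNReal.ofReal δ ^ (d + 1) with hA
  set W := ∫⁻ x : Horiz d, ENNReal.ofReal (decayWeight d x * (1 + ‖x‖) ^ 2) with hW
  have hAt : A ≠ ⊤ := ENNReal.mul_ne_top hV (ENNReal.pow_ne_top ENNReal.ofReal_ne_top)
  have hMt : meanConst d δ ≠ ⊤ := ENNReal.mul_ne_top (ENNReal.pow_ne_top hV)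
    (ENNReal.pow_ne_top ENNReal.ofReal_ne_top)
  refine ⟨2 * (A + W * (ENNReal.ofReal ((3 / δ + 1) ^ 2) * meanConst d δ)),
    ENNReal.mul_ne_top (by simp) (ENNReal.add_ne_top.2 ⟨hAt, ENNReal.mul_ne_top
      lintegral_weight_lt_top.ne (ENNReal.mul_ne_top ENNReal.ofReal_ne_top hMt)⟩), ?_⟩
  intro f hf
  set N := screenedNorm (fun _ => ENNReal.ofReal δ) f ^ 2 with hN
  have hpt : ∀ x, ‖decayWeight d x * (f x - localMean (δ / 3) f 0)‖ₑ ^ 2 ≤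
      2 * (‖f x - localMean (δ / 3) f x‖ₑ ^ 2 + ENNReal.ofReal (decayWeight d x * (1 + ‖x‖) ^ 2) *
        (ENNReal.ofReal ((3 / δ + 1) ^ 2) * meanConst d δ * N)) := by
    intro x
    have e1 : f x - localMean (δ / 3) f 0 = (f x - localMean (δ / 3) f x) +
      (localMean (δ / 3) f x - localMean (δ / 3) f 0) := by ring
    rw [enorm_mul, mul_pow, e1]
    calc _ ≤ ENNReal.ofReal (decayWeight d x) * (2 * (‖f x - localMean (δ / 3) f x‖ₑ ^ 2 +
          ‖localMean (δ / 3) f x - localMean (δ / 3) f 0‖ₑ ^ 2)) := by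
          gcongr
          · exact enorm_decayWeight_sq_le x
          · exact (pow_le_pow_left' (enorm_add_le _ _) 2).trans (ennreal_add_sq_le _ _)
      _ = 2 * (ENNReal.ofReal (decayWeight d x) * ‖f x - localMean (δ / 3) f x‖ₑ ^ 2 +
          ENNReal.ofReal (decayWeight d x) *
            ‖localMean (δ / 3) f x - localMean (δ / 3) f 0‖ₑ ^ 2) := by ring
      _ ≤ 2 * (1 * ‖f x - localMean (δ / 3) f x‖ₑ ^ 2 + ENNReal.ofReal (decayWeight d x) *
          (ENNReal.ofReal ((3 / δ + 1) ^ 2 * (1 + ‖x‖) ^ 2) * (meanConst d δ * N))) := by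
          gcongr
          · exact ENNReal.ofReal_le_one.2 (decayWeight_le_one x)
          · exact localMean_sub_zero_sq_le hf hδ x
      _ = _ := by
          rw [one_mul, ENNReal.ofReal_mul (by positivity),
            ENNReal.ofReal_mul (decayWeight_pos x).le]
          ring
  calc _ ≤ _ := lintegral_mono hpt
    _ = 2 * ((∫⁻ x, ‖f x - localMean (δ / 3) f x‖ₑ ^ 2) + W *
        (ENNReal.ofReal ((3 / δ + 1) ^ 2) * meanConst d δ * N)) := by
        have hm : Measurable fun x : Horiz d =>
            ENNReal.ofReal (decayWeight d x * (1 + ‖x‖) ^ 2) :=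
          (continuous_decayWeight.mul (by fun_prop)).measurable.ennreal_ofReal
        rw [lintegral_const_mul' _ _ (by simp), lintegral_add_right _ (hm.mul_const _),
          lintegral_mul_const _ hm]
    _ ≤ 2 * (A * N + W * (ENNReal.ofReal ((3 / δ + 1) ^ 2) * meanConst d δ * N)) := by
        gcongr
        exact lintegral_sub_localMean_sq_le hf hδ
    _ = _ := by ring

/-! ### Temperedness -/

/-- The function is a polynomial times an element of `L²`, and tempered distributions are stable
under multiplication by functions of temperate growth. -/
lemma isTempered_of_memLp {f : Horiz d → ℝ}
    (hf : MemLp (fun x => decayWeight d x * f x) 2 volume) : IsTempered f := by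
  have hF : MemLp (fun x => ((decayWeight d x * f x : ℝ) : ℂ)) 2 volume := hf.ofReal
  set w : Horiz d → ℂ := fun x => (((1 + ‖x‖ ^ 2) ^ (d + 2) : ℝ) : ℂ) with hw
  have hwt : w.HasTemperateGrowth := by
    have h1 : (fun x : Horiz d => (1 + ‖x‖ ^ 2) ^ (d + 2)).HasTemperateGrowth :=
      ((Function.HasTemperateGrowth.const (1 : ℝ)).add
        (Function.hasTemperateGrowth_norm_sq (Horiz d))).pow (d + 2)
    exact Function.HasTemperateGrowth.comp Function.Complex.hasTemperateGrowth_ofReal h1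
  refine ⟨TemperedDistribution.smulLeftCLM ℂ w (Lp.toTemperedDistribution hF.toLp), ?_⟩
  intro φ _
  rw [TemperedDistribution.smulLeftCLM_apply_apply, Lp.toTemperedDistribution_apply]
  refine integral_congr_ae ?_
  filter_upwards [hF.coeFn_toLp] with x hx
  rw [hx, SchwartzMap.smulLeftCLM_apply_apply hwt]
  have h2 : ((1 : ℂ) + (‖x‖ : ℂ) ^ 2) ^ (d + 2) ≠ 0 := by
    have : (0 : ℝ) < (1 + ‖x‖ ^ 2) ^ (d + 2) := by positivity
    exact_mod_cast this.ne'
  simp only [hw, decayWeight, smul_eq_mul]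
  push_cast
  field_simp

/-! ### Averages against a tent function -/

/-- The tent function `max(0, 1 - |k|)`. -/
def tent (k : Horiz d) : ℝ := max 0 (1 - ‖k‖)

lemma continuous_tent : Continuous (tent (d := d)) := by unfold tent; fun_prop

lemma tent_nonneg (k : Horiz d) : 0 ≤ tent k := le_max_left _ _

lemma tent_eq_zero {k : Horiz d} (hk : 1 ≤ ‖k‖) : tent k = 0 := max_eq_left (by linarith)

lemma hasCompactSupport_tent : HasCompactSupport (tent (d := d)) := by
  refine HasCompactSupport.intro (isCompact_closedBall (0 : Horiz d) 1) fun k hk => ?_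
  rw [mem_closedBall_zero_iff, not_le] at hk
  exact tent_eq_zero hk.le

lemma integrable_tent_mul {g : Horiz d → ℝ} (hg : Continuous g) :
    Integrable fun k => tent k * g k :=
  (continuous_tent.mul hg).integrable_of_hasCompactSupport hasCompactSupport_tent.mul_right

/-- The integral of the tent function. -/
def tentMass (d : ℕ) : ℝ := ∫ k : Horiz d, tent k

lemma tentMass_pos : 0 < tentMass d := by
  refine continuous_tent.integral_pos_of_hasCompactSupport_nonneg_nonzero hasCompactSupport_tent
    tent_nonneg (x := 0) ?_
  simp [tent]

/-- The average of `η` about `x` at scale `z`. -/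
def tentAverage (η : Horiz d → ℝ) (x : Horiz d) (z : ℝ) : ℝ :=
  (tentMass d)⁻¹ * ∫ k, tent k * η (x + z • k)

lemma tentAverage_zero (η : Horiz d → ℝ) (x : Horiz d) : tentAverage η x 0 = η x := by
  simp only [tentAverage, zero_smul, add_zero, integral_mul_const]
  rw [← mul_assoc, ← tentMass, inv_mul_cancel₀ tentMass_pos.ne', one_mul]

lemma tentAverage_sub_const {η : Horiz d → ℝ} (hη : Continuous η) (x : Horiz d) (z c : ℝ) :
    tentAverage η x z - c = (tentMass d)⁻¹ * ∫ k, tent k * (η (x + z • k) - c) := by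
  have h1 : ∫ k : Horiz d, tent k * (η (x + z • k) - c) =
      (∫ k, tent k * η (x + z • k)) - tentMass d * c := by
    simp only [mul_sub]
    rw [integral_sub (integrable_tent_mul (by fun_prop)) (integrable_tent_mul (by fun_prop)),
      integral_mul_const, tentMass]
  rw [h1, mul_sub, ← mul_assoc, inv_mul_cancel₀ tentMass_pos.ne', one_mul, tentAverage]

lemma abs_tent_average_le {g : Horiz d → ℝ} {B : ℝ}
    (hB : ∀ k : Horiz d, ‖k‖ ≤ 1 → |g k| ≤ B) :
    |(tentMass d)⁻¹ * ∫ k, tent k * g k| ≤ B := by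
  have h1 : |∫ k, tent k * g k| ≤ ∫ k : Horiz d, tent k * B := by
    rw [← Real.norm_eq_abs]
    refine norm_integral_le_of_norm_le (integrable_tent_mul continuous_const)
      (ae_of_all _ fun k => ?_)
    rw [Real.norm_eq_abs, abs_mul, abs_of_nonneg (tent_nonneg k)]
    rcases le_total ‖k‖ 1 with hk | hk
    · exact mul_le_mul_of_nonneg_left (hB k hk) (tent_nonneg k)
    · simp [tent_eq_zero hk]
  rw [integral_mul_const, ← tentMass] at h1
  rw [abs_mul, abs_of_pos (inv_pos.2 tentMass_pos), inv_mul_le_iff₀ tentMass_pos]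
  exact h1

lemma abs_tentAverage_le {η : Horiz d → ℝ} {M : ℝ} (hM : ∀ x, |η x| ≤ M) (x : Horiz d) (z : ℝ) :
    |tentAverage η x z| ≤ M := abs_tent_average_le fun _ _ => hM _

lemma abs_tentAverage_sub_le {η : Horiz d → ℝ} {K : ℝ} (hK0 : 0 ≤ K)
    (hK : ∀ x y, |η x - η y| ≤ K * ‖x - y‖) (x x' : Horiz d) (z z' : ℝ) :
    |tentAverage η x z - tentAverage η x' z'| ≤ K * (‖x - x'‖ + |z - z'|) := by
  have hη : Continuous η := continuous_of_abs_sub_le hK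
  have h1 : tentAverage η x z - tentAverage η x' z' =
      (tentMass d)⁻¹ * ∫ k, tent k * (η (x + z • k) - η (x' + z' • k)) := by
    simp only [mul_sub]
    rw [integral_sub (integrable_tent_mul (by fun_prop)) (integrable_tent_mul (by fun_prop)),
      mul_sub, tentAverage, tentAverage]
  rw [h1]
  refine abs_tent_average_le fun k hk => (hK _ _).trans ?_
  gcongr
  have h2 : x + z • k - (x' + z' • k) = (x - x') + (z - z') • k := by rw [sub_smul]; abel
  rw [h2]
  refine (norm_add_le _ _).trans ?_
  gcongr
  rw [norm_smul, Real.norm_eq_abs]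
  exact mul_le_of_le_one_right (abs_nonneg _) hk

/-- The averaging kernel at scale `z`. -/
def tentKernel (d : ℕ) (z : ℝ) (k : Horiz d) : ℝ :=
  (tentMass d)⁻¹ * (z ^ (d + 1))⁻¹ * max 0 (z - ‖k‖)

lemma continuous_tentKernel (z : ℝ) : Continuous (tentKernel d z) := by
  unfold tentKernel; fun_prop

lemma tentKernel_eq_zero {z : ℝ} {k : Horiz d} (hk : z ≤ ‖k‖) : tentKernel d z k = 0 := by
  simp [tentKernel, max_eq_left (sub_nonpos.2 hk)]

/-- The free base point `x₀` lets averages about different points, at different scales, be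
subtracted under one integral sign. -/
lemma tentAverage_sub_const_eq {η : Horiz d → ℝ} (hη : Continuous η) (x x₀ : Horiz d) {z : ℝ}
    (hz : 0 < z) (c : ℝ) :
    tentAverage η x z - c = ∫ k, tentKernel d z (x₀ + k - x) * (η (x₀ + k) - c) := by
  rw [tentAverage_sub_const hη]
  have h1 := Measure.integral_comp_smul (volume : Measure (Horiz d))
    (fun k => tent (z⁻¹ • k) * (η (x + k) - c)) z
  simp only [smul_smul, inv_mul_cancel₀ hz.ne', one_smul, finrank_euclideanSpace_fin] at h1
  rw [h1, abs_of_pos (by positivity), smul_eq_mul, ← mul_assoc, ← integral_const_mul]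
  have h3 : ∫ k, tentKernel d z (x₀ + k - x) * (η (x₀ + k) - c) =
      ∫ k, tentKernel d z (x + k - x) * (η (x + k) - c) :=
    (integral_add_left_eq_self (fun k => tentKernel d z (k - x) * (η k - c)) x₀).trans
      (integral_add_left_eq_self (fun k => tentKernel d z (k - x) * (η k - c)) x).symm
  rw [h3]
  refine integral_congr_ae (ae_of_all _ fun k => ?_)
  simp only [add_sub_cancel_left, tentKernel, tent]
  have h2 : max 0 (z - ‖k‖) = z * max 0 (1 - ‖z⁻¹ • k‖) := by
    rw [mul_max_of_nonneg _ _ hz.le, mul_zero, norm_smul, norm_inv, Real.norm_of_nonneg hz.le,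
      mul_sub, ← mul_assoc, mul_inv_cancel₀ hz.ne', one_mul, mul_one]
  rw [h2, pow_succ]
  field_simp

/-- The kernel is a product of `z^{-(d+1)}` and `max(0, z - |k|)`. The second factor is 1-Lipschitz;
a change of the first costs `1/z`, which the bound `z` for the second compensates. The hypothesis on
`z'` keeps both scales comparable. -/
lemma abs_tentKernel_sub_le {z z' : ℝ} (hz : 0 < z) (hzz' : |z' - z| ≤ z / 2) (k k' : Horiz d) :
    |tentKernel d z' k' - tentKernel d z k| ≤
      (tentMass d)⁻¹ * (2 ^ (d + 1) + (d + 1) * 4 ^ (d + 1)) * (z ^ (d + 1))⁻¹ *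
        (‖k' - k‖ + |z' - z|) := by
  have h0 := abs_le.1 hzz'
  have hz' : 0 < z' := by linarith
  have hm := inv_pos.2 (tentMass_pos (d := d))
  set n := d + 1 with hn
  have hzn : 0 < z ^ n := by positivity
  have hz'n : 0 < z' ^ n := by positivity
  have hinv : (z' ^ n)⁻¹ ≤ 2 ^ n * (z ^ n)⁻¹ := by
    rw [← div_eq_mul_inv, le_div_iff₀ hzn, inv_mul_le_iff₀ hz'n, ← mul_pow]
    exact pow_le_pow_left₀ hz.le (by linarith) n
  have hmax : |max 0 (z' - ‖k'‖) - max 0 (z - ‖k‖)| ≤ ‖k' - k‖ + |z' - z| := by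
    have h1 := abs_max_sub_max_le_max 0 (z' - ‖k'‖) 0 (z - ‖k‖)
    rw [sub_self, abs_zero, max_eq_right (abs_nonneg (z' - ‖k'‖ - (z - ‖k‖)))] at h1
    refine h1.trans ?_
    have h2 : z' - ‖k'‖ - (z - ‖k‖) = (z' - z) - (‖k'‖ - ‖k‖) := by ring
    rw [h2, add_comm]
    exact (abs_sub _ _).trans (add_le_add le_rfl (abs_norm_sub_norm_le _ _))
  have hpow : |(z' ^ n)⁻¹ - (z ^ n)⁻¹| * z ≤ n * 4 ^ n * (z ^ n)⁻¹ * |z' - z| := by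
    have h1 : (z' ^ n)⁻¹ - (z ^ n)⁻¹ = (z ^ n - z' ^ n) * ((z' ^ n)⁻¹ * (z ^ n)⁻¹) := by
      field_simp
    have h2 : |z ^ n - z' ^ n| ≤ |z' - z| * n * (2 * z) ^ (n - 1) := by
      refine (abs_pow_sub_pow_le z z' n).trans ?_
      rw [abs_sub_comm z z']
      refine mul_le_mul_of_nonneg_left (pow_le_pow_left₀ (by positivity) ?_ _) (by positivity)
      rw [abs_of_pos hz, abs_of_pos hz']
      exact max_le (by linarith) (by linarith)
    have h3 : (2 * z) ^ (n - 1) * z ≤ 2 ^ n * z ^ n := by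
      rw [hn, Nat.add_sub_cancel, mul_pow, mul_assoc, ← pow_succ]
      refine mul_le_mul_of_nonneg_right ?_ (by positivity)
      exact pow_le_pow_right₀ (by norm_num) (by omega)
    rw [h1, abs_mul, abs_of_pos (mul_pos (inv_pos.2 hz'n) (inv_pos.2 hzn))]
    calc |z ^ n - z' ^ n| * ((z' ^ n)⁻¹ * (z ^ n)⁻¹) * z
        ≤ (|z' - z| * n * (2 * z) ^ (n - 1)) * ((2 ^ n * (z ^ n)⁻¹) * (z ^ n)⁻¹) * z := by
          gcongr
      _ = |z' - z| * n * ((2 * z) ^ (n - 1) * z) * (2 ^ n * (z ^ n)⁻¹ * (z ^ n)⁻¹) := by ring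
      _ ≤ |z' - z| * n * (2 ^ n * z ^ n) * (2 ^ n * (z ^ n)⁻¹ * (z ^ n)⁻¹) := by gcongr
      _ = |z' - z| * n * ((2 ^ n * 2 ^ n) * (z ^ n)⁻¹) * (z ^ n * (z ^ n)⁻¹) := by ring
      _ = _ := by
        rw [mul_inv_cancel₀ hzn.ne', ← mul_pow]
        norm_num
        ring
  have hsplit : tentKernel d z' k' - tentKernel d z k =
      (tentMass d)⁻¹ * ((z' ^ n)⁻¹ * (max 0 (z' - ‖k'‖) - max 0 (z - ‖k‖)) +
        ((z' ^ n)⁻¹ - (z ^ n)⁻¹) * max 0 (z - ‖k‖)) := by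
    simp only [tentKernel, ← hn]; ring
  rw [hsplit, abs_mul, abs_of_pos hm, mul_assoc, mul_assoc]
  refine mul_le_mul_of_nonneg_left ((abs_add_le _ _).trans ?_) hm.le
  rw [abs_mul, abs_mul, abs_of_pos (inv_pos.2 hz'n), abs_of_nonneg (le_max_left 0 (z - ‖k‖))]
  have hmz : max 0 (z - ‖k‖) ≤ z := max_le hz.le (by linarith [norm_nonneg k])
  calc (z' ^ n)⁻¹ * |max 0 (z' - ‖k'‖) - max 0 (z - ‖k‖)| +
        |(z' ^ n)⁻¹ - (z ^ n)⁻¹| * max 0 (z - ‖k‖)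
      ≤ (2 ^ n * (z ^ n)⁻¹) * (‖k' - k‖ + |z' - z|) + n * 4 ^ n * (z ^ n)⁻¹ * |z' - z| := by
        refine add_le_add (mul_le_mul hinv hmax (abs_nonneg _) (by positivity)) ?_
        exact (mul_le_mul_of_nonneg_left hmz (abs_nonneg _)).trans hpow
    _ ≤ (2 ^ n * (z ^ n)⁻¹) * (‖k' - k‖ + |z' - z|) +
        n * 4 ^ n * (z ^ n)⁻¹ * (‖k' - k‖ + |z' - z|) := by
        gcongr
        linarith [norm_nonneg (k' - k)]
    _ = _ := by rw [hn]; push_cast; ring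

/-- The mean oscillation of `η` at scale `z`, divided by `z`. -/
def oscillation (η : Horiz d → ℝ) (x : Horiz d) (z : ℝ) : ℝ :=
  (z ^ (d + 1))⁻¹ * ∫ k in Metric.ball (0 : Horiz d) (2 * z), |η (x + k) - η x|

lemma oscillation_nonneg (η : Horiz d → ℝ) (x : Horiz d) {z : ℝ} (hz : 0 < z) :
    0 ≤ oscillation η x z :=
  mul_nonneg (by positivity) (integral_nonneg fun _ => abs_nonneg _)

/-- An integral against a kernel supported in a ball. -/
lemma abs_integral_kernel_le {η : Horiz d → ℝ} (hη : Continuous η) (x : Horiz d) {z : ℝ}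
    {ψ : Horiz d → ℝ} {B : ℝ} (hψ0 : ∀ k, 2 * z ≤ ‖k‖ → ψ k = 0)
    (hψ : ∀ k, |ψ k| ≤ B * (z ^ (d + 1))⁻¹) :
    |∫ k, ψ k * (η (x + k) - η x)| ≤ B * oscillation η x z := by
  have hint : IntegrableOn (fun k => |η (x + k) - η x|) (Metric.ball (0 : Horiz d) (2 * z)) := by
    have : Continuous fun k => |η (x + k) - η x| := by fun_prop
    exact (this.continuousOn.integrableOn_compact (isCompact_closedBall _ _)).mono_set
      Metric.ball_subset_closedBall
  have h1 : |∫ k, ψ k * (η (x + k) - η x)| ≤ ∫ k, (Metric.ball (0 : Horiz d) (2 * z)).indicator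
      (fun k => B * (z ^ (d + 1))⁻¹ * |η (x + k) - η x|) k := by
    rw [← Real.norm_eq_abs]
    refine norm_integral_le_of_norm_le
      ((integrable_indicator_iff measurableSet_ball).2 (hint.const_mul _))
      (ae_of_all _ fun k => ?_)
    by_cases hk : k ∈ Metric.ball (0 : Horiz d) (2 * z)
    · rw [indicator_of_mem hk, Real.norm_eq_abs, abs_mul]
      exact mul_le_mul_of_nonneg_right (hψ k) (abs_nonneg _)
    · rw [mem_ball_zero_iff, not_lt] at hk
      rw [hψ0 k hk]
      simp only [zero_mul, norm_zero]
      refine indicator_nonneg (fun k _ => ?_) _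
      exact mul_nonneg ((abs_nonneg _).trans (hψ k)) (abs_nonneg _)
  rw [integral_indicator measurableSet_ball, integral_const_mul] at h1
  rw [oscillation, ← mul_assoc]
  exact h1

/-- The constant in the local Lipschitz estimate for averages. -/
def tentLipConst (d : ℕ) : ℝ := (tentMass d)⁻¹ * (2 ^ (d + 1) + (d + 1) * 4 ^ (d + 1))

lemma tentLipConst_pos : 0 < tentLipConst d :=
  mul_pos (inv_pos.2 tentMass_pos) (by positivity)

/-- The constant `η x` can be subtracted from both averages, so only the difference of the kernels,
integrated against the oscillation of `η` about `x`, remains. Both kernels vanish for `|k| ≥ 2z`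
because `z' + |x' - x| ≤ 3z/2`. -/
lemma abs_tentAverage_sub_le_oscillation {η : Horiz d → ℝ} (hη : Continuous η) {x x' : Horiz d}
    {z z' : ℝ} (hz : 0 < z) (hclose : ‖x' - x‖ + |z' - z| ≤ z / 2) :
    |tentAverage η x' z' - tentAverage η x z| ≤
      tentLipConst d * (‖x' - x‖ + |z' - z|) * oscillation η x z := by
  have hzz : |z' - z| ≤ z / 2 := by linarith [norm_nonneg (x' - x)]
  have hz' : 0 < z' := by linarith [(abs_le.1 hzz).1]
  have h1 := tentAverage_sub_const_eq hη x' x hz' (η x)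
  have h2 := tentAverage_sub_const_eq hη x x hz (η x)
  have hint : ∀ (w : ℝ) (y : Horiz d),
      Integrable fun k => tentKernel d w (x + k - y) * (η (x + k) - η x) := by
    intro w y
    refine Continuous.integrable_of_hasCompactSupport
      (((continuous_tentKernel w).comp (by fun_prop)).mul (by fun_prop)) ?_
    refine HasCompactSupport.intro (isCompact_closedBall (0 : Horiz d) (|w| + ‖y - x‖))
      fun k hk => ?_
    rw [mem_closedBall_zero_iff, not_le] at hk
    have h3 : w ≤ ‖x + k - y‖ := by
      have h4 : k = (x + k - y) + (y - x) := by abel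
      have h5 : ‖k‖ ≤ ‖x + k - y‖ + ‖y - x‖ := by
        conv_lhs => rw [h4]
        exact norm_add_le _ _
      linarith [le_abs_self w]
    simp [tentKernel_eq_zero h3]
  have h3 : tentAverage η x' z' - tentAverage η x z =
      ∫ k, (tentKernel d z' (x + k - x') - tentKernel d z (x + k - x)) * (η (x + k) - η x) := by
    simp only [sub_mul]
    rw [integral_sub (hint z' x') (hint z x), ← h1, ← h2]
    ring
  rw [h3]
  refine abs_integral_kernel_le hη x (fun k hk => ?_) (fun k => ?_)
  · have h4 : x + k - x = k := by abel
    have h5 : ‖k‖ ≤ ‖x + k - x'‖ + ‖x' - x‖ := by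
      have h6 : k = (x + k - x') + (x' - x) := by abel
      conv_lhs => rw [h6]
      exact norm_add_le _ _
    have h7 := (abs_le.1 hzz).2
    rw [tentKernel_eq_zero (by linarith [abs_nonneg (z' - z)]), h4,
      tentKernel_eq_zero (by linarith), sub_zero]
  · refine (abs_tentKernel_sub_le hz hzz _ _).trans (le_of_eq ?_)
    have h4 : x + k - x' - (x + k - x) = -(x' - x) := by abel
    rw [h4, norm_neg, tentLipConst]
    ring

lemma abs_tentAverage_sub_self_le {η : Horiz d → ℝ} (hη : Continuous η) (x : Horiz d) {z : ℝ}
    (hz : 0 < z) :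
    |tentAverage η x z - η x| ≤ (tentMass d)⁻¹ * z * oscillation η x z := by
  rw [tentAverage_sub_const_eq hη x x hz (η x)]
  refine abs_integral_kernel_le hη x (fun k hk => ?_) (fun k => ?_)
  · have h4 : x + k - x = k := by abel
    rw [h4, tentKernel_eq_zero (by linarith)]
  · have h1 := inv_pos.2 (tentMass_pos (d := d))
    rw [tentKernel, abs_mul, abs_of_pos (by positivity), abs_of_nonneg (le_max_left _ _), mul_assoc,
      mul_assoc, mul_comm z]
    refine mul_le_mul_of_nonneg_left (mul_le_mul_of_nonneg_left ?_ (by positivity)) h1.le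
    exact max_le hz.le (by linarith [norm_nonneg (x + k - x)])

/-! ### Gradients of Lipschitz functions -/

/-- The gradient of a function on `ℝ^d × ℝ`, as a Euclidean vector. -/
def gradVec (u : Pt d → ℝ) (p : Pt d) : Vec d :=
  (InnerProductSpace.toDual ℝ (Vec d)).symm
    ((fderiv ℝ u p).comp (WithLp.prodContinuousLinearEquiv 2 ℝ (Horiz d) ℝ : Vec d →L[ℝ] Pt d))

lemma inner_gradVec (u : Pt d → ℝ) (p : Pt d) (e : Vec d) :
    (inner ℝ (gradVec u p) e : ℝ) = fderiv ℝ u p (WithLp.ofLp e) := by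
  rw [gradVec, InnerProductSpace.toDual_symm_apply]
  rfl

lemma norm_ofLp_le (e : Vec d) : ‖(WithLp.ofLp e : Pt d)‖ ≤ ‖e‖ := by
  rw [WithLp.prod_norm_eq_of_L2, Prod.norm_def]
  refine max_le ?_ ?_
  · exact Real.le_sqrt_of_sq_le (le_add_of_nonneg_right (sq_nonneg _))
  · exact Real.le_sqrt_of_sq_le (le_add_of_nonneg_left (sq_nonneg _))

lemma norm_gradVec_le (u : Pt d → ℝ) (p : Pt d) : ‖gradVec u p‖ ≤ ‖fderiv ℝ u p‖ := by
  rw [gradVec, LinearIsometryEquiv.norm_map]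
  refine ContinuousLinearMap.opNorm_le_bound _ (norm_nonneg _) fun e => ?_
  exact ((fderiv ℝ u p).le_opNorm _).trans
    (mul_le_mul_of_nonneg_left (norm_ofLp_le e) (norm_nonneg _))

lemma measurable_gradVec (u : Pt d → ℝ) : Measurable (gradVec u) := by
  have h1 : Continuous fun T : Pt d →L[ℝ] ℝ => (InnerProductSpace.toDual ℝ (Vec d)).symm
    (T.comp (WithLp.prodContinuousLinearEquiv 2 ℝ (Horiz d) ℝ : Vec d →L[ℝ] Pt d)) := by
    fun_prop
  exact h1.measurable.comp (measurable_fderiv ℝ u)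

/-- Rademacher's theorem identifies the classical gradient with the line derivatives almost
everywhere, and these can be integrated by parts for Lipschitz functions. -/
lemma isWeakGradient_gradVec {u : Pt d → ℝ} {C : NNReal} (hu : LipschitzWith C u)
    (U : Set (Pt d)) : IsWeakGradient U u (gradVec u) := by
  intro ψ hψ hψc hψs e
  set v : Pt d := WithLp.ofLp e with hv
  have hψ1 : ContDiff ℝ 1 ψ := hψ.of_le (by simp)
  obtain ⟨D, hD⟩ := hψ1.lipschitzWith_of_hasCompactSupport hψc (by norm_num)
  have hψd : Differentiable ℝ ψ := hψ.differentiable (by simp)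
  have h := hu.integral_lineDeriv_mul_eq (μ := (volume : Measure (Pt d))) hD hψc v
  have h1 : ∫ p, lineDeriv ℝ u p v * ψ p = ∫ p, fderiv ℝ u p v * ψ p := by
    refine integral_congr_ae ?_
    filter_upwards [hu.ae_differentiableAt (μ := volume)] with p hp
    rw [hp.lineDeriv_eq_fderiv]
  have h2 : ∫ p, lineDeriv ℝ ψ p (-v) * u p = -∫ p, u p * fderiv ℝ ψ p v := by
    rw [← integral_neg]
    refine integral_congr_ae (ae_of_all _ fun p => ?_)
    simp only [(hψd p).lineDeriv_eq_fderiv, map_neg]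
    ring
  have h3 : ∫ p in U, u p * fderiv ℝ ψ p v = ∫ p, u p * fderiv ℝ ψ p v := by
    refine setIntegral_eq_integral_of_forall_compl_eq_zero fun p hp => ?_
    have : fderiv ℝ ψ p = 0 := by
      by_contra h0
      exact hp (hψs (support_fderiv_subset ℝ h0))
    simp [this]
  have h4 : ∫ p in U, inner ℝ (gradVec u p) e * ψ p = ∫ p, fderiv ℝ u p v * ψ p := by
    simp only [inner_gradVec]
    refine setIntegral_eq_integral_of_forall_compl_eq_zero fun p hp => ?_
    have : ψ p = 0 := by
      by_contra h0
      exact hp (hψs (subset_tsupport ψ h0))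
    simp [this]
  rw [h3, h4, ← h1, h, h2, neg_neg]

/-! ### The lifting of the interface -/

/-- A function near the graph of `η` whose trace on the graph is `η`. -/
def lift (η : Horiz d → ℝ) (p : Pt d) : ℝ :=
  max 0 (1 - |p.2 - η p.1|) * tentAverage η p.1 |p.2 - η p.1|

section Lift

variable {η : Horiz d → ℝ} {K M : ℝ}

lemma abs_lift_le (hM : ∀ x, |η x| ≤ M) (p : Pt d) : |lift η p| ≤ M := by
  have h0 : 0 ≤ M := (abs_nonneg _).trans (hM 0)
  have h1 : |max 0 (1 - |p.2 - η p.1|)| ≤ 1 := by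
    rw [abs_of_nonneg (le_max_left _ _)]
    exact max_le zero_le_one (by linarith [abs_nonneg (p.2 - η p.1)])
  rw [lift, abs_mul]
  calc _ ≤ 1 * M := mul_le_mul h1 (abs_tentAverage_le hM _ _) (abs_nonneg _) zero_le_one
    _ = M := one_mul M

lemma abs_height_sub_le (hK0 : 0 ≤ K) (hK : ∀ x y, |η x - η y| ≤ K * ‖x - y‖) (p p' : Pt d) :
    |(|p.2 - η p.1| - |p'.2 - η p'.1|)| ≤ (1 + K) * ‖p - p'‖ := by
  refine (abs_abs_sub_abs_le _ _).trans ?_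
  have h1 : p.2 - η p.1 - (p'.2 - η p'.1) = (p.2 - p'.2) - (η p.1 - η p'.1) := by ring
  have h2 : |p.2 - p'.2| ≤ ‖p - p'‖ := norm_snd_le (p - p')
  have h3 : ‖p.1 - p'.1‖ ≤ ‖p - p'‖ := norm_fst_le (p - p')
  rw [h1]
  refine (abs_sub _ _).trans ?_
  nlinarith [hK p.1 p'.1]

lemma abs_lift_sub_le (p p' : Pt d) :
    |lift η p' - lift η p| ≤ |(|p'.2 - η p'.1| - |p.2 - η p.1|)| * |tentAverage η p.1 (|p.2 - η p.1|)| +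
      |tentAverage η p'.1 (|p'.2 - η p'.1|) - tentAverage η p.1 (|p.2 - η p.1|)| := by
  set z := |p.2 - η p.1|
  set z' := |p'.2 - η p'.1|
  have h1 : lift η p' - lift η p = (max 0 (1 - z') - max 0 (1 - z)) * tentAverage η p.1 z +
      max 0 (1 - z') * (tentAverage η p'.1 z' - tentAverage η p.1 z) := by
    simp only [lift]; ring
  have h2 : |max 0 (1 - z') - max 0 (1 - z)| ≤ |z' - z| := by
    have h3 := abs_max_sub_max_le_max 0 (1 - z') 0 (1 - z)
    rw [sub_self, abs_zero, max_eq_right (abs_nonneg (1 - z' - (1 - z)))] at h3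
    refine h3.trans (le_of_eq ?_)
    rw [abs_sub_comm]
    congr 1; ring
  have h4 : |max 0 (1 - z')| ≤ 1 := by
    rw [abs_of_nonneg (le_max_left _ _)]
    exact max_le zero_le_one (by linarith [abs_nonneg (p'.2 - η p'.1)])
  rw [h1]
  refine (abs_add_le _ _).trans (add_le_add ?_ ?_)
  · rw [abs_mul]
    exact mul_le_mul_of_nonneg_right h2 (abs_nonneg _)
  · rw [abs_mul]
    exact mul_le_of_le_one_left (abs_nonneg _) h4

lemma lipschitzWith_lift (hK0 : 0 ≤ K) (hK : ∀ x y, |η x - η y| ≤ K * ‖x - y‖)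
    (hM : ∀ x, |η x| ≤ M) :
    LipschitzWith (Real.toNNReal ((1 + K) * M + K * (2 + K))) (lift η) := by
  refine LipschitzWith.of_dist_le' fun p' p => ?_
  rw [Real.dist_eq, dist_eq_norm]
  have h0 : 0 ≤ M := (abs_nonneg _).trans (hM 0)
  have h1 := abs_height_sub_le hK0 hK p' p
  have h3 : ‖p'.1 - p.1‖ ≤ ‖p' - p‖ := norm_fst_le (p' - p)
  refine (abs_lift_sub_le p p').trans ?_
  have h4 := mul_le_mul h1 (abs_tentAverage_le hM p.1 (|p.2 - η p.1|)) (abs_nonneg _) (by positivity)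
  have h5 := abs_tentAverage_sub_le hK0 hK p'.1 p.1 (|p'.2 - η p'.1|) (|p.2 - η p.1|)
  have h6 : K * (‖p'.1 - p.1‖ + |(|p'.2 - η p'.1| - |p.2 - η p.1|)|) ≤
      K * (‖p' - p‖ + (1 + K) * ‖p' - p‖) := by gcongr
  nlinarith

/-- The lift is Lipschitz and equals `η` on the graph, so `|lift - η|` is at most a multiple of the
height and its mean square over a thin layer is `O(ε²)`. -/
lemma hasTrace_lift (hK0 : 0 ≤ K) (hK : ∀ x y, |η x - η y| ≤ K * ‖x - y‖)
    (hM : ∀ x, |η x| ≤ M) (s : Phase) : HasTrace s η (lift η) η := by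
  have hη : Continuous η := continuous_of_abs_sub_le hK
  refine ⟨hη.aestronglyMeasurable, fun S hS => ?_⟩
  have hlip := lipschitzWith_lift hK0 hK hM
  set C := Real.toNNReal ((1 + K) * M + K * (2 + K)) with hC
  have hpt : ∀ p : Pt d, ‖lift η p - η p.1‖ₑ ≤ C * ENNReal.ofReal |height s η p| := by
    intro p
    have h1 : lift η (p.1, η p.1) = η p.1 := by simp [lift, tentAverage_zero]
    have h2 := hlip.edist_le_mul p (p.1, η p.1)
    rw [edist_eq_enorm_sub, h1] at h2
    refine h2.trans ?_
    gcongr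
    rw [Prod.edist_eq, edist_self, max_eq_right zero_le, edist_eq_enorm_sub, ← ofReal_norm,
      Real.norm_eq_abs, height, abs_mul, s.abs_sgn, one_mul]
  have hb : ∀ ε > 0, (∫⁻ p in layer s η S ε, ‖lift η p - η p.1‖ₑ ^ 2) / ENNReal.ofReal ε ≤
      C ^ 2 * volume S * ENNReal.ofReal ε ^ 2 := by
    intro ε hε
    have h1 : ∫⁻ p in layer s η S ε, ‖lift η p - η p.1‖ₑ ^ 2 ≤
        ∫⁻ p in layer s η S ε, (C * ENNReal.ofReal ε) ^ 2 := by
      refine setLIntegral_mono' (measurableSet_layer s hη hS.measurableSet ε) fun p hp => ?_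
      have h2 := mem_layer_iff.1 hp
      gcongr
      refine (hpt p).trans ?_
      gcongr
      rw [abs_of_pos h2.2.1]
      exact h2.2.2.le
    have h3 : ∫⁻ p in layer s η S ε, (C * ENNReal.ofReal ε) ^ 2 =
        ENNReal.ofReal ε * ((C * ENNReal.ofReal ε) ^ 2 * volume S) := by
      have := setLIntegral_band s hη (W := S)
        (measurable_const (a := (C * ENNReal.ofReal ε : ℝ≥0∞) ^ 2)) 0 ε
      rw [sub_zero] at this
      exact this.trans (by rw [setLIntegral_const])
    refine ENNReal.div_le_of_le_mul ((h1.trans h3.le).trans (le_of_eq ?_))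
    ring
  refine tendsto_of_tendsto_of_tendsto_of_le_of_le' tendsto_const_nhds
    (h := fun ε : ℝ => C ^ 2 * volume S * ENNReal.ofReal ε ^ 2) ?_
    (Eventually.of_forall fun _ => zero_le) ?_
  · have h1 : Tendsto (fun ε : ℝ => ENNReal.ofReal ε ^ 2) (𝓝[>] 0) (𝓝 0) := by
      have : Continuous fun ε : ℝ => ENNReal.ofReal ε ^ 2 := (ENNReal.continuous_pow 2).comp ENNReal.continuous_ofReal
      have h2 := (this.tendsto 0).mono_left (nhdsWithin_le_nhds (s := Ioi 0))
      simpa using h2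
    have h2 := ENNReal.Tendsto.const_mul (a := C ^ 2 * volume S) h1
      (Or.inr (ENNReal.mul_ne_top (by simp) hS.measure_lt_top.ne))
    simpa using h2
  · filter_upwards [self_mem_nhdsWithin] with ε hε using hb ε hε

/-- The constant in the pointwise gradient bound. -/
def liftConst (d : ℕ) : ℝ := tentLipConst d + (tentMass d)⁻¹

lemma liftConst_pos : 0 < liftConst d := add_pos tentLipConst_pos (inv_pos.2 tentMass_pos)

/-- The derivative is bounded through difference quotients, so differentiability need not be
checked. The cutoff contributes the average, which is at most `|η|` plus an oscillation; the average
contributes an oscillation. Beyond height one the lift vanishes. -/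
lemma norm_fderiv_lift_le (hK0 : 0 ≤ K) (hK : ∀ x y, |η x - η y| ≤ K * ‖x - y‖) {p : Pt d}
    (hp : 0 < |p.2 - η p.1|) :
    ‖fderiv ℝ (lift η) p‖ ≤ if |p.2 - η p.1| ≤ 1 then
      2 * (1 + K) * (|η p.1| + liftConst d * oscillation η p.1 |p.2 - η p.1|) else 0 := by
  have hη : Continuous η := continuous_of_abs_sub_le hK
  set z := |p.2 - η p.1| with hz
  have hosc := oscillation_nonneg η p.1 hp
  have hcont : Continuous fun p' : Pt d => |p'.2 - η p'.1| := by fun_prop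
  split_ifs with h1
  · have hC : 0 ≤ 2 * (1 + K) * (|η p.1| + liftConst d * oscillation η p.1 z) := by
      have := liftConst_pos (d := d)
      positivity
    refine norm_fderiv_le_of_lip' ℝ hC ?_
    -- Close points change base point and scale by at most `(2 + K)‖p' - p‖` in total, which meets
    -- the comparability condition of the oscillation estimate.
    have hev : ∀ᶠ p' in 𝓝 p, (2 + K) * ‖p' - p‖ < z / 2 := by
      have h2 : ContinuousAt (fun p' : Pt d => (2 + K) * ‖p' - p‖) p := by fun_prop
      refine h2.eventually_lt_const ?_
      simp only [sub_self, norm_zero, mul_zero]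
      exact half_pos hp
    filter_upwards [hev] with p' hp'
    have h2 := abs_height_sub_le hK0 hK p' p
    have h3 : ‖p'.1 - p.1‖ ≤ ‖p' - p‖ := norm_fst_le (p' - p)
    have hclose : ‖p'.1 - p.1‖ + |(|p'.2 - η p'.1| - z)| ≤ (2 + K) * ‖p' - p‖ := by linarith
    have h4 := abs_tentAverage_sub_le_oscillation hη hp (hclose.trans hp'.le)
    have h5 := abs_tentAverage_sub_self_le hη p.1 hp
    have hm := inv_pos.2 (tentMass_pos (d := d))
    have h6 : |tentAverage η p.1 z| ≤ |η p.1| + (tentMass d)⁻¹ * oscillation η p.1 z := by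
      have h7 : |tentAverage η p.1 z| ≤ |tentAverage η p.1 z - η p.1| + |η p.1| := by
        have := abs_add_le (tentAverage η p.1 z - η p.1) (η p.1)
        simpa using this
      have h8 : (tentMass d)⁻¹ * z * oscillation η p.1 z ≤
          (tentMass d)⁻¹ * oscillation η p.1 z := by
        refine mul_le_mul_of_nonneg_right ?_ hosc
        exact mul_le_of_le_one_right hm.le h1
      linarith
    have h9 := abs_lift_sub_le (η := η) p p'
    rw [Real.norm_eq_abs]
    have hT := tentLipConst_pos (d := d)
    calc |lift η p' - lift η p| ≤ _ := h9
      _ ≤ (1 + K) * ‖p' - p‖ * (|η p.1| + (tentMass d)⁻¹ * oscillation η p.1 z) +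
          tentLipConst d * ((2 + K) * ‖p' - p‖) * oscillation η p.1 z := by
          refine add_le_add (mul_le_mul h2 h6 (abs_nonneg _) (by positivity)) (h4.trans ?_)
          gcongr
      _ ≤ (2 * (1 + K)) * ‖p' - p‖ * (|η p.1| + (tentMass d)⁻¹ * oscillation η p.1 z) +
          tentLipConst d * ((2 * (1 + K)) * ‖p' - p‖) * oscillation η p.1 z := by
          gcongr
          · linarith
          · linarith
      _ = _ := by rw [liftConst]; ring
  · push Not at h1
    have hev : lift η =ᶠ[𝓝 p] fun _ => 0 := by
      filter_upwards [hcont.continuousAt.eventually_const_lt h1] with p' hp'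
      rw [lift, max_eq_left (by linarith), zero_mul]
    rw [hev.fderiv_eq]
    simp

end Lift

/-! ### The energy of the lifting -/

lemma lintegral_Ioi_rpow_le {a : ℝ} (ha : 0 < a) :
    ∫⁻ z in Ioi (a / 2), ENNReal.ofReal (z ^ (-((d : ℝ) + 2))) ≤
      ENNReal.ofReal (2 ^ (d + 1)) * (ENNReal.ofReal a ^ (d + 1))⁻¹ := by
  have hd : (0 : ℝ) ≤ d := by positivity
  have ha2 : 0 < a / 2 := half_pos ha
  have h1 : -((d : ℝ) + 2) < -1 := by linarith
  rw [← ofReal_integral_eq_lintegral_ofReal (integrableOn_Ioi_rpow_of_lt h1 ha2)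
    ((ae_restrict_mem measurableSet_Ioi).mono fun z hz =>
      Real.rpow_nonneg (ha2.trans hz).le _), integral_Ioi_rpow_of_lt h1 ha2,
    ← ENNReal.ofReal_pow ha.le, ← ENNReal.ofReal_inv_of_pos (by positivity),
    ← ENNReal.ofReal_mul (by positivity)]
  refine ENNReal.ofReal_le_ofReal ?_
  have h2 : (a / 2) ^ (-((d : ℝ) + 2) + 1) = 2 ^ (d + 1) * (a ^ (d + 1))⁻¹ := by
    have h3 : -((d : ℝ) + 2) + 1 = -((d + 1 : ℕ) : ℝ) := by push_cast; ring
    rw [h3, Real.rpow_neg ha2.le, Real.rpow_natCast, div_pow, inv_div]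
    field_simp
  rw [h2, neg_div, ← div_neg]
  refine div_le_self (by positivity) (by linarith)

/-- Cauchy–Schwarz on the ball: `z^{-2(d+1)}` times its volume, of order `z^d`, leaves `z^{-d-2}`.
-/
lemma oscillation_sq_le {η : Horiz d → ℝ} (hη : Continuous η) (x : Horiz d) {z : ℝ} (hz : 0 < z) :
    ENNReal.ofReal (oscillation η x z) ^ 2 ≤
      ENNReal.ofReal (2 ^ d) * volume (Metric.ball (0 : Horiz d) 1) *
      (ENNReal.ofReal (z ^ (-((d : ℝ) + 2))) *
        ∫⁻ k in Metric.ball (0 : Horiz d) (2 * z), ‖η (x + k) - η x‖ₑ ^ 2) := by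
  have hint : IntegrableOn (fun k => |η (x + k) - η x|) (Metric.ball (0 : Horiz d) (2 * z)) := by
    have : Continuous fun k => |η (x + k) - η x| := by fun_prop
    exact (this.continuousOn.integrableOn_compact (isCompact_closedBall _ _)).mono_set
      Metric.ball_subset_closedBall
  have hηm := hη.measurable
  have hm : Measurable fun k => ‖η (x + k) - η x‖ₑ := by fun_prop
  have h1 : ENNReal.ofReal (oscillation η x z) = ENNReal.ofReal ((z ^ (d + 1))⁻¹) *
      ∫⁻ k in Metric.ball (0 : Horiz d) (2 * z), ‖η (x + k) - η x‖ₑ := by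
    rw [oscillation, ENNReal.ofReal_mul (by positivity),
      ofReal_integral_eq_lintegral_ofReal hint (ae_of_all _ fun _ => abs_nonneg _)]
    simp only [← Real.norm_eq_abs, ofReal_norm]
  have hball : volume (Metric.ball (0 : Horiz d) (2 * z)) =
      ENNReal.ofReal ((2 * z) ^ d) * volume (Metric.ball (0 : Horiz d) 1) := by
    rw [Measure.addHaar_ball_of_pos _ _ (by positivity), finrank_euclideanSpace_fin]
  rw [h1, mul_pow]
  calc _ ≤ ENNReal.ofReal ((z ^ (d + 1))⁻¹) ^ 2 * (volume (Metric.ball (0 : Horiz d) (2 * z)) *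
        ∫⁻ k in Metric.ball (0 : Horiz d) (2 * z), ‖η (x + k) - η x‖ₑ ^ 2) := by
        gcongr
        exact setLIntegral_sq_le _ hm.aemeasurable
    _ = (ENNReal.ofReal ((z ^ (d + 1))⁻¹) ^ 2 * ENNReal.ofReal ((2 * z) ^ d)) *
        volume (Metric.ball (0 : Horiz d) 1) *
        ∫⁻ k in Metric.ball (0 : Horiz d) (2 * z), ‖η (x + k) - η x‖ₑ ^ 2 := by
        rw [hball]; ring
    _ = (ENNReal.ofReal (2 ^ d) * ENNReal.ofReal (z ^ (-((d : ℝ) + 2)))) *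
        volume (Metric.ball (0 : Horiz d) 1) *
        ∫⁻ k in Metric.ball (0 : Horiz d) (2 * z), ‖η (x + k) - η x‖ₑ ^ 2 := by
        congr 2
        rw [← ENNReal.ofReal_pow (by positivity), ← ENNReal.ofReal_mul (by positivity),
          ← ENNReal.ofReal_mul (by positivity)]
        congr 1
        have h3 : -((d : ℝ) + 2) = -((d + 2 : ℕ) : ℝ) := by push_cast; ring
        rw [h3, Real.rpow_neg hz.le, Real.rpow_natCast, mul_pow]
        have h4 : ((z ^ (d + 1))⁻¹) ^ 2 = (z ^ (d + 2))⁻¹ * (z ^ d)⁻¹ := by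
          rw [← mul_inv, ← inv_pow, ← pow_mul, ← pow_add, inv_pow]
          congr 2; ring
        rw [h4]
        field_simp
    _ = _ := by ring

/-- The constant in the energy estimate for the oscillation. -/
def oscConst (d : ℕ) : ℝ≥0∞ :=
  ENNReal.ofReal (2 ^ d) * volume (Metric.ball (0 : Horiz d) 1) * ENNReal.ofReal (2 ^ (d + 1))

lemma oscConst_ne_top : oscConst d ≠ ⊤ :=
  ENNReal.mul_ne_top (ENNReal.mul_ne_top ENNReal.ofReal_ne_top measure_ball_lt_top.ne)
    ENNReal.ofReal_ne_top

/-- After Fubini, a given `k` is seen only by the scales `z > |k|/2`, and the integral of `z^{-d-2}`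
over these is a multiple of `|k|^{-d-1}`, the weight of the `H^{1/2}` seminorm. -/
lemma lintegral_oscillation_sq_le {η : Horiz d → ℝ} (hη : Continuous η) :
    ∫⁻ x, ∫⁻ z in Ioc (0 : ℝ) 1, ENNReal.ofReal (oscillation η x z) ^ 2 ≤
      oscConst d * screenedNorm (fun _ => ⊤) η ^ 2 := by
  set c₁ := ENNReal.ofReal (2 ^ d) * volume (Metric.ball (0 : Horiz d) 1) with hc₁
  have hc₁t : c₁ ≠ ⊤ := ENNReal.mul_ne_top ENNReal.ofReal_ne_top measure_ball_lt_top.ne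
  rw [screenedNorm_sq, oscConst, mul_assoc, ← hc₁, ← lintegral_const_mul' _ _ ENNReal.ofReal_ne_top,
    ← lintegral_const_mul' _ _ hc₁t]
  refine lintegral_mono fun x => ?_
  have huniv : {k : Horiz d | ‖k‖ₑ < ⊤} = univ := by ext k; simp
  simp only [huniv, setLIntegral_univ]
  have hηm := hη.measurable
  have hm : Measurable fun k => ‖η (x + k) - η x‖ₑ ^ 2 := by fun_prop
  have hsm : MeasurableSet {q : ℝ × Horiz d | ‖q.2‖ / 2 < q.1} :=
    measurableSet_lt (by fun_prop) (by fun_prop)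
  calc ∫⁻ z in Ioc (0 : ℝ) 1, ENNReal.ofReal (oscillation η x z) ^ 2
      ≤ ∫⁻ z in Ioc (0 : ℝ) 1, c₁ * ∫⁻ k, {q : ℝ × Horiz d | ‖q.2‖ / 2 < q.1}.indicator
          (fun q => ENNReal.ofReal (q.1 ^ (-((d : ℝ) + 2))) * ‖η (x + q.2) - η x‖ₑ ^ 2) (z, k) := by
        refine setLIntegral_mono' measurableSet_Ioc fun z hz => ?_
        refine (oscillation_sq_le hη x hz.1).trans (mul_le_mul' le_rfl (le_of_eq ?_))
        rw [← lintegral_const_mul' _ _ ENNReal.ofReal_ne_top, ← lintegral_indicator measurableSet_ball]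
        refine lintegral_congr fun k => ?_
        have : k ∈ Metric.ball (0 : Horiz d) (2 * z) ↔
            (z, k) ∈ {q : ℝ × Horiz d | ‖q.2‖ / 2 < q.1} := by
          rw [mem_ball_zero_iff, mem_ofPred_eq, div_lt_iff₀ (by norm_num : (0:ℝ) < 2), mul_comm]
        by_cases hk : k ∈ Metric.ball (0 : Horiz d) (2 * z)
        · rw [indicator_of_mem hk, indicator_of_mem (this.1 hk)]
        · rw [indicator_of_notMem hk, indicator_of_notMem (fun h => hk (this.2 h))]
    _ ≤ c₁ * ∫⁻ z, ∫⁻ k, {q : ℝ × Horiz d | ‖q.2‖ / 2 < q.1}.indicator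
          (fun q => ENNReal.ofReal (q.1 ^ (-((d : ℝ) + 2))) * ‖η (x + q.2) - η x‖ₑ ^ 2) (z, k) := by
        rw [lintegral_const_mul' _ _ hc₁t]
        exact mul_le_mul' le_rfl (setLIntegral_le_lintegral _ _)
    _ = c₁ * ∫⁻ k, ∫⁻ z, {q : ℝ × Horiz d | ‖q.2‖ / 2 < q.1}.indicator
          (fun q => ENNReal.ofReal (q.1 ^ (-((d : ℝ) + 2))) * ‖η (x + q.2) - η x‖ₑ ^ 2) (z, k) := by
        rw [lintegral_lintegral_swap (f := fun z k => {q : ℝ × Horiz d | ‖q.2‖ / 2 < q.1}.indicator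
          (fun q => ENNReal.ofReal (q.1 ^ (-((d : ℝ) + 2))) * ‖η (x + q.2) - η x‖ₑ ^ 2) (z, k))]
        refine (Measurable.indicator ?_ hsm).aemeasurable
        exact Measurable.mul (by fun_prop) (hm.comp measurable_snd)
    _ ≤ c₁ * ∫⁻ k : Horiz d, ENNReal.ofReal (2 ^ (d + 1)) *
          (‖η (x + k) - η x‖ₑ ^ 2 / ‖k‖ₑ ^ (d + 1)) := by
        refine mul_le_mul' le_rfl (lintegral_mono fun k => ?_)
        have h1 : ∫⁻ z, {q : ℝ × Horiz d | ‖q.2‖ / 2 < q.1}.indicator (fun q =>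
            ENNReal.ofReal (q.1 ^ (-((d : ℝ) + 2))) * ‖η (x + q.2) - η x‖ₑ ^ 2) (z, k) =
            (∫⁻ z in Ioi (‖k‖ / 2), ENNReal.ofReal (z ^ (-((d : ℝ) + 2)))) *
              ‖η (x + k) - η x‖ₑ ^ 2 := by
          rw [← lintegral_mul_const' _ _ (by simp), ← lintegral_indicator measurableSet_Ioi]
          rfl
        simp only [h1]
        rcases eq_or_ne k 0 with rfl | hk
        · simp
        · refine (mul_le_mul' (lintegral_Ioi_rpow_le (norm_pos_iff.2 hk)) le_rfl).trans
            (le_of_eq ?_)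
          rw [ofReal_norm, ENNReal.div_eq_inv_mul, mul_assoc]
    _ = _ := by rw [lintegral_const_mul' _ _ ENNReal.ofReal_ne_top]

/-- The lift supported within height one has gradient bounded by `|η|` plus the oscillation at scale
`z`; the former is controlled by the `L²` norm and the latter by the seminorm. The bound `M` on `η`
serves only to make the lift bounded and Lipschitz and does not enter the energy. -/
theorem exists_lift (d : ℕ) : ∃ C : ℝ≥0∞, C ≠ ⊤ ∧ ∀ (η : Horiz d → ℝ) (K M : ℝ), 0 ≤ K →
    (∀ x y, |η x - η y| ≤ K * ‖x - y‖) → (∀ x, |η x| ≤ M) → hHalfNorm η < ⊤ →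
    ∀ b : Option (Horiz d → ℝ), (∀ β ∈ b, Continuous β) → ∃ u G,
      MemHDotOne (fluidDomain .upper η b) u G ∧ HasTrace .upper η u η ∧
      ∫⁻ p in fluidDomain .upper η b, ‖G p‖ₑ ^ 2 ≤
        C * ENNReal.ofReal ((1 + K) ^ 2) * hHalfNorm η ^ 2 := by
  set c := ENNReal.ofReal (liftConst d) with hc
  -- The factor `8` is `2² · 2`: the square of the `2 (1 + K)` in the pointwise gradient bound gives
  -- `2²`, and squaring a sum of two terms gives the other `2`.
  refine ⟨8 * (1 + c ^ 2 * oscConst d), ENNReal.mul_ne_top (by simp) (ENNReal.add_ne_top.2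
    ⟨by simp, ENNReal.mul_ne_top (ENNReal.pow_ne_top ENNReal.ofReal_ne_top) oscConst_ne_top⟩), ?_⟩
  intro η K M hK0 hK hM hfin b hb
  have hη : Continuous η := continuous_of_abs_sub_le hK
  have hlip := lipschitzWith_lift hK0 hK hM
  set Ω := fluidDomain .upper η b with hΩ
  have hΩo : IsOpen Ω := isOpen_fluidDomain _ hη hb
  have hsq : hHalfNorm η ^ 2 = (∫⁻ x, ‖η x‖ₑ ^ 2) + screenedNorm (fun _ => ⊤) η ^ 2 := by
    rw [hHalfNorm, rpow_half_sq, eLpNorm_two_sq]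
  have henergy : ∫⁻ p in Ω, ‖gradVec (lift η) p‖ₑ ^ 2 ≤
      8 * (1 + c ^ 2 * oscConst d) * ENNReal.ofReal ((1 + K) ^ 2) * hHalfNorm η ^ 2 := by
    have hsub : shear .upper η ⁻¹' Ω ⊆ univ ×ˢ Ioi (0 : ℝ) := fun q hq =>
      ⟨mem_univ _, (shear_mem_fluidDomain.1 hq).1⟩
    have hpt : ∀ q ∈ (univ ×ˢ Ioi (0 : ℝ) : Set (Pt d)),
        ‖gradVec (lift η) (shear .upper η q)‖ₑ ^ 2 ≤
        (univ ×ˢ Ioc (0 : ℝ) 1 : Set (Pt d)).indicator (fun q => ENNReal.ofReal (8 * (1 + K) ^ 2) *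
          (‖η q.1‖ₑ ^ 2 + c ^ 2 * ENNReal.ofReal (oscillation η q.1 q.2) ^ 2)) q := by
      rintro q ⟨-, hq⟩
      have hq0 : 0 < q.2 := hq
      have hz : |(shear .upper η q).2 - η (shear .upper η q).1| = q.2 := by
        simp [shear, Phase.sgn, abs_of_pos hq0]
      have h1 := (norm_gradVec_le (lift η) (shear .upper η q)).trans
        (norm_fderiv_lift_le hK0 hK (p := shear .upper η q) (by rw [hz]; exact hq0))
      rw [hz] at h1
      have hx : (shear .upper η q).1 = q.1 := rfl
      rw [hx] at h1
      have hosc := oscillation_nonneg η q.1 hq0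
      have hl := liftConst_pos (d := d)
      split_ifs at h1 with h2
      · rw [indicator_of_mem (show q ∈ (univ ×ˢ Ioc (0 : ℝ) 1 : Set (Pt d)) from
          ⟨mem_univ _, hq0, h2⟩)]
        have h3 : ‖gradVec (lift η) (shear .upper η q)‖ₑ ≤ ENNReal.ofReal (2 * (1 + K)) *
            (‖η q.1‖ₑ + c * ENNReal.ofReal (oscillation η q.1 q.2)) := by
          rw [← ofReal_norm, ← ofReal_norm, Real.norm_eq_abs (η q.1), hc,
            ← ENNReal.ofReal_mul hl.le, ← ENNReal.ofReal_add (abs_nonneg _) (by positivity),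
            ← ENNReal.ofReal_mul (by positivity)]
          exact ENNReal.ofReal_le_ofReal h1
        calc _ ≤ (ENNReal.ofReal (2 * (1 + K)) *
            (‖η q.1‖ₑ + c * ENNReal.ofReal (oscillation η q.1 q.2))) ^ 2 := by gcongr
          _ ≤ ENNReal.ofReal (2 * (1 + K)) ^ 2 * (2 * (‖η q.1‖ₑ ^ 2 +
            (c * ENNReal.ofReal (oscillation η q.1 q.2)) ^ 2)) := by
            rw [mul_pow]
            gcongr
            exact ennreal_add_sq_le _ _
          _ = _ := by
            have h8 : ENNReal.ofReal (8 * (1 + K) ^ 2) = ENNReal.ofReal (2 * (1 + K)) ^ 2 * 2 := by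
              rw [← ENNReal.ofReal_pow (by positivity)]
              have : (2 : ℝ≥0∞) = ENNReal.ofReal 2 := by norm_num
              rw [this, ← ENNReal.ofReal_mul (by positivity)]
              congr 1; ring
            rw [h8, mul_pow, mul_assoc]
      · have h3 : gradVec (lift η) (shear .upper η q) = 0 :=
          norm_le_zero_iff.1 h1
        simp [h3]
    have hm1 : MeasurableSet (univ ×ˢ Ioi (0 : ℝ) : Set (Pt d)) :=
      MeasurableSet.univ.prod measurableSet_Ioi
    have hm2 : MeasurableSet (univ ×ˢ Ioc (0 : ℝ) 1 : Set (Pt d)) :=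
      MeasurableSet.univ.prod measurableSet_Ioc
    have hηm' := hη.measurable
    have hηm : Measurable fun q : Pt d => ‖η q.1‖ₑ ^ 2 := by fun_prop
    have hom : Measurable fun q : Pt d => ENNReal.ofReal (oscillation η q.1 q.2) ^ 2 := by
      have h1 : Measurable fun q : Pt d => oscillation η q.1 q.2 := by
        unfold oscillation
        refine Measurable.mul (by fun_prop) ?_
        have h2 : ∀ q : Pt d, ∫ k in Metric.ball (0 : Horiz d) (2 * q.2), |η (q.1 + k) - η q.1| =
            ∫ k, {r : Pt d × Horiz d | ‖r.2‖ < 2 * r.1.2}.indicator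
              (fun r => |η (r.1.1 + r.2) - η r.1.1|) (q, k) := by
          intro q
          rw [← integral_indicator measurableSet_ball]
          refine integral_congr_ae (ae_of_all _ fun k => ?_)
          have h3 : k ∈ Metric.ball (0 : Horiz d) (2 * q.2) ↔
              (q, k) ∈ {r : Pt d × Horiz d | ‖r.2‖ < 2 * r.1.2} := by
            rw [mem_ball_zero_iff]; rfl
          by_cases hk : k ∈ Metric.ball (0 : Horiz d) (2 * q.2)
          · simp only [indicator_of_mem hk, indicator_of_mem (h3.1 hk)]
          · simp only [indicator_of_notMem hk, indicator_of_notMem (fun h => hk (h3.2 h))]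
        simp only [h2]
        refine StronglyMeasurable.measurable ?_
        refine StronglyMeasurable.integral_prod_right' (f := {r : Pt d × Horiz d |
          ‖r.2‖ < 2 * r.1.2}.indicator (fun r => |η (r.1.1 + r.2) - η r.1.1|)) ?_
        refine StronglyMeasurable.indicator ?_ (measurableSet_lt (by fun_prop) (by fun_prop))
        exact (by fun_prop : Continuous fun r : Pt d × Horiz d =>
          |η (r.1.1 + r.2) - η r.1.1|).stronglyMeasurable
      exact (h1.ennreal_ofReal).pow_const 2
    calc ∫⁻ p in Ω, ‖gradVec (lift η) p‖ₑ ^ 2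
        = ∫⁻ q in shear .upper η ⁻¹' Ω, ‖gradVec (lift η) (shear .upper η q)‖ₑ ^ 2 :=
          (setLIntegral_shear .upper hη (fun p => ‖gradVec (lift η) p‖ₑ ^ 2) Ω).symm
      _ ≤ ∫⁻ q in (univ ×ˢ Ioi (0 : ℝ) : Set (Pt d)),
          ‖gradVec (lift η) (shear .upper η q)‖ₑ ^ 2 := lintegral_mono_set hsub
      _ ≤ ∫⁻ q in (univ ×ˢ Ioi (0 : ℝ) : Set (Pt d)), (univ ×ˢ Ioc (0 : ℝ) 1 : Set (Pt d)).indicator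
          (fun q => ENNReal.ofReal (8 * (1 + K) ^ 2) *
          (‖η q.1‖ₑ ^ 2 + c ^ 2 * ENNReal.ofReal (oscillation η q.1 q.2) ^ 2)) q :=
          setLIntegral_mono' hm1 hpt
      _ ≤ ∫⁻ q in (univ ×ˢ Ioc (0 : ℝ) 1 : Set (Pt d)), ENNReal.ofReal (8 * (1 + K) ^ 2) *
          (‖η q.1‖ₑ ^ 2 + c ^ 2 * ENNReal.ofReal (oscillation η q.1 q.2) ^ 2) := by
          rw [← lintegral_indicator hm2]
          exact setLIntegral_le_lintegral _ _
      _ = ENNReal.ofReal (8 * (1 + K) ^ 2) * ((∫⁻ x, ‖η x‖ₑ ^ 2) + c ^ 2 *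
          ∫⁻ x, ∫⁻ z in Ioc (0 : ℝ) 1, ENNReal.ofReal (oscillation η x z) ^ 2) := by
          rw [lintegral_const_mul' _ _ ENNReal.ofReal_ne_top, lintegral_add_left hηm,
            lintegral_const_mul _ hom, Measure.volume_eq_prod, ← Measure.prod_restrict,
            Measure.restrict_univ, lintegral_prod _ hηm.aemeasurable,
            lintegral_prod _ hom.aemeasurable]
          simp
      _ ≤ ENNReal.ofReal (8 * (1 + K) ^ 2) * (1 * hHalfNorm η ^ 2 + c ^ 2 *
          (oscConst d * hHalfNorm η ^ 2)) := by
          gcongr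
          · rw [one_mul, hsq]; exact le_self_add
          · refine (lintegral_oscillation_sq_le hη).trans (mul_le_mul' le_rfl ?_)
            rw [hsq]; exact le_add_self
      _ = _ := by
          rw [ENNReal.ofReal_mul (by norm_num)]
          have : ENNReal.ofReal 8 = 8 := by norm_num
          rw [this]; ring
  refine ⟨lift η, gradVec (lift η), ⟨?_, ?_, isWeakGradient_gradVec hlip _⟩,
    hasTrace_lift hK0 hK hM _, henergy⟩
  · intro S hS _
    have : IsFiniteMeasure (volume.restrict S) := ⟨by simpa using hS.measure_lt_top⟩
    exact MemLp.of_bound hlip.continuous.aestronglyMeasurable M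
      (ae_of_all _ fun p => abs_lift_le hM p)
  · refine memLp_two_iff.2 ⟨(measurable_gradVec _).aestronglyMeasurable, henergy.trans_lt ?_⟩
    refine ENNReal.mul_lt_top (ENNReal.mul_lt_top ?_ ENNReal.ofReal_lt_top)
      (ENNReal.pow_lt_top hfin)
    exact ENNReal.mul_lt_top (by simp) (ENNReal.add_lt_top.2 ⟨by simp, ENNReal.mul_lt_top
      (ENNReal.pow_lt_top ENNReal.ofReal_lt_top) oscConst_ne_top.lt_top⟩)

/-! ### Lipschitz functions and the essential supremum of the gradient -/

lemma gradSupNorm_nonneg (g : Horiz d → ℝ) : 0 ≤ gradSupNorm g := ENNReal.toReal_nonneg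

lemma supNorm_nonneg (g : Horiz d → ℝ) : 0 ≤ supNorm g := ENNReal.toReal_nonneg

lemma ae_norm_fderiv_le_gradSupNorm {g : Horiz d → ℝ} (hg : MemWDotOneInfty g) :
    ∀ᵐ x, ‖fderiv ℝ g x‖ ≤ gradSupNorm g := by
  obtain ⟨K, hK⟩ := hg
  have hfin : eLpNorm (fderiv ℝ g) ⊤ volume ≠ ⊤ := by
    rw [eLpNorm_exponent_top]
    refine ((eLpNormEssSup_le_of_ae_bound (C := K)
      (ae_of_all _ fun x => norm_fderiv_le_of_lipschitz ℝ hK)).trans_lt ENNReal.ofReal_lt_top).ne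
  have h := ae_le_eLpNormEssSup (f := fderiv ℝ g) (μ := (volume : Measure (Horiz d)))
  filter_upwards [h] with x hx
  rw [← eLpNorm_exponent_top] at hx
  rw [gradSupNorm, ← toReal_enorm]
  exact ENNReal.toReal_mono hfin hx

/-- By Fubini, for almost every `x` the gradient exists and obeys its essential bound at almost
every point of the line through `x` in direction `v`. On such a line `g` is absolutely continuous
and its derivative can be integrated. -/
lemma ae_abs_sub_le_gradSupNorm {g : Horiz d → ℝ} (hg : MemWDotOneInfty g) (v : Horiz d) :
    ∀ᵐ x, |g (x + v) - g x| ≤ gradSupNorm g * ‖v‖ := by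
  obtain ⟨K, hK⟩ := id hg
  set P : Horiz d → Prop := fun x => DifferentiableAt ℝ g x ∧ ‖fderiv ℝ g x‖ ≤ gradSupNorm g
  have hPm : MeasurableSet {x | P x} := (measurableSet_of_differentiableAt ℝ g).inter
    (measurableSet_le (measurable_fderiv ℝ g).norm measurable_const)
  have hP : ∀ᵐ x, P x := hK.ae_differentiableAt.and (ae_norm_fderiv_le_gradSupNorm hg)
  have h1 : ∀ᵐ t : ℝ, ∀ᵐ x : Horiz d, P (x + t • v) := ae_of_all _ fun t =>
    (measurePreserving_add_right volume (t • v)).quasiMeasurePreserving.ae hP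
  have hm : MeasurableSet {q : ℝ × Horiz d | P (q.2 + q.1 • v)} :=
    (by fun_prop : Measurable fun q : ℝ × Horiz d => q.2 + q.1 • v) hPm
  have h2 : ∀ᵐ x : Horiz d, ∀ᵐ t : ℝ, P (x + t • v) := (Measure.ae_ae_comm hm).1 h1
  filter_upwards [h2] with x hx
  have hl : LipschitzWith (K * ‖v‖₊) fun t : ℝ => g (x + t • v) := by
    refine LipschitzWith.of_dist_le_mul fun t t' => ?_
    refine (hK.dist_le_mul _ _).trans (le_of_eq ?_)
    rw [dist_add_left, dist_eq_norm, ← sub_smul, norm_smul, dist_eq_norm]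
    push_cast; ring
  have hac : AbsolutelyContinuousOnInterval (fun t : ℝ => g (x + t • v)) 0 1 :=
    (hl.lipschitzOnWith (s := uIcc 0 1)).absolutelyContinuousOnInterval
  have h3 := hac.integral_deriv_eq_sub
  simp only [one_smul, zero_smul, add_zero] at h3
  rw [← h3, ← Real.norm_eq_abs]
  have h4 := intervalIntegral.norm_integral_le_of_norm_le_const_ae (a := 0) (b := 1)
    (f := deriv fun t : ℝ => g (x + t • v)) (C := gradSupNorm g * ‖v‖) (by
      filter_upwards [hx] with t ht _
      have hd : HasDerivAt (fun t : ℝ => g (x + t • v)) (fderiv ℝ g (x + t • v) v) t := by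
        have h5 : HasDerivAt (fun t : ℝ => x + t • v) v t := by
          simpa using ((hasDerivAt_id t).smul_const v).const_add x
        exact ht.1.hasFDerivAt.comp_hasDerivAt t h5
      rw [hd.deriv]
      exact ((fderiv ℝ g (x + t • v)).le_opNorm v).trans
        (mul_le_mul_of_nonneg_right ht.2 (norm_nonneg _)))
  simpa using h4

/-- A closed condition on the base point that holds almost everywhere holds everywhere, since conull
sets are dense. -/
lemma abs_sub_le_gradSupNorm {g : Horiz d → ℝ} (hg : MemWDotOneInfty g) (x y : Horiz d) :
    |g x - g y| ≤ gradSupNorm g * ‖x - y‖ := by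
  have hc : Continuous g := hg.choose_spec.continuous
  have h := ae_abs_sub_le_gradSupNorm hg (x - y)
  have hcl : IsClosed {y' : Horiz d | |g (y' + (x - y)) - g y'| ≤ gradSupNorm g * ‖x - y‖} :=
    isClosed_le (by fun_prop) continuous_const
  have hd := Measure.dense_of_ae h
  have := hcl.closure_eq ▸ hd y
  simpa using this

lemma volume_univ_eq_top (hd : 1 ≤ d) : (volume : Measure (Horiz d)) univ = ⊤ := by
  have : Nonempty (Fin d) := ⟨⟨0, hd⟩⟩
  have : Nontrivial (Horiz d) := inferInstance
  have : NoncompactSpace (Horiz d) := NormedSpace.noncompactSpace ℝ _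
  exact measure_univ_of_isAddLeftInvariant _

/-- The function is constant, and a nonzero constant is not square integrable on a space of infinite
volume; `1 ≤ d` is needed for the latter. -/
lemma eq_zero_of_gradSupNorm_eq_zero (hd : 1 ≤ d) {η : Horiz d → ℝ} (hη : MemWDotOneInfty η)
    (hη2 : MemLp η 2 volume) (h0 : gradSupNorm η = 0) : η = 0 := by
  have hconst : η = fun _ => η 0 := by
    funext x
    have := abs_sub_le_gradSupNorm hη x 0
    rw [h0, zero_mul] at this
    exact sub_eq_zero.1 (abs_nonpos_iff.1 this)
  rw [hconst, memLp_const_iff (by norm_num) (by norm_num)] at hη2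
  rcases hη2 with h | h
  · rw [hconst, h]; rfl
  · rw [volume_univ_eq_top hd] at h
    exact absurd h (lt_irrefl _)

lemma slope_nonneg (η : Horiz d → ℝ) (b : Option (Horiz d → ℝ)) : 0 ≤ slope η b := by
  cases b with
  | none => exact gradSupNorm_nonneg η
  | some β => exact add_nonneg (gradSupNorm_nonneg η) (gradSupNorm_nonneg β)

lemma gradSupNorm_le_slope (η : Horiz d → ℝ) (b : Option (Horiz d → ℝ)) :
    gradSupNorm η ≤ slope η b := by
  cases b with
  | none => exact le_rfl
  | some β => exact le_add_of_nonneg_right (gradSupNorm_nonneg β)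

/-- The infimum defining the distance is compared with the pair of points over the same `x`, whose
Euclidean distance is the depth. -/
lemma AdmissibleBoundary.le_depth {s : Phase} {h : ℝ} {η : Horiz d → ℝ}
    {b : Option (Horiz d → ℝ)} (hb : AdmissibleBoundary s h η b) :
    ∀ β ∈ b, ∀ x, h ≤ s.sgn * (β x - η x) := by
  intro β hβ x
  obtain ⟨-, hpos, hdist⟩ := hb β hβ
  have h1 := hdist.le.trans ((iInf_le _ x).trans (iInf_le _ x))
  rw [edist_dist, WithLp.prod_dist_eq_of_L2] at h1
  change _ ≤ ENNReal.ofReal √(dist x x ^ 2 + dist (η x) (β x) ^ 2) at h1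
  rw [dist_self, zero_pow two_ne_zero, zero_add, Real.sqrt_sq dist_nonneg, Real.dist_eq] at h1
  have h2 : |η x - β x| = s.sgn * (β x - η x) := by
    rw [← abs_of_pos (hpos x), abs_mul, s.abs_sgn, one_mul, abs_sub_comm]
  simp only [h2] at h1
  exact (ENNReal.ofReal_le_ofReal_iff (hpos x).le).1 h1

/-! ### Weighted estimates of the difference between a function and its trace -/

section Weighted

variable {s : Phase} {η : Horiz d → ℝ} {b : Option (Horiz d → ℝ)} {u : Pt d → ℝ}
  {G : Pt d → Vec d} {g : Horiz d → ℝ}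

/-- By the column estimate and Cauchy–Schwarz, `|u - g|²` at height `z` is at most `z` times the
integral of `|G|²` over the whole column. The variables then separate. -/
lemma HasTrace.lintegral_weight_sub_sq_le (hη : Continuous η) (hb : ∀ β ∈ b, Continuous β)
    (hu : MemHDotOne (fluidDomain s η b) u G) (hg : HasTrace s η u g) {w : ℝ → ℝ≥0∞}
    (hw : Measurable w) :
    ∫⁻ p in fluidDomain s η b, w (height s η p) * ‖u p - g p.1‖ₑ ^ 2 ≤
      (∫⁻ z in Ioi 0, w z * ENNReal.ofReal z) * ∫⁻ p in fluidDomain s η b, ‖G p‖ₑ ^ 2 := by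
  obtain ⟨G', hG', hGG', hu'⟩ := hu.exists_stronglyMeasurable
  set Ω := fluidDomain s η b with hΩ
  have hΩm : MeasurableSet Ω := (isOpen_fluidDomain s hη hb).measurableSet
  set D := shear s η ⁻¹' Ω with hD
  have hTm : Measurable (shear s η) := (measurePreserving_shear s hη).measurable
  have hDm : MeasurableSet D := hTm hΩm
  set N : Pt d → ℝ≥0∞ := D.indicator fun q => ‖G' (shear s η q)‖ₑ ^ 2 with hN
  have hGm : Measurable fun q => ‖G' (shear s η q)‖ₑ :=
    (hG'.measurable.comp hTm).enorm
  have hNm : Measurable N := (hGm.pow_const 2).indicator hDm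
  have hMm : Measurable fun x => ∫⁻ z, N (x, z) := hNm.lintegral_prod_right'
  have hcol : ∀ q ∈ D, columnIntegral s η G' q ^ 2 ≤ ENNReal.ofReal q.2 * ∫⁻ z, N (q.1, z) := by
    intro q hq
    have hq' := shear_mem_fluidDomain.1 hq
    refine (setLIntegral_sq_le (Ioo 0 q.2)
      (hGm.comp (measurable_const.prodMk measurable_id)).aemeasurable).trans ?_
    rw [Real.volume_Ioo, sub_zero]
    refine mul_le_mul' le_rfl ?_
    rw [← lintegral_indicator measurableSet_Ioo]
    refine lintegral_mono fun z => ?_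
    by_cases hz : z ∈ Ioo 0 q.2
    · have : (q.1, z) ∈ D :=
        shear_mem_fluidDomain.2 ⟨hz.1, fun β hβ => hz.2.trans (hq'.2 β hβ)⟩
      rw [indicator_of_mem hz, hN, indicator_of_mem this]
      rfl
    · rw [indicator_of_notMem hz]; exact zero_le
  calc ∫⁻ p in Ω, w (height s η p) * ‖u p - g p.1‖ₑ ^ 2
      = ∫⁻ q in D, w q.2 * ‖u (shear s η q) - g q.1‖ₑ ^ 2 := by
        rw [← setLIntegral_shear s hη]
        simp only [height_shear]
        rfl
    _ ≤ ∫⁻ q in D, w q.2 * (ENNReal.ofReal q.2 * ∫⁻ z, N (q.1, z)) := by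
        refine lintegral_mono_ae ?_
        rw [ae_restrict_iff' hDm]
        filter_upwards [hg.ae_enorm_sub_le hη hb hu' hG'] with q hq hqD
        refine mul_le_mul' le_rfl (le_trans ?_ (hcol q hqD))
        exact pow_le_pow_left' (hq hqD) 2
    _ ≤ ∫⁻ q in (univ ×ˢ Ioi (0 : ℝ) : Set (Pt d)),
          (∫⁻ z, N (q.1, z)) * (w q.2 * ENNReal.ofReal q.2) := by
        have hsub : D ⊆ (univ ×ˢ Ioi (0 : ℝ) : Set (Pt d)) := fun q hq =>
          ⟨mem_univ _, (shear_mem_fluidDomain.1 hq).1⟩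
        refine (lintegral_mono_set hsub).trans (le_of_eq ?_)
        refine lintegral_congr fun q => ?_
        ring
    _ = (∫⁻ x, ∫⁻ z, N (x, z)) * ∫⁻ z in Ioi 0, w z * ENNReal.ofReal z := by
        rw [Measure.volume_eq_prod, ← Measure.prod_restrict, Measure.restrict_univ,
          lintegral_prod_mul (g := fun z => w z * ENNReal.ofReal z) hMm.aemeasurable
            (hw.mul ENNReal.measurable_ofReal).aemeasurable]
    _ = (∫⁻ z in Ioi 0, w z * ENNReal.ofReal z) * ∫⁻ p in Ω, ‖G' p‖ₑ ^ 2 := by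
        rw [mul_comm, ← lintegral_prod _ hNm.aemeasurable, ← Measure.volume_eq_prod, hN,
          lintegral_indicator hDm, hD, setLIntegral_shear s hη (fun p => ‖G' p‖ₑ ^ 2)]
    _ = _ := by
        congr 1
        refine lintegral_congr_ae (hGG'.mono fun p hp => ?_)
        simp only [hp]

lemma HasTrace.lintegral_layer_sub_sq_le (hη : Continuous η) (hb : ∀ β ∈ b, Continuous β)
    (hu : MemHDotOne (fluidDomain s η b) u G) (hg : HasTrace s η u g) {h : ℝ}
    (hdep : ∀ β ∈ b, ∀ x, h ≤ s.sgn * (β x - η x)) {ε : ℝ} (hεh : ε ≤ h)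
    {K : Set (Horiz d)} (hK : MeasurableSet K) :
    ∫⁻ p in layer s η K ε, ‖u p - g p.1‖ₑ ^ 2 ≤
      ENNReal.ofReal ε ^ 2 * ∫⁻ p in fluidDomain s η b, ‖G p‖ₑ ^ 2 := by
  have h1 := hg.lintegral_weight_sub_sq_le hη hb hu
    (w := (Iio ε).indicator 1) (measurable_one.indicator measurableSet_Iio)
  have h2 : ∫⁻ z in Ioi (0 : ℝ), (Iio ε).indicator 1 z * ENNReal.ofReal z ≤
      ENNReal.ofReal ε ^ 2 := by
    calc _ ≤ ∫⁻ z in Ioi (0 : ℝ), (Iio ε).indicator (fun _ => ENNReal.ofReal ε) z := by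
          refine lintegral_mono fun z => ?_
          by_cases hz : z ∈ Iio ε
          · rw [indicator_of_mem hz, indicator_of_mem hz, Pi.one_apply, one_mul]
            exact ENNReal.ofReal_le_ofReal (le_of_lt hz)
          · simp [indicator_of_notMem hz]
      _ = _ := by
          rw [lintegral_indicator measurableSet_Iio, Measure.restrict_restrict measurableSet_Iio,
            setLIntegral_const, inter_comm, Ioi_inter_Iio, Real.volume_Ioo, sub_zero, sq]
  refine le_trans ?_ (h1.trans (mul_le_mul' h2 le_rfl))
  have hm := measurableSet_layer s hη hK ε
  calc _ = ∫⁻ p in layer s η K ε, (Iio ε).indicator 1 (height s η p) * ‖u p - g p.1‖ₑ ^ 2 := by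
        refine setLIntegral_congr_fun hm fun p hp => ?_
        have : height s η p ∈ Iio ε := (mem_layer_iff.1 hp).2.2
        simp only [indicator_of_mem this, Pi.one_apply, one_mul]
    _ ≤ _ := lintegral_mono_set (layer_subset hdep hεh K)

/-- On one sufficiently thin layer `u - g` is square integrable, and so is `u` on a compact slab
inside it. As `g` does not depend on the height, its integral over the slab is the thickness times
its integral over `K`. -/
lemma HasTrace.memL2Loc (hη : Continuous η) {h : ℝ} (hh : 0 < h)
    (hdep : ∀ β ∈ b, ∀ x, h ≤ s.sgn * (β x - η x))
    (hu : MemL2Loc (fluidDomain s η b) u) (hg : HasTrace s η u g) : MemL2Loc univ g := by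
  have hm : ∀ K, MeasurableSet K → AEStronglyMeasurable g (volume.restrict K) :=
    fun K _ => hg.1.restrict
  intro K hK _
  refine memLp_two_iff.2 ⟨hm K hK.measurableSet, ?_⟩
  have h1 := (hg.2 K hK).eventually (gt_mem_nhds zero_lt_one)
  have h2 : ∀ᶠ ε : ℝ in 𝓝[>] 0, ε ∈ Ioo 0 h := Ioo_mem_nhdsGT hh
  obtain ⟨ε, hε1, hε0, hεh⟩ := (h1.and h2).exists
  have hfin1 : ∫⁻ p in layer s η K ε, ‖u p - g p.1‖ₑ ^ 2 < ⊤ := by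
    by_contra hcon
    rw [not_lt, top_le_iff] at hcon
    rw [hcon, ENNReal.top_div_of_ne_top ENNReal.ofReal_ne_top] at hε1
    exact absurd hε1 (by simp)
  set S : Set (Pt d) := shear s η '' (K ×ˢ Icc (ε / 4) (ε / 2)) with hS
  have hSc : IsCompact S := (hK.prod isCompact_Icc).image (shearHomeo s hη).continuous
  have hSl : S ⊆ layer s η K ε := by
    rintro _ ⟨q, ⟨hq1, hq2⟩, rfl⟩
    exact shear_mem_layer.2 ⟨hq1, by linarith [hq2.1], by linarith [hq2.2]⟩
  have hfin2 : ∫⁻ p in S, ‖u p‖ₑ ^ 2 < ⊤ :=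
    (memLp_two_iff.1 (hu S hSc (hSl.trans (layer_subset hdep hεh.le K)))).2
  have hgm := hg.1.stronglyMeasurable_mk
  set g' := hg.1.mk g with hg'
  have hgg' : ∀ᵐ p : Pt d, g p.1 = g' p.1 := Measure.quasiMeasurePreserving_fst.ae hg.1.ae_eq_mk
  have hband := setLIntegral_band s hη (W := K)
    (F := fun x => ‖g' x‖ₑ ^ 2) (hgm.measurable.enorm.pow_const 2) (ε / 4) (ε / 2)
  have hsub : {p : Pt d | p.1 ∈ K ∧ ε / 4 < height s η p ∧ height s η p < ε / 2} ⊆ S := by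
    rintro p ⟨hp1, hp2, hp3⟩
    exact ⟨(p.1, height s η p), ⟨hp1, hp2.le, hp3.le⟩, shear_height s η p⟩
  have hfin3 : ∫⁻ p in S, ‖g' p.1‖ₑ ^ 2 < ⊤ := by
    have hSm := hSc.measurableSet
    have h3 : ∫⁻ p in S, ‖g' p.1‖ₑ ^ 2 ≤
        ∫⁻ p in S, 2 * (‖u p - g p.1‖ₑ ^ 2 + ‖u p‖ₑ ^ 2) := by
      refine lintegral_mono_ae (ae_restrict_of_ae (hgg'.mono fun p hp => ?_))
      rw [← hp]
      refine le_trans ?_ (ennreal_add_sq_le _ _)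
      refine pow_le_pow_left' ?_ 2
      have h4 : g p.1 = -(u p - g p.1) + u p := by ring
      calc ‖g p.1‖ₑ = ‖-(u p - g p.1) + u p‖ₑ := by rw [← h4]
        _ ≤ ‖-(u p - g p.1)‖ₑ + ‖u p‖ₑ := enorm_add_le _ _
        _ = _ := by rw [enorm_neg]
    have hum : AEStronglyMeasurable u (volume.restrict S) :=
      (memLp_two_iff.1 (hu S hSc (hSl.trans (layer_subset hdep hεh.le K)))).1
    refine h3.trans_lt ?_
    rw [lintegral_const_mul' _ _ (by simp), lintegral_add_right' _ (hum.enorm.pow_const 2)]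
    exact ENNReal.mul_lt_top (by simp) (ENNReal.add_lt_top.2
      ⟨(lintegral_mono_set hSl).trans_lt hfin1, hfin2⟩)
  have h5 : ENNReal.ofReal (ε / 2 - ε / 4) * ∫⁻ x in K, ‖g' x‖ₑ ^ 2 < ⊤ := by
    rw [← hband]
    exact (lintegral_mono_set hsub).trans_lt hfin3
  have h6 : ∫⁻ x in K, ‖g' x‖ₑ ^ 2 < ⊤ := by
    refine lt_top_iff_ne_top.2 fun h7 => ?_
    rw [h7, ENNReal.mul_top (by simp only [ne_eq, ENNReal.ofReal_eq_zero, not_le]; linarith)] at h5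
    exact lt_irrefl _ h5
  refine lt_of_eq_of_lt (lintegral_congr_ae (ae_restrict_of_ae ?_)) h6
  exact hg.1.ae_eq_mk.mono fun x hx => by simp only [hx, hg']

end Weighted

/-! ### Limits in `L²` -/

lemma exists_limit_of_lintegral_sub_sq_le {X : Type*} [MeasurableSpace X] {m : Measure X}
    {f : ℕ → X → ℝ} (hf : ∀ n, MemLp (f n) 2 m) {C : ℝ≥0∞} (hC : C ≠ ⊤) {a : ℕ → ℝ≥0∞}
    (ha : Tendsto a atTop (𝓝 0))
    (h : ∀ n k, ∫⁻ x, ‖f n x - f k x‖ₑ ^ 2 ∂m ≤ C * (a n + a k)) :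
    ∃ F, MemLp F 2 m ∧ Tendsto (fun n => ∫⁻ x, ‖f n x - F x‖ₑ ^ 2 ∂m) atTop (𝓝 0) := by
  have hcauchy : CauchySeq fun n => (hf n).toLp := by
    rw [EMetric.cauchySeq_iff]
    intro ε hε
    have h0 : Tendsto (fun n => C * a n) atTop (𝓝 0) := by
      simpa using ENNReal.Tendsto.const_mul (a := C) ha (Or.inr hC)
    have hε2 : 0 < ε ^ 2 / 2 := ENNReal.half_pos (pow_ne_zero 2 hε.ne')
    obtain ⟨N, hN⟩ := eventually_atTop.1 (h0.eventually (gt_mem_nhds hε2))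
    refine ⟨N, fun n hn k hk => ?_⟩
    have h1 : edist (hf n).toLp (hf k).toLp ^ 2 < ε ^ 2 := by
      rw [Lp.edist_toLp_toLp, eLpNorm_two_sq]
      calc _ ≤ C * (a n + a k) := h n k
        _ = C * a n + C * a k := mul_add _ _ _
        _ < ε ^ 2 / 2 + ε ^ 2 / 2 := ENNReal.add_lt_add (hN n hn) (hN k hk)
        _ = ε ^ 2 := ENNReal.add_halves _
    exact lt_of_pow_lt_pow_left' 2 h1
  obtain ⟨F, hF⟩ := cauchySeq_tendsto_of_complete hcauchy
  refine ⟨F, Lp.memLp F, ?_⟩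
  have h1 := (Lp.tendsto_Lp_iff_tendsto_eLpNorm' _ _).1 hF
  have h2 := ((ENNReal.continuous_pow 2).tendsto 0).comp h1
  rw [zero_pow two_ne_zero] at h2
  refine h2.congr fun n => ?_
  simp only [Function.comp_apply, eLpNorm_two_sq]
  refine lintegral_congr_ae ((hf n).coeFn_toLp.mono fun x hx => ?_)
  simp [hx]

lemma tendsto_integral_mul_of_lintegral_sub_sq {X : Type*} [MeasurableSpace X] {m : Measure X}
    {f : ℕ → X → ℝ} {F φ : X → ℝ} (hf : ∀ n, MemLp (f n) 2 m) (hF : MemLp F 2 m)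
    (hφ : MemLp φ 2 m) (h : Tendsto (fun n => ∫⁻ x, ‖f n x - F x‖ₑ ^ 2 ∂m) atTop (𝓝 0)) :
    Tendsto (fun n => ∫ x, f n x * φ x ∂m) atTop (𝓝 (∫ x, F x * φ x ∂m)) := by
  refine tendsto_integral_of_L1 _ (hF.integrable_mul hφ).1
    (Eventually.of_forall fun n => (hf n).integrable_mul hφ) ?_
  have h1 : ∀ n, ∫⁻ x, ‖f n x * φ x - F x * φ x‖ₑ ∂m ≤
      (∫⁻ x, ‖f n x - F x‖ₑ ^ 2 ∂m) ^ (1 / 2 : ℝ) * (∫⁻ x, ‖φ x‖ₑ ^ 2 ∂m) ^ (1 / 2 : ℝ) := by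
    intro n
    have h2 := lintegral_mul_sq_le (((hf n).1.sub hF.1).enorm) hφ.1.enorm
    rw [← ENNReal.mul_rpow_of_nonneg _ _ (by norm_num)]
    calc _ = ((∫⁻ x, ‖f n x - F x‖ₑ * ‖φ x‖ₑ ∂m) ^ 2) ^ (1 / 2 : ℝ) := by
          rw [← ENNReal.rpow_natCast, ← ENNReal.rpow_mul]
          norm_num
          refine lintegral_congr fun x => ?_
          rw [← sub_mul, enorm_mul]
      _ ≤ _ := ENNReal.rpow_le_rpow h2 (by norm_num)
  have h3 : Tendsto (fun n => (∫⁻ x, ‖f n x - F x‖ₑ ^ 2 ∂m) ^ (1 / 2 : ℝ) *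
      (∫⁻ x, ‖φ x‖ₑ ^ 2 ∂m) ^ (1 / 2 : ℝ)) atTop (𝓝 0) := by
    have h4 := ((ENNReal.continuous_rpow_const (y := 1 / 2)).tendsto 0).comp h
    rw [ENNReal.zero_rpow_of_pos (by norm_num)] at h4
    have := ENNReal.Tendsto.mul_const (b := (∫⁻ x, ‖φ x‖ₑ ^ 2 ∂m) ^ (1 / 2 : ℝ)) h4
      (Or.inr (ENNReal.rpow_ne_top_of_nonneg (by norm_num) (memLp_two_iff.1 hφ).2.ne))
    simpa using this
  exact tendsto_of_tendsto_of_tendsto_of_le_of_le tendsto_const_nhds h3 (fun _ => zero_le) h1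

lemma enorm_add_sq_le {E : Type*} [NormedAddCommGroup E] (a b : E) :
    ‖a + b‖ₑ ^ 2 ≤ 2 * (‖a‖ₑ ^ 2 + ‖b‖ₑ ^ 2) :=
  (pow_le_pow_left' (enorm_add_le a b) 2).trans (ennreal_add_sq_le _ _)

lemma lintegral_enorm_add_sq_le {X E : Type*} [MeasurableSpace X] [NormedAddCommGroup E]
    {m : Measure X} {f g : X → E} (hf : AEStronglyMeasurable f m) :
    ∫⁻ x, ‖f x + g x‖ₑ ^ 2 ∂m ≤ 2 * ((∫⁻ x, ‖f x‖ₑ ^ 2 ∂m) + ∫⁻ x, ‖g x‖ₑ ^ 2 ∂m) := by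
  rw [← lintegral_add_left' (hf.enorm.pow_const 2), ← lintegral_const_mul' _ _ (by simp)]
  exact lintegral_mono fun x => enorm_add_sq_le _ _

lemma lintegral_enorm_sub_sq_le {X E : Type*} [MeasurableSpace X] [NormedAddCommGroup E]
    {m : Measure X} {f g h : X → E} (hf : AEStronglyMeasurable f m)
    (hh : AEStronglyMeasurable h m) :
    ∫⁻ x, ‖f x - g x‖ₑ ^ 2 ∂m ≤
      2 * ((∫⁻ x, ‖f x - h x‖ₑ ^ 2 ∂m) + ∫⁻ x, ‖g x - h x‖ₑ ^ 2 ∂m) := by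
  have h1 := lintegral_enorm_add_sq_le (m := m) (f := fun x => f x - h x)
    (g := fun x => h x - g x) (hf.sub hh)
  simp only [sub_add_sub_cancel] at h1
  refine h1.trans (le_of_eq ?_)
  simp only [enorm_sub_rev (h _)]

/-! ### The weighted trace inequality -/

section Trace

variable {s : Phase} {η : Horiz d → ℝ} {b : Option (Horiz d → ℝ)} {Lη Lβ h : ℝ}

/-- With a screening length constant in `x`, chosen from the lower bound `h` of the depth, the trace
inequality feeds the weighted Poincaré inequality. The radius and the constant do not depend on the
function, as required for passing to limits. -/
lemma exists_weighted_trace_inequality (hLη : ∀ x y, |η x - η y| ≤ Lη * ‖x - y‖)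
    (hLβ : ∀ β ∈ b, ∀ x y, |β x - β y| ≤ Lβ * ‖x - y‖) (hLη0 : 0 ≤ Lη) (hLβ0 : 0 ≤ Lβ)
    (hh : 0 < h) (hdep : ∀ β ∈ b, ∀ x, h ≤ s.sgn * (β x - η x)) :
    ∃ r > 0, ∃ C : ℝ≥0∞, C ≠ ⊤ ∧ ∀ u G f, MemHDotOne (fluidDomain s η b) u G →
      HasTrace s η u f →
      ∫⁻ x, ‖decayWeight d x * (f x - localMean r f 0)‖ₑ ^ 2 ≤
        C * ∫⁻ p in fluidDomain s η b, ‖G p‖ₑ ^ 2 := by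
  have hη := continuous_of_abs_sub_le hLη
  have hb : ∀ β ∈ b, Continuous β := fun β hβ => continuous_of_abs_sub_le (hLβ β hβ)
  have hpos : 0 < Lη + Lβ + 2 * 1 := by positivity
  -- The largest constant screening length admissible in the trace inequality with `c = 1`.
  set δ := h / (Lη + Lβ + 2 * 1) with hδ
  have hδ0 : 0 < δ := div_pos hh hpos
  obtain ⟨C, hC, hpoin⟩ := exists_weighted_poincare (d := d) hδ0
  refine ⟨δ / 3, by positivity, C * (traceConst d * ENNReal.ofReal (2 * (Lη + 1) / 1 ^ 2)),
    ENNReal.mul_ne_top hC (ENNReal.mul_ne_top traceConst_lt_top.ne ENNReal.ofReal_ne_top), ?_⟩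
  intro u G f hu hf
  refine (hpoin f (hf.memL2Loc hη hh hdep hu.1)).trans ?_
  rw [mul_assoc]
  refine mul_le_mul' le_rfl ?_
  refine hf.screenedNorm_sq_le hLη hLβ hLη0 zero_lt_one le_rfl hu measurable_const ?_
  intro x k hk β hβ
  rw [← ofReal_norm, ENNReal.ofReal_lt_ofReal_iff hδ0, hδ, lt_div_iff₀ hpos] at hk
  linarith [hdep β hβ x]

end Trace

/-! ### Weights on the fluid domains -/

/-- A positive continuous weight for which multiples of functions in `Ḣ¹` are in `L²`. -/
def columnWeight (s : Phase) (η : Horiz d → ℝ) (p : Pt d) : ℝ :=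
  decayWeight d p.1 * Real.exp (-height s η p)

lemma columnWeight_pos (s : Phase) (η : Horiz d → ℝ) (p : Pt d) : 0 < columnWeight s η p :=
  mul_pos (decayWeight_pos _) (Real.exp_pos _)

lemma continuous_columnWeight (s : Phase) {η : Horiz d → ℝ} (hη : Continuous η) :
    Continuous (columnWeight s η) := by
  have h1 : Continuous (height s η) := by unfold height; fun_prop
  exact (continuous_decayWeight.comp continuous_fst).mul (Real.continuous_exp.comp h1.neg)

lemma lintegral_exp_neg : ∫⁻ z in Ioi (0 : ℝ), ENNReal.ofReal (Real.exp (-z)) = 1 := by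
  rw [← ofReal_integral_eq_lintegral_ofReal (integrableOn_exp_neg_Ioi 0)
    (ae_of_all _ fun z => (Real.exp_pos _).le), integral_exp_neg_Ioi_zero, ENNReal.ofReal_one]

lemma enorm_exp_sq (z : ℝ) : ‖Real.exp (-z)‖ₑ ^ 2 = ENNReal.ofReal (Real.exp (-(2 * z))) := by
  rw [Real.enorm_eq_ofReal (Real.exp_pos _).le, ← ENNReal.ofReal_pow (Real.exp_pos _).le,
    ← Real.exp_nat_mul]
  congr 2
  push_cast; ring

section Weights

variable {s : Phase} {η : Horiz d → ℝ} {b : Option (Horiz d → ℝ)} {u : Pt d → ℝ}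
  {G : Pt d → Vec d} {g : Horiz d → ℝ}

lemma HasTrace.lintegral_columnWeight_sub_sq_le (hη : Continuous η)
    (hb : ∀ β ∈ b, Continuous β) (hu : MemHDotOne (fluidDomain s η b) u G)
    (hg : HasTrace s η u g) :
    ∫⁻ p in fluidDomain s η b, ‖columnWeight s η p * (u p - g p.1)‖ₑ ^ 2 ≤
      ∫⁻ p in fluidDomain s η b, ‖G p‖ₑ ^ 2 := by
  have h1 := hg.lintegral_weight_sub_sq_le hη hb hu
    (w := fun z => ‖Real.exp (-z)‖ₑ ^ 2) (by fun_prop)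
  -- From `z ≤ exp z` one gets `z exp(-2z) ≤ exp(-z)`, whose integral is one.
  have h2 : ∫⁻ z in Ioi (0 : ℝ), ‖Real.exp (-z)‖ₑ ^ 2 * ENNReal.ofReal z ≤ 1 := by
    rw [← lintegral_exp_neg]
    refine lintegral_mono fun z => ?_
    simp only [enorm_exp_sq]
    rw [← ENNReal.ofReal_mul (Real.exp_pos _).le]
    refine ENNReal.ofReal_le_ofReal ?_
    have h3 : -(2 * z) = -z + -z := by ring
    rw [h3, Real.exp_add, mul_assoc]
    refine mul_le_of_le_one_right (Real.exp_pos _).le ?_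
    rw [Real.exp_neg, inv_mul_le_iff₀ (Real.exp_pos _), mul_one]
    linarith [Real.add_one_le_exp z]
  refine le_trans (lintegral_mono fun p => ?_) (h1.trans (mul_le_of_le_one_left' h2))
  rw [columnWeight, enorm_mul, enorm_mul, mul_pow, mul_pow]
  refine mul_le_mul' ?_ le_rfl
  refine mul_le_of_le_one_left' (pow_le_one' ?_ 2)
  rw [Real.enorm_eq_ofReal (decayWeight_pos _).le]
  exact ENNReal.ofReal_le_one.2 (decayWeight_le_one _)

lemma lintegral_columnWeight_fst_sq_le (hη : Continuous η) (hgm : AEStronglyMeasurable g volume) :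
    ∫⁻ p in fluidDomain s η b, ‖columnWeight s η p * g p.1‖ₑ ^ 2 ≤
      ∫⁻ x, ‖decayWeight d x * g x‖ₑ ^ 2 := by
  have hsub : shear s η ⁻¹' (fluidDomain s η b) ⊆ (univ ×ˢ Ioi (0 : ℝ) : Set (Pt d)) :=
    fun q hq => ⟨mem_univ _, (shear_mem_fluidDomain.1 hq).1⟩
  have hm : AEMeasurable (fun x => ‖decayWeight d x * g x‖ₑ ^ 2) volume :=
    (continuous_decayWeight.aestronglyMeasurable.mul hgm).enorm.pow_const 2
  calc _ = ∫⁻ q in shear s η ⁻¹' (fluidDomain s η b),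
        ‖decayWeight d q.1 * g q.1‖ₑ ^ 2 * ‖Real.exp (-q.2)‖ₑ ^ 2 := by
        rw [← setLIntegral_shear s hη]
        refine lintegral_congr fun q => ?_
        rw [columnWeight, height_shear, ← mul_pow, ← enorm_mul]
        change ‖decayWeight d q.1 * Real.exp (-q.2) * g q.1‖ₑ ^ 2 = _
        congr 2; ring
    _ ≤ ∫⁻ q in (univ ×ˢ Ioi (0 : ℝ) : Set (Pt d)),
        ‖decayWeight d q.1 * g q.1‖ₑ ^ 2 * ‖Real.exp (-q.2)‖ₑ ^ 2 := lintegral_mono_set hsub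
    _ = (∫⁻ x, ‖decayWeight d x * g x‖ₑ ^ 2) * ∫⁻ z in Ioi (0 : ℝ), ‖Real.exp (-z)‖ₑ ^ 2 := by
        rw [Measure.volume_eq_prod, ← Measure.prod_restrict, Measure.restrict_univ,
          lintegral_prod_mul (f := fun x => ‖decayWeight d x * g x‖ₑ ^ 2)
            (g := fun z => ‖Real.exp (-z)‖ₑ ^ 2) hm
            (by fun_prop : Measurable fun z : ℝ => ‖Real.exp (-z)‖ₑ ^ 2).aemeasurable]
    _ ≤ _ := by
        refine mul_le_of_le_one_right' ?_
        rw [← lintegral_exp_neg]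
        refine setLIntegral_mono' measurableSet_Ioi fun z hz => ?_
        rw [enorm_exp_sq]
        refine ENNReal.ofReal_le_ofReal (Real.exp_le_exp.2 ?_)
        have : (0 : ℝ) < z := hz
        linarith

lemma HasTrace.lintegral_columnWeight_sq_le (hη : Continuous η)
    (hb : ∀ β ∈ b, Continuous β) (hu : MemHDotOne (fluidDomain s η b) u G)
    (hg : HasTrace s η u g) :
    ∫⁻ p in fluidDomain s η b, ‖columnWeight s η p * u p‖ₑ ^ 2 ≤
      2 * ((∫⁻ p in fluidDomain s η b, ‖G p‖ₑ ^ 2) + ∫⁻ x, ‖decayWeight d x * g x‖ₑ ^ 2) := by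
  have hum := hu.1.aestronglyMeasurable (isOpen_fluidDomain s hη hb)
  have hgm : AEStronglyMeasurable (fun p : Pt d => g p.1)
      (volume.restrict (fluidDomain s η b)) := (aestronglyMeasurable_fst hg.1).restrict
  have hQ := (continuous_columnWeight s hη).aestronglyMeasurable
    (μ := volume.restrict (fluidDomain s η b))
  have h1 := lintegral_enorm_add_sq_le (m := volume.restrict (fluidDomain s η b))
    (f := fun p => columnWeight s η p * (u p - g p.1)) (g := fun p => columnWeight s η p * g p.1)
    (hQ.mul (hum.sub hgm))
  have h2 : ∀ p : Pt d, columnWeight s η p * (u p - g p.1) + columnWeight s η p * g p.1 =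
      columnWeight s η p * u p := fun p => by ring
  simp only [h2] at h1
  refine h1.trans (mul_le_mul' le_rfl (add_le_add ?_ ?_))
  · exact hg.lintegral_columnWeight_sub_sq_le hη hb hu
  · exact lintegral_columnWeight_fst_sq_le hη hg.1

end Weights

/-! ### Limits in the homogeneous Sobolev space -/

section Limits

variable {s : Phase} {η : Horiz d → ℝ} {b : Option (Horiz d → ℝ)} {h : ℝ}

/-- The potentials converge only after multiplication by the weight. The weight is positive and
continuous, so its inverse can be moved onto the compactly supported test function. -/
lemma isWeakGradient_of_tendsto (hη : Continuous η) {v : ℕ → Pt d → ℝ} {V : ℕ → Pt d → Vec d}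
    {V' : Pt d → Vec d} {F : Pt d → ℝ} {U : Set (Pt d)} (hv : ∀ n, MemHDotOne U (v n) (V n))
    (hV' : MemLp V' 2 (volume.restrict U))
    (hVV' : Tendsto (fun n => ∫⁻ p in U, ‖V n p - V' p‖ₑ ^ 2) atTop (𝓝 0))
    (hf : ∀ n, MemLp (fun p => columnWeight s η p * v n p) 2 (volume.restrict U))
    (hF : MemLp F 2 (volume.restrict U))
    (hvF : Tendsto (fun n => ∫⁻ p in U, ‖columnWeight s η p * v n p - F p‖ₑ ^ 2) atTop (𝓝 0)) :
    IsWeakGradient U (fun p => (columnWeight s η p)⁻¹ * F p) V' := by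
  intro ψ hψ hψc hψs e
  have hQpos := columnWeight_pos s η
  have hQinv : Continuous fun p => (columnWeight s η p)⁻¹ :=
    (continuous_columnWeight s hη).inv₀ fun p => (hQpos p).ne'
  have hDcont : Continuous fun p => fderiv ℝ ψ p (WithLp.ofLp e) :=
    (hψ.continuous_fderiv (by simp)).clm_apply continuous_const
  have hDc : HasCompactSupport fun p => fderiv ℝ ψ p (WithLp.ofLp e) :=
    hψc.fderiv_apply (𝕜 := ℝ) _
  have hφ : MemLp (fun p => (columnWeight s η p)⁻¹ * fderiv ℝ ψ p (WithLp.ofLp e)) 2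
      (volume.restrict U) :=
    ((hQinv.mul hDcont).memLp_of_hasCompactSupport (p := 2) hDc.mul_left).restrict U
  have h1 := tendsto_integral_mul_of_lintegral_sub_sq hf hF hφ hvF
  have hψ2 : MemLp ψ 2 (volume.restrict U) :=
    (hψ.continuous.memLp_of_hasCompactSupport (p := 2) hψc).restrict U
  have h2 := tendsto_integral_mul_of_lintegral_sub_sq (fun n => (hv n).2.1.inner_const e)
    (hV'.inner_const e) hψ2 (by
      have h3 : Tendsto (fun n => ‖e‖ₑ ^ 2 * ∫⁻ p in U, ‖V n p - V' p‖ₑ ^ 2) atTop (𝓝 0) := by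
        simpa using ENNReal.Tendsto.const_mul (a := ‖e‖ₑ ^ 2) hVV' (Or.inr (by simp))
      refine tendsto_of_tendsto_of_tendsto_of_le_of_le tendsto_const_nhds h3
        (fun _ => zero_le) fun n => ?_
      simp only
      rw [← lintegral_const_mul' _ _ (by simp)]
      refine lintegral_mono fun p => ?_
      rw [← inner_sub_left, ← mul_pow]
      refine pow_le_pow_left' ?_ 2
      rw [mul_comm, ← ofReal_norm, ← ofReal_norm, ← ofReal_norm,
        ← ENNReal.ofReal_mul (norm_nonneg _)]
      exact ENNReal.ofReal_le_ofReal (norm_inner_le_norm _ _))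
  have h4 : ∀ n, ∫ p in U, columnWeight s η p * v n p *
      ((columnWeight s η p)⁻¹ * fderiv ℝ ψ p (WithLp.ofLp e)) =
      -∫ p in U, inner ℝ (V n p) e * ψ p := by
    intro n
    rw [← (hv n).2.2 ψ hψ hψc hψs e]
    refine integral_congr_ae (ae_of_all _ fun p => ?_)
    have := (hQpos p).ne'
    field_simp
  simp only [h4] at h1
  have h5 := tendsto_nhds_unique h1 h2.neg
  rw [← h5]
  refine integral_congr_ae (ae_of_all _ fun p => ?_)
  ring

/-- A trace is not obviously stable under limits, since its definition contains the limit `ε → 0`.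
The bound of the layer integral by `ε²` times the energy is uniform in `n`, so it survives the
passage to the limit and still beats the division by `ε`. -/
lemma hasTrace_of_tendsto (hη : Continuous η) (hb : ∀ β ∈ b, Continuous β) (hh : 0 < h)
    (hdep : ∀ β ∈ b, ∀ x, h ≤ s.sgn * (β x - η x))
    {v : ℕ → Pt d → ℝ} {V : ℕ → Pt d → Vec d} {g : ℕ → Horiz d → ℝ} {V' : Pt d → Vec d}
    {g' : Horiz d → ℝ} {F : Pt d → ℝ}
    (hv : ∀ n, MemHDotOne (fluidDomain s η b) (v n) (V n)) (hg : ∀ n, HasTrace s η (v n) (g n))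
    (hV' : MemLp V' 2 (volume.restrict (fluidDomain s η b)))
    (hVV' : Tendsto (fun n => ∫⁻ p in fluidDomain s η b, ‖V n p - V' p‖ₑ ^ 2) atTop (𝓝 0))
    (hg' : AEStronglyMeasurable g' volume)
    (hgg' : Tendsto (fun n => ∫⁻ x, ‖decayWeight d x * (g n x - g' x)‖ₑ ^ 2) atTop (𝓝 0))
    (hF : MemLp F 2 (volume.restrict (fluidDomain s η b)))
    (hvF : Tendsto (fun n => ∫⁻ p in fluidDomain s η b,
      ‖columnWeight s η p * v n p - F p‖ₑ ^ 2) atTop (𝓝 0)) :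
    HasTrace s η (fun p => (columnWeight s η p)⁻¹ * F p) g' := by
  set Ω := fluidDomain s η b with hΩ
  set Q := columnWeight s η with hQ
  have hQpos : ∀ p, 0 < Q p := columnWeight_pos s η
  have hΩo : IsOpen Ω := isOpen_fluidDomain s hη hb
  set E := ∫⁻ p in Ω, ‖V' p‖ₑ ^ 2 with hE
  have hEfin : E ≠ ⊤ := (memLp_two_iff.1 hV').2.ne
  refine ⟨hg', fun K hK => ?_⟩
  have hfst : ∀ {f : Horiz d → ℝ} {S : Set (Pt d)}, AEStronglyMeasurable f volume →
      AEStronglyMeasurable (fun p : Pt d => f p.1) (volume.restrict S) :=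
    fun hf => (aestronglyMeasurable_fst hf).restrict
  -- For fixed `ε` the limit `n → ∞` is taken first, which removes all terms but the energy of the
  -- limit field.
  have key : ∀ ε : ℝ, 0 < ε → ε ≤ h →
      ∫⁻ p in layer s η K ε, ‖F p - Q p * g' p.1‖ₑ ^ 2 ≤ 8 * (ENNReal.ofReal ε ^ 2 * E) := by
    intro ε hε hεh
    have hlay : layer s η K ε ⊆ Ω := layer_subset hdep hεh K
    have hbound : ∀ n, ∫⁻ p in layer s η K ε, ‖F p - Q p * g' p.1‖ₑ ^ 2 ≤
        2 * (2 * ((∫⁻ p in Ω, ‖Q p * v n p - F p‖ₑ ^ 2) +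
          ∫⁻ x, ‖decayWeight d x * (g n x - g' x)‖ₑ ^ 2) +
          ENNReal.ofReal ε ^ 2 * (2 * ((∫⁻ p in Ω, ‖V n p - V' p‖ₑ ^ 2) + E))) := by
      intro n
      have hQm : ∀ S : Set (Pt d), AEStronglyMeasurable Q (volume.restrict S) := fun S =>
        (continuous_columnWeight s hη).aestronglyMeasurable
      have hvm := (hv n).1.aestronglyMeasurable hΩo
      have hm1 : AEStronglyMeasurable (fun p => F p - Q p * v n p) (volume.restrict Ω) :=
        hF.1.sub ((hQm Ω).mul hvm)
      have hm2 : AEStronglyMeasurable (fun p : Pt d => Q p * (g n p.1 - g' p.1))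
          (volume.restrict Ω) := (hQm Ω).mul ((hfst (hg n).1).sub (hfst hg'))
      have h1 := lintegral_enorm_add_sq_le (m := volume.restrict (layer s η K ε))
        (f := fun p => (F p - Q p * v n p) + Q p * (g n p.1 - g' p.1))
        (g := fun p => Q p * (v n p - g n p.1))
        ((hm1.add hm2).mono_set hlay)
      have h2 : ∀ p : Pt d, (F p - Q p * v n p) + Q p * (g n p.1 - g' p.1) +
          Q p * (v n p - g n p.1) = F p - Q p * g' p.1 := fun p => by ring
      simp only [h2] at h1
      refine h1.trans (mul_le_mul' le_rfl (add_le_add ?_ ?_))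
      · refine (lintegral_mono_set hlay).trans ((lintegral_enorm_add_sq_le hm1).trans
          (mul_le_mul' le_rfl (add_le_add (le_of_eq ?_) ?_)))
        · simp only [enorm_sub_rev (F _)]
        · exact lintegral_columnWeight_fst_sq_le hη ((hg n).1.sub hg')
      · have h3 : ∫⁻ p in layer s η K ε, ‖Q p * (v n p - g n p.1)‖ₑ ^ 2 ≤
            ∫⁻ p in layer s η K ε, ‖v n p - g n p.1‖ₑ ^ 2 := by
          refine setLIntegral_mono' (measurableSet_layer s hη hK.measurableSet ε) fun p hp => ?_
          refine pow_le_pow_left' ?_ 2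
          rw [enorm_mul]
          refine mul_le_of_le_one_left' ?_
          rw [Real.enorm_eq_ofReal (hQpos p).le]
          refine ENNReal.ofReal_le_one.2 ?_
          refine mul_le_one₀ (decayWeight_le_one _) (Real.exp_pos _).le ?_
          rw [Real.exp_le_one_iff]
          linarith [(mem_layer_iff.1 hp).2.1]
        refine h3.trans (((hg n).lintegral_layer_sub_sq_le hη hb (hv n) hdep hεh
          hK.measurableSet).trans (mul_le_mul' le_rfl ?_))
        have h4 := lintegral_enorm_add_sq_le (m := volume.restrict Ω)
          (f := fun p => V n p - V' p) (g := V') ((hv n).2.1.1.sub hV'.1)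
        simpa using h4
    have hlim : Tendsto (fun n => 2 * (2 * ((∫⁻ p in Ω, ‖Q p * v n p - F p‖ₑ ^ 2) +
          ∫⁻ x, ‖decayWeight d x * (g n x - g' x)‖ₑ ^ 2) +
          ENNReal.ofReal ε ^ 2 * (2 * ((∫⁻ p in Ω, ‖V n p - V' p‖ₑ ^ 2) + E)))) atTop
        (𝓝 (2 * (2 * (0 + 0) + ENNReal.ofReal ε ^ 2 * (2 * (0 + E))))) := by
      refine ENNReal.Tendsto.const_mul (Tendsto.add (ENNReal.Tendsto.const_mul
        (hvF.add hgg') (Or.inr (by simp))) (ENNReal.Tendsto.const_mul (ENNReal.Tendsto.const_mul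
        (hVV'.add tendsto_const_nhds) (Or.inr (by simp))) (Or.inr (by simp)))) (Or.inr (by simp))
    refine (ge_of_tendsto' hlim hbound).trans ?_
    simp only [add_zero, mul_zero, zero_add]
    rw [mul_left_comm _ 2, ← mul_assoc]
    refine mul_le_mul' ?_ le_rfl
    norm_num
  -- Over the compact `K` and at heights below one the weight is at least `c exp(-1) > 0`, so it can
  -- be divided out.
  obtain ⟨c, hc0, hc⟩ := hK.exists_forall_le' (a := 0)
    (continuous_decayWeight (d := d)).continuousOn fun x _ => decayWeight_pos x
  set c' := c * Real.exp (-1) with hc'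
  have hc'0 : 0 < c' := mul_pos hc0 (Real.exp_pos _)
  have hb2 : ∀ ε : ℝ, 0 < ε → ε ≤ h → ε ≤ 1 →
      (∫⁻ p in layer s η K ε, ‖(Q p)⁻¹ * F p - g' p.1‖ₑ ^ 2) / ENNReal.ofReal ε ≤
        ENNReal.ofReal c'⁻¹ ^ 2 * (8 * E) * ENNReal.ofReal ε := by
    intro ε hε hεh hε1
    refine ENNReal.div_le_of_le_mul ?_
    calc _ ≤ ∫⁻ p in layer s η K ε, ENNReal.ofReal c'⁻¹ ^ 2 * ‖F p - Q p * g' p.1‖ₑ ^ 2 := by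
          refine setLIntegral_mono' (measurableSet_layer s hη hK.measurableSet ε) fun p hp => ?_
          obtain ⟨hp1, hp2, hp3⟩ := mem_layer_iff.1 hp
          rw [← mul_pow]
          refine pow_le_pow_left' ?_ 2
          have h1 : (Q p)⁻¹ * F p - g' p.1 = (Q p)⁻¹ * (F p - Q p * g' p.1) := by
            have := (hQpos p).ne'
            field_simp
          rw [h1, enorm_mul]
          refine mul_le_mul' ?_ le_rfl
          rw [Real.enorm_eq_ofReal (inv_pos.2 (hQpos p)).le]
          refine ENNReal.ofReal_le_ofReal (inv_anti₀ hc'0 ?_)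
          refine mul_le_mul (hc _ hp1) (Real.exp_le_exp.2 ?_) (Real.exp_pos _).le
            (decayWeight_pos _).le
          linarith
      _ = ENNReal.ofReal c'⁻¹ ^ 2 * ∫⁻ p in layer s η K ε, ‖F p - Q p * g' p.1‖ₑ ^ 2 :=
          lintegral_const_mul' _ _ (by simp)
      _ ≤ ENNReal.ofReal c'⁻¹ ^ 2 * (8 * (ENNReal.ofReal ε ^ 2 * E)) :=
          mul_le_mul' le_rfl (key ε hε hεh)
      _ = _ := by ring
  have hlim2 : Tendsto (fun ε : ℝ => ENNReal.ofReal c'⁻¹ ^ 2 * (8 * E) * ENNReal.ofReal ε)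
      (𝓝[>] 0) (𝓝 0) := by
    have h1 : Tendsto (fun ε : ℝ => ENNReal.ofReal ε) (𝓝[>] 0) (𝓝 0) := by
      simpa using (ENNReal.continuous_ofReal.tendsto 0).mono_left nhdsWithin_le_nhds
    simpa using ENNReal.Tendsto.const_mul (a := ENNReal.ofReal c'⁻¹ ^ 2 * (8 * E)) h1
      (Or.inr (ENNReal.mul_ne_top (by simp) (ENNReal.mul_ne_top (by simp) hEfin)))
  refine tendsto_of_tendsto_of_tendsto_of_le_of_le' tendsto_const_nhds hlim2
    (Eventually.of_forall fun _ => zero_le) ?_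
  filter_upwards [Ioo_mem_nhdsGT (lt_min hh zero_lt_one)] with ε hε
  exact hb2 ε hε.1 (hε.2.le.trans (min_le_left _ _)) (hε.2.le.trans (min_le_right _ _))

/-- The weighted potentials are Cauchy in `L²`, because differences are controlled by the energy and
by the weighted norm of their traces. The limit divided by the weight is the potential sought. -/
lemma exists_memHDotOne_of_tendsto (hη : Continuous η) (hb : ∀ β ∈ b, Continuous β) (hh : 0 < h)
    (hdep : ∀ β ∈ b, ∀ x, h ≤ s.sgn * (β x - η x))
    {v : ℕ → Pt d → ℝ} {V : ℕ → Pt d → Vec d} {g : ℕ → Horiz d → ℝ} {V' : Pt d → Vec d}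
    {g' : Horiz d → ℝ}
    (hv : ∀ n, MemHDotOne (fluidDomain s η b) (v n) (V n)) (hg : ∀ n, HasTrace s η (v n) (g n))
    (hV' : MemLp V' 2 (volume.restrict (fluidDomain s η b)))
    (hVV' : Tendsto (fun n => ∫⁻ p in fluidDomain s η b, ‖V n p - V' p‖ₑ ^ 2) atTop (𝓝 0))
    (hgw : ∀ n, MemLp (fun x => decayWeight d x * g n x) 2 volume)
    (hg' : AEStronglyMeasurable g' volume)
    (hgg' : Tendsto (fun n => ∫⁻ x, ‖decayWeight d x * (g n x - g' x)‖ₑ ^ 2) atTop (𝓝 0)) :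
    ∃ v', MemHDotOne (fluidDomain s η b) v' V' ∧ HasTrace s η v' g' := by
  set Ω := fluidDomain s η b with hΩ
  have hΩo : IsOpen Ω := isOpen_fluidDomain s hη hb
  have hQm : AEStronglyMeasurable (columnWeight s η) (volume.restrict Ω) :=
    (continuous_columnWeight s hη).aestronglyMeasurable
  have hf : ∀ n, MemLp (fun p => columnWeight s η p * v n p) 2 (volume.restrict Ω) := fun n =>
    memLp_two_iff.2 ⟨hQm.mul ((hv n).1.aestronglyMeasurable hΩo),
      ((hg n).lintegral_columnWeight_sq_le hη hb (hv n)).trans_lt (ENNReal.mul_lt_top (by simp)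
        (ENNReal.add_lt_top.2 ⟨(memLp_two_iff.1 (hv n).2.1).2, (memLp_two_iff.1 (hgw n)).2⟩))⟩
  have hdm : AEStronglyMeasurable (decayWeight d) volume :=
    continuous_decayWeight.aestronglyMeasurable
  obtain ⟨F, hF, hvF⟩ := exists_limit_of_lintegral_sub_sq_le hf (C := 4) (by simp)
    (a := fun n => (∫⁻ p in Ω, ‖V n p - V' p‖ₑ ^ 2) +
      ∫⁻ x, ‖decayWeight d x * (g n x - g' x)‖ₑ ^ 2)
    (by simpa using hVV'.add hgg') (by
      intro n k
      have h1 := ((hg n).sub hh hdep ((hv n).1.aestronglyMeasurable hΩo)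
        (hg k)).lintegral_columnWeight_sq_le hη hb ((hv n).sub (hv k))
      have h2 := lintegral_enorm_sub_sq_le (g := V k) (hv n).2.1.1 hV'.1
      have h3 := lintegral_enorm_sub_sq_le (m := volume) (f := fun x => decayWeight d x * g n x)
        (g := fun x => decayWeight d x * g k x) (h := fun x => decayWeight d x * g' x)
        (hdm.mul (hg n).1) (hdm.mul hg')
      simp only [← mul_sub] at h3 ⊢
      calc _ ≤ _ := h1
        _ ≤ 2 * (2 * ((∫⁻ p in Ω, ‖V n p - V' p‖ₑ ^ 2) + ∫⁻ p in Ω, ‖V k p - V' p‖ₑ ^ 2) +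
            2 * ((∫⁻ x, ‖decayWeight d x * (g n x - g' x)‖ₑ ^ 2) +
              ∫⁻ x, ‖decayWeight d x * (g k x - g' x)‖ₑ ^ 2)) :=
          mul_le_mul' le_rfl (add_le_add h2 h3)
        _ = _ := by ring)
  refine ⟨fun p => (columnWeight s η p)⁻¹ * F p, ⟨fun K hK hKΩ => ?_, hV',
    isWeakGradient_of_tendsto hη hv hV' hVV' hf hF hvF⟩,
    hasTrace_of_tendsto hη hb hh hdep hv hg hV' hVV' hg' hgg' hF hvF⟩
  have hQinv : Continuous fun p => (columnWeight s η p)⁻¹ :=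
    (continuous_columnWeight s hη).inv₀ fun p => (columnWeight_pos s η p).ne'
  obtain ⟨M, hM⟩ := hK.exists_bound_of_continuousOn hQinv.continuousOn
  have hFK : MemLp F 2 (volume.restrict K) := hF.mono_measure (Measure.restrict_mono_set _ hKΩ)
  refine hFK.of_le_mul (c := M) (hQinv.aestronglyMeasurable.mul hFK.1) ?_
  filter_upwards [ae_restrict_mem hK.measurableSet] with p hp
  rw [norm_mul]
  exact mul_le_mul_of_nonneg_right (hM p hp) (norm_nonneg _)

end Limits

/-! ### The weighted energy space -/

/-- The measure `μ₊⁻¹ dx dy` on `Ω⁺` and `μ₋⁻¹ dx dy` on `Ω⁻`. -/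
def energyMeasure (μ : Phase → ℝ) (η : Horiz d → ℝ) (b : Phase → Option (Horiz d → ℝ)) :
    Measure (Pt d) :=
  ENNReal.ofReal (1 / μ .upper) • volume.restrict (fluidDomain .upper η (b .upper)) +
    ENNReal.ofReal (1 / μ .lower) • volume.restrict (fluidDomain .lower η (b .lower))

/-- The vector field that agrees with `V s` in the domain of phase `s`. -/
def glue (η : Horiz d → ℝ) (b : Phase → Option (Horiz d → ℝ)) (V : Phase → Pt d → Vec d)
    (p : Pt d) : Vec d :=
  (fluidDomain .upper η (b .upper)).indicator (V .upper) p +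
    (fluidDomain .lower η (b .lower)).indicator (V .lower) p

/-- `V` is the gradient of a pair of functions in the two fluid domains whose traces on the
interface agree. -/
def IsCompatible (η : Horiz d → ℝ) (b : Phase → Option (Horiz d → ℝ)) (V : Pt d → Vec d) : Prop :=
  ∃ (v : Phase → Pt d → ℝ) (g : Horiz d → ℝ), ∀ s,
    MemHDotOne (fluidDomain s η (b s)) (v s) V ∧ HasTrace s η (v s) g

lemma integrable_inner_of_memLp {X : Type*} [MeasurableSpace X] {m : Measure X} {F G : X → Vec d}
    (hF : MemLp F 2 m) (hG : MemLp G 2 m) : Integrable (fun x => (inner ℝ (F x) (G x) : ℝ)) m := by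
  refine (L2.integrable_inner (𝕜 := ℝ) hF.toLp hG.toLp).congr ?_
  filter_upwards [hF.coeFn_toLp, hG.coeFn_toLp] with x hx hx'
  rw [hx, hx']

section Energy

variable {μ : Phase → ℝ} {η : Horiz d → ℝ} {b : Phase → Option (Horiz d → ℝ)}

lemma disjoint_fluidDomain (η : Horiz d → ℝ) (b b' : Option (Horiz d → ℝ)) :
    Disjoint (fluidDomain .upper η b) (fluidDomain .lower η b') := by
  rw [Set.disjoint_left]
  intro p hp hp'
  have h1 := hp.1
  have h2 := hp'.1
  simp only [Phase.sgn] at h1 h2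
  linarith

lemma glue_eq {V : Phase → Pt d → Vec d} {s : Phase} {p : Pt d}
    (hp : p ∈ fluidDomain s η (b s)) : glue η b V p = V s p := by
  have hdis := disjoint_fluidDomain η (b .upper) (b .lower)
  cases s with
  | upper =>
    rw [glue, indicator_of_mem hp, indicator_of_notMem (Set.disjoint_left.1 hdis hp), add_zero]
  | lower =>
    rw [glue, indicator_of_mem hp, indicator_of_notMem (Set.disjoint_right.1 hdis hp), zero_add]

lemma glue_ae_eq (hη : Continuous η) (hb : ∀ s, ∀ β ∈ b s, Continuous β)
    (V : Phase → Pt d → Vec d) (s : Phase) :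
    glue η b V =ᵐ[volume.restrict (fluidDomain s η (b s))] V s := by
  filter_upwards [ae_restrict_mem (isOpen_fluidDomain s hη (hb s)).measurableSet] with p hp
  exact glue_eq hp

lemma ae_energyMeasure_iff (hμ : ∀ s, 0 < μ s) {P : Pt d → Prop} :
    (∀ᵐ p ∂(energyMeasure μ η b), P p) ↔
      ∀ s, ∀ᵐ p ∂(volume.restrict (fluidDomain s η (b s))), P p := by
  have h1 : ∀ s, ENNReal.ofReal (1 / μ s) ≠ 0 := fun s => by
    have := hμ s
    simp [this]
  rw [energyMeasure, ae_add_measure_iff, Measure.ae_ennreal_smul_measure_iff (h1 _),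
    Measure.ae_ennreal_smul_measure_iff (h1 _)]
  exact ⟨fun h s => by cases s; exacts [h.1, h.2], fun h => ⟨h _, h _⟩⟩

lemma lintegral_energyMeasure (F : Pt d → ℝ≥0∞) :
    ∫⁻ p, F p ∂(energyMeasure μ η b) =
      ENNReal.ofReal (1 / μ .upper) * (∫⁻ p in fluidDomain .upper η (b .upper), F p) +
      ENNReal.ofReal (1 / μ .lower) * ∫⁻ p in fluidDomain .lower η (b .lower), F p := by
  rw [energyMeasure, lintegral_add_measure, lintegral_smul_measure, lintegral_smul_measure]
  rfl

lemma setLIntegral_le_energyMeasure (hμ : ∀ s, 0 < μ s) (s : Phase) (F : Pt d → ℝ≥0∞) :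
    ∫⁻ p in fluidDomain s η (b s), F p ≤
      ENNReal.ofReal (μ s) * ∫⁻ p, F p ∂(energyMeasure μ η b) := by
  have h1 : ENNReal.ofReal (1 / μ s) * (∫⁻ p in fluidDomain s η (b s), F p) ≤
      ∫⁻ p, F p ∂(energyMeasure μ η b) := by
    rw [lintegral_energyMeasure]
    cases s
    exacts [le_self_add, le_add_self]
  refine le_trans (le_of_eq ?_) (mul_le_mul' le_rfl h1)
  rw [← mul_assoc, ← ENNReal.ofReal_mul (hμ s).le, mul_one_div_cancel (hμ s).ne',
    ENNReal.ofReal_one, one_mul]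

lemma integral_energyMeasure (hμ : ∀ s, 0 < μ s) {F : Pt d → ℝ}
    (hF : ∀ s, IntegrableOn F (fluidDomain s η (b s))) :
    ∫ p, F p ∂(energyMeasure μ η b) =
      1 / μ .upper * (∫ p in fluidDomain .upper η (b .upper), F p) +
      1 / μ .lower * ∫ p in fluidDomain .lower η (b .lower), F p := by
  have h1 : ∀ s, 0 ≤ 1 / μ s := fun s => (one_div_pos.2 (hμ s)).le
  rw [energyMeasure, integral_add_measure ((hF _).smul_measure ENNReal.ofReal_ne_top)
    ((hF _).smul_measure ENNReal.ofReal_ne_top), integral_smul_measure, integral_smul_measure,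
    ENNReal.toReal_ofReal (h1 _), ENNReal.toReal_ofReal (h1 _), smul_eq_mul, smul_eq_mul]

lemma memLp_energyMeasure_iff (hμ : ∀ s, 0 < μ s) {F : Pt d → Vec d} :
    MemLp F 2 (energyMeasure μ η b) ↔
      ∀ s, MemLp F 2 (volume.restrict (fluidDomain s η (b s))) := by
  have h1 : ∀ s, ENNReal.ofReal (1 / μ s) ≠ 0 := fun s => by
    have := hμ s
    simp [this]
  constructor
  · intro h s
    have h2 := memLp_two_iff.1 h
    refine memLp_two_iff.2 ⟨?_, (setLIntegral_le_energyMeasure hμ s _).trans_lt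
      (ENNReal.mul_lt_top ENNReal.ofReal_lt_top h2.2)⟩
    have h3 : volume.restrict (fluidDomain s η (b s)) ≪ energyMeasure μ η b := by
      refine Measure.AbsolutelyContinuous.mk fun t _ ht0 => ?_
      have h4 : ∀ᵐ p ∂(energyMeasure μ η b), p ∉ t := measure_eq_zero_iff_ae_notMem.1 ht0
      exact measure_eq_zero_iff_ae_notMem.2 ((ae_energyMeasure_iff hμ).1 h4 s)
    exact h2.1.mono_ac h3
  · intro h
    refine memLp_two_iff.2 ⟨?_, ?_⟩
    · exact ((h .upper).1.smul_measure _).add_measure ((h .lower).1.smul_measure _)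
    · rw [lintegral_energyMeasure]
      exact ENNReal.add_lt_top.2 ⟨ENNReal.mul_lt_top ENNReal.ofReal_lt_top (memLp_two_iff.1 (h _)).2,
        ENNReal.mul_lt_top ENNReal.ofReal_lt_top (memLp_two_iff.1 (h _)).2⟩

lemma IsCompatible.congr {V W : Pt d → Vec d} (hV : IsCompatible η b V) (hμ : ∀ s, 0 < μ s)
    (h : V =ᵐ[energyMeasure μ η b] W) : IsCompatible η b W := by
  obtain ⟨v, g, hv⟩ := hV
  exact ⟨v, g, fun s => ⟨(hv s).1.congr (ae_eq_refl _) ((ae_energyMeasure_iff hμ).1 h s),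
    (hv s).2⟩⟩

lemma IsCompatible.memLp {V : Pt d → Vec d} (hV : IsCompatible η b V) (hμ : ∀ s, 0 < μ s) :
    MemLp V 2 (energyMeasure μ η b) := by
  obtain ⟨v, g, hv⟩ := hV
  exact (memLp_energyMeasure_iff hμ).2 fun s => (hv s).1.2.1

lemma isCompatible_glue (hη : Continuous η) (hb : ∀ s, ∀ β ∈ b s, Continuous β)
    {v : Phase → Pt d → ℝ} {V : Phase → Pt d → Vec d} {g : Horiz d → ℝ}
    (hv : ∀ s, MemHDotOne (fluidDomain s η (b s)) (v s) (V s))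
    (hg : ∀ s, HasTrace s η (v s) g) : IsCompatible η b (glue η b V) :=
  ⟨v, g, fun s => ⟨(hv s).congr (ae_eq_refl _) (glue_ae_eq hη hb V s).symm, hg s⟩⟩

/-- The gradients of compatible pairs, as a subspace of the weighted `L²` space. -/
def compatibleSubmodule {h : ℝ} (hμ : ∀ s, 0 < μ s) (hη : Continuous η)
    (hb : ∀ s, ∀ β ∈ b s, Continuous β) (hh : 0 < h)
    (hdep : ∀ s, ∀ β ∈ b s, ∀ x, h ≤ s.sgn * (β x - η x)) :
    Submodule ℝ (Lp (Vec d) 2 (energyMeasure μ η b)) where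
  carrier := {V | IsCompatible η b V}
  zero_mem' := by
    refine IsCompatible.congr (V := fun _ => 0) (μ := μ) ?_ hμ (Lp.coeFn_zero _ _ _).symm
    exact ⟨fun _ _ => 0, fun _ => 0, fun s =>
      ⟨memHDotOne_const 0, hasTrace_const s η 0⟩⟩
  add_mem' := by
    rintro V W ⟨v, g, hv⟩ ⟨w, g', hw⟩
    refine IsCompatible.congr (μ := μ) ?_ hμ (Lp.coeFn_add V W).symm
    exact ⟨fun s p => v s p + w s p, fun x => g x + g' x, fun s => ⟨(hv s).1.add (hw s).1,
      (hv s).2.add hh (hdep s) ((hv s).1.1.aestronglyMeasurable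
        (isOpen_fluidDomain s hη (hb s))) (hw s).2⟩⟩
  smul_mem' := by
    rintro c V ⟨v, g, hv⟩
    refine IsCompatible.congr (μ := μ) ?_ hμ (Lp.coeFn_smul c V).symm
    exact ⟨fun s p => c * v s p, fun x => c * g x, fun s => ⟨(hv s).1.const_mul c,
      (hv s).2.const_mul c⟩⟩

end Energy

/-! ### Closedness of the space of compatible gradients -/

/-- Gradients determine potentials only up to constants, which could escape to infinity. Subtracting
the same constant, a local mean of the common trace, in both phases keeps the traces equal and makes
them converge in weighted `L²`, by the weighted trace inequality in one phase. Both phases then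
share the limit trace. -/
lemma IsCompatible.of_tendsto {η : Horiz d → ℝ} {b : Phase → Option (Horiz d → ℝ)}
    {Lη Lβ h : ℝ} (hLη : ∀ x y, |η x - η y| ≤ Lη * ‖x - y‖)
    (hLβ : ∀ s, ∀ β ∈ b s, ∀ x y, |β x - β y| ≤ Lβ * ‖x - y‖) (hLη0 : 0 ≤ Lη) (hLβ0 : 0 ≤ Lβ)
    (hh : 0 < h) (hdep : ∀ s, ∀ β ∈ b s, ∀ x, h ≤ s.sgn * (β x - η x))
    {V : ℕ → Pt d → Vec d} {V' : Pt d → Vec d} (hV : ∀ n, IsCompatible η b (V n))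
    (hV' : ∀ s, MemLp V' 2 (volume.restrict (fluidDomain s η (b s))))
    (hlim : ∀ s, Tendsto (fun n => ∫⁻ p in fluidDomain s η (b s), ‖V n p - V' p‖ₑ ^ 2)
      atTop (𝓝 0)) : IsCompatible η b V' := by
  have hη := continuous_of_abs_sub_le hLη
  have hb : ∀ s, ∀ β ∈ b s, Continuous β := fun s β hβ => continuous_of_abs_sub_le (hLβ s β hβ)
  have hΩo : ∀ s, IsOpen (fluidDomain s η (b s)) := fun s => isOpen_fluidDomain s hη (hb s)
  obtain ⟨r, hr, C, hC, hpoin⟩ := exists_weighted_trace_inequality (s := .upper) hLη (hLβ .upper)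
    hLη0 hLβ0 hh (hdep .upper)
  choose v g hv using hV
  have hg2 : ∀ n, MemL2Loc univ (g n) := fun n =>
    (hv n .upper).2.memL2Loc hη hh (hdep _) (hv n .upper).1.1
  set c : ℕ → ℝ := fun n => localMean r (g n) 0 with hc
  have hvm : ∀ n s, AEStronglyMeasurable (v n s) (volume.restrict (fluidDomain s η (b s))) :=
    fun n s => (hv n s).1.1.aestronglyMeasurable (hΩo s)
  have hv' : ∀ n s, MemHDotOne (fluidDomain s η (b s)) (fun p => v n s p - c n) (V n) := by
    intro n s
    simpa using (hv n s).1.sub (memHDotOne_const (c n))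
  have hg' : ∀ n s, HasTrace s η (fun p => v n s p - c n) (fun x => g n x - c n) := fun n s =>
    (hv n s).2.sub hh (hdep s) (hvm n s) (hasTrace_const s η (c n))
  have hdm : AEStronglyMeasurable (decayWeight d) volume :=
    continuous_decayWeight.aestronglyMeasurable
  have hgw : ∀ n, MemLp (fun x => decayWeight d x * (g n x - c n)) 2 volume := fun n =>
    memLp_two_iff.2 ⟨hdm.mul ((hv n .upper).2.1.sub aestronglyMeasurable_const),
      (hpoin _ _ _ (hv n .upper).1 (hv n .upper).2).trans_lt
        (ENNReal.mul_lt_top hC.lt_top (memLp_two_iff.1 (hv n .upper).1.2.1).2)⟩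
  -- Local means are linear, so the difference of two normalized traces is the normalized difference
  -- and the trace inequality applies to it.
  obtain ⟨A, hA, hgA⟩ := exists_limit_of_lintegral_sub_sq_le hgw (C := C * 2)
    (ENNReal.mul_ne_top hC (by simp)) (hlim .upper) (by
      intro n k
      have h1 := hpoin _ _ _ ((hv n .upper).1.sub (hv k .upper).1)
        ((hv n .upper).2.sub hh (hdep _) (hvm n .upper) (hv k .upper).2)
      rw [localMean_sub (hg2 n) (hg2 k) hr] at h1
      have h2 := lintegral_enorm_sub_sq_le (g := V k) (hv n .upper).1.2.1.1 (hV' .upper).1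
      calc _ = ∫⁻ x, ‖decayWeight d x * (g n x - g k x - (c n - c k))‖ₑ ^ 2 := by
            refine lintegral_congr fun x => ?_
            rw [← mul_sub]
            congr 3; ring
        _ ≤ _ := h1
        _ ≤ _ := mul_le_mul' le_rfl h2
        _ = _ := by ring)
  have hdecay : ∀ x, decayWeight d x * ((decayWeight d x)⁻¹ * A x) = A x := fun x => by
    have := (decayWeight_pos x).ne'
    field_simp
  have hAm : AEStronglyMeasurable (fun x => (decayWeight d x)⁻¹ * A x) volume :=
    (continuous_decayWeight.inv₀ fun x => (decayWeight_pos x).ne').aestronglyMeasurable.mul hA.1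
  have hex : ∀ s, ∃ v', MemHDotOne (fluidDomain s η (b s)) v' V' ∧
      HasTrace s η v' (fun x => (decayWeight d x)⁻¹ * A x) := fun s =>
    exists_memHDotOne_of_tendsto hη (hb s) hh (hdep s) (fun n => hv' n s) (fun n => hg' n s)
      (hV' s) (hlim s) hgw hAm (by simpa only [mul_sub, hdecay] using hgA)
  choose v' hv'' using hex
  exact ⟨v', _, hv''⟩

section Closed

variable {μ : Phase → ℝ} {η : Horiz d → ℝ} {b : Phase → Option (Horiz d → ℝ)} {Lη Lβ h : ℝ}

lemma isClosed_compatibleSubmodule (hμ : ∀ s, 0 < μ s)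
    (hLη : ∀ x y, |η x - η y| ≤ Lη * ‖x - y‖)
    (hLβ : ∀ s, ∀ β ∈ b s, ∀ x y, |β x - β y| ≤ Lβ * ‖x - y‖) (hLη0 : 0 ≤ Lη) (hLβ0 : 0 ≤ Lβ)
    (hη : Continuous η) (hb : ∀ s, ∀ β ∈ b s, Continuous β) (hh : 0 < h)
    (hdep : ∀ s, ∀ β ∈ b s, ∀ x, h ≤ s.sgn * (β x - η x)) :
    IsClosed (compatibleSubmodule hμ hη hb hh hdep : Set (Lp (Vec d) 2 (energyMeasure μ η b))) := by
  refine IsSeqClosed.isClosed fun V V' hV hlim => ?_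
  have h1 := (Lp.tendsto_Lp_iff_tendsto_eLpNorm' _ _).1 hlim
  have h2 := ((ENNReal.continuous_pow 2).tendsto 0).comp h1
  rw [zero_pow two_ne_zero] at h2
  simp only [Function.comp_def, eLpNorm_two_sq, Pi.sub_apply] at h2
  refine IsCompatible.of_tendsto (V := fun n => V n) hLη hLβ hLη0 hLβ0 hh hdep (fun n => hV n)
    ((memLp_energyMeasure_iff hμ).1 (Lp.memLp V')) fun s => ?_
  have h3 := ENNReal.Tendsto.const_mul (a := ENNReal.ofReal (μ s)) h2 (Or.inr (by simp))
  rw [mul_zero] at h3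
  exact tendsto_of_tendsto_of_tendsto_of_le_of_le tendsto_const_nhds h3 (fun _ => zero_le)
    fun n => setLIntegral_le_energyMeasure hμ s _

lemma lintegral_const_smul_sq {U : Set (Pt d)} (c : ℝ) (G : Pt d → Vec d) :
    ∫⁻ p in U, ‖c • G p‖ₑ ^ 2 = ENNReal.ofReal (c ^ 2) * ∫⁻ p in U, ‖G p‖ₑ ^ 2 := by
  rw [← lintegral_const_mul' _ _ ENNReal.ofReal_ne_top]
  refine lintegral_congr fun p => ?_
  rw [enorm_smul, mul_pow, ← sq_abs c, ENNReal.ofReal_pow (abs_nonneg c), ← Real.norm_eq_abs,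
    ofReal_norm]

/-- The weak form of the transmission problem: orthogonality of the gradient to the
compatible gradients, with the jump of the traces prescribed by that of `u`. -/
theorem exists_transmission_field (hμ : ∀ s, 0 < μ s)
    (hLη : ∀ x y, |η x - η y| ≤ Lη * ‖x - y‖)
    (hLβ : ∀ s, ∀ β ∈ b s, ∀ x y, |β x - β y| ≤ Lβ * ‖x - y‖) (hLη0 : 0 ≤ Lη) (hLβ0 : 0 ≤ Lβ)
    (hh : 0 < h) (hdep : ∀ s, ∀ β ∈ b s, ∀ x, h ≤ s.sgn * (β x - η x)) {u : Pt d → ℝ}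
    {G : Pt d → Vec d} {g₀ : Horiz d → ℝ}
    (hu : MemHDotOne (fluidDomain .upper η (b .upper)) u G) (hg₀ : HasTrace .upper η u g₀)
    (J : ℝ) :
    ∃ (f : Phase → Horiz d → ℝ) (φ : Phase → Pt d → ℝ) (Φ : Pt d → Vec d),
      (∀ s, MemHDotOne (fluidDomain s η (b s)) (φ s) Φ) ∧ (∀ s, HasTrace s η (φ s) (f s)) ∧
      (∀ x, f .upper x - f .lower x = J * g₀ x) ∧
      (∀ (v : Phase → Pt d → ℝ) (V : Phase → Pt d → Vec d) (g : Horiz d → ℝ),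
        (∀ s, MemHDotOne (fluidDomain s η (b s)) (v s) (V s)) → (∀ s, HasTrace s η (v s) g) →
        1 / μ .upper * (∫ p in fluidDomain .upper η (b .upper), inner ℝ (Φ p) (V .upper p)) +
        1 / μ .lower * (∫ p in fluidDomain .lower η (b .lower), inner ℝ (Φ p) (V .lower p)) = 0) ∧
      ∀ s, ∫⁻ p in fluidDomain s η (b s), ‖Φ p‖ₑ ^ 2 ≤ ENNReal.ofReal (μ s / μ .upper * J ^ 2) *
        ∫⁻ p in fluidDomain .upper η (b .upper), ‖G p‖ₑ ^ 2 := by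
  have hη := continuous_of_abs_sub_le hLη
  have hb : ∀ s, ∀ β ∈ b s, Continuous β := fun s β hβ => continuous_of_abs_sub_le (hLβ s β hβ)
  have hΩo : ∀ s, IsOpen (fluidDomain s η (b s)) := fun s => isOpen_fluidDomain s hη (hb s)
  set S := compatibleSubmodule hμ hη hb hh hdep with hS
  have hScl := isClosed_compatibleSubmodule hμ hLη hLβ hLη0 hLβ0 hη hb hh hdep
  have : CompleteSpace S := hScl.completeSpace_coe
  -- A pair with the prescribed jump, concentrated in the upper phase; `T`, `w` and `t` are its
  -- gradients, potentials and traces.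
  set T : Phase → Pt d → Vec d := fun s => match s with
    | .upper => fun p => J • G p
    | .lower => fun _ => 0 with hT
  set w : Phase → Pt d → ℝ := fun s => match s with
    | .upper => fun p => J * u p
    | .lower => fun _ => 0 with hw
  set t : Phase → Horiz d → ℝ := fun s => match s with
    | .upper => fun x => J * g₀ x
    | .lower => fun _ => 0 with ht
  have hwT : ∀ s, MemHDotOne (fluidDomain s η (b s)) (w s) (T s) := by
    rintro (_ | _)
    exacts [hu.const_mul J, memHDotOne_const 0]
  have hwt : ∀ s, HasTrace s η (w s) (t s) := by
    rintro (_ | _)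
    exacts [hg₀.const_mul J, hasTrace_const _ η 0]
  have hTL : MemLp (glue η b T) 2 (energyMeasure μ η b) := (memLp_energyMeasure_iff hμ).2 fun s =>
    (memLp_congr_ae (glue_ae_eq hη hb T s)).2 (hwT s).2.1
  -- Removing the component in `S` alters both traces by the same function `g`, so the jump is kept,
  -- and leaves a field orthogonal to every compatible gradient.
  obtain ⟨Y, hY, Z, hZ, hYZ⟩ := S.exists_add_mem_mem_orthogonal hTL.toLp
  obtain ⟨v, g, hv⟩ := id hY
  have hZT : ∀ s, (fun p => T s p - Y p) =ᵐ[volume.restrict (fluidDomain s η (b s))] Z := by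
    intro s
    have h1 : glue η b T =ᵐ[energyMeasure μ η b] fun p => Y p + Z p := by
      filter_upwards [hTL.coeFn_toLp, Lp.coeFn_add Y Z] with p hp1 hp2
      rw [← hp1, hYZ, hp2, Pi.add_apply]
    filter_upwards [(ae_energyMeasure_iff hμ).1 h1 s, glue_ae_eq hη hb T s] with p hp1 hp2
    rw [← hp2, hp1, add_sub_cancel_left]
  refine ⟨fun s x => t s x - g x, fun s p => w s p - v s p, Z, fun s => ?_, fun s => ?_, ?_, ?_, ?_⟩
  · exact ((hwT s).sub (hv s).1).congr (ae_eq_refl _) (hZT s)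
  · exact (hwt s).sub hh (hdep s) ((hwT s).1.aestronglyMeasurable (hΩo s)) (hv s).2
  · intro x; simp [ht]
  · intro v' V' g' hv' hg'
    have hcomp := isCompatible_glue hη hb hv' hg'
    have hmem := hcomp.memLp hμ
    have hin : hmem.toLp ∈ S := hcomp.congr hμ hmem.coeFn_toLp.symm
    have h0 := Submodule.inner_left_of_mem_orthogonal hin hZ
    have hZL := (memLp_energyMeasure_iff hμ).1 (Lp.memLp Z)
    have h1 : (inner ℝ Z hmem.toLp : ℝ) =
        ∫ p, inner ℝ (Z p) (glue η b V' p) ∂(energyMeasure μ η b) := by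
      rw [L2.inner_def]
      exact integral_congr_ae (hmem.coeFn_toLp.mono fun p hp => by simp only [hp])
    rw [h1, integral_energyMeasure hμ fun s => integrable_inner_of_memLp (hZL s)
      ((memLp_energyMeasure_iff hμ).1 hmem s)] at h0
    rw [← h0]
    congr 2
    all_goals
      refine setIntegral_congr_fun (hΩo _).measurableSet fun p hp => ?_
      simp only [glue_eq hp]
  · intro s
    -- By Pythagoras the projection does not increase the energy. The weights then explain the
    -- factor: `1/μ⁺` from the upper lift and `μ s` from restricting to phase `s`.
    have hpyth : ‖Z‖ₑ ≤ ‖(hTL.toLp : Lp (Vec d) 2 (energyMeasure μ η b))‖ₑ := by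
      rw [← ofReal_norm, ← ofReal_norm]
      refine ENNReal.ofReal_le_ofReal ?_
      have h1 := norm_add_sq_eq_norm_sq_add_norm_sq_of_inner_eq_zero Y Z
        (Submodule.inner_right_of_mem_orthogonal hY hZ)
      rw [hYZ]
      nlinarith [norm_nonneg (Y + Z), norm_nonneg Z, mul_self_nonneg ‖Y‖]
    have h2 : ∫⁻ p, ‖Z p‖ₑ ^ 2 ∂(energyMeasure μ η b) ≤
        ∫⁻ p, ‖glue η b T p‖ₑ ^ 2 ∂(energyMeasure μ η b) := by
      rw [← eLpNorm_two_sq, ← eLpNorm_two_sq]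
      refine pow_le_pow_left' ?_ 2
      rw [Lp.enorm_def, Lp.enorm_def, eLpNorm_congr_ae hTL.coeFn_toLp] at hpyth
      exact hpyth
    have h3 : ∀ s, ∫⁻ p in fluidDomain s η (b s), ‖glue η b T p‖ₑ ^ 2 =
        ∫⁻ p in fluidDomain s η (b s), ‖T s p‖ₑ ^ 2 := fun s =>
      setLIntegral_congr_fun (hΩo s).measurableSet fun p hp => by simp only [glue_eq hp]
    rw [lintegral_energyMeasure (fun p => ‖glue η b T p‖ₑ ^ 2), h3, h3] at h2
    simp only [hT, enorm_zero, ne_eq, OfNat.ofNat_ne_zero, not_false_eq_true, zero_pow,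
      lintegral_const, zero_mul, mul_zero, add_zero, lintegral_const_smul_sq] at h2
    refine (setLIntegral_le_energyMeasure hμ s _).trans ((mul_le_mul' le_rfl h2).trans
      (le_of_eq ?_))
    have h4 := hμ s
    have h5 := hμ .upper
    rw [← mul_assoc, ← mul_assoc, ← ENNReal.ofReal_mul h4.le, ← ENNReal.ofReal_mul (by positivity)]
    congr 2; ring

end Closed

/-! ### Uniqueness -/

lemma ae_eq_zero_of_integral_inner_self {m : Measure (Pt d)} {F : Pt d → Vec d}
    (hF : MemLp F 2 m) (h : ∫ p, inner ℝ (F p) (F p) ∂m = 0) : ∫⁻ p, ‖F p‖ₑ ^ 2 ∂m = 0 := by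
  have h1 := integrable_inner_of_memLp hF hF
  have h2 := (integral_eq_zero_iff_of_nonneg (fun p => real_inner_self_nonneg) h1).1 h
  rw [lintegral_eq_zero_iff' (hF.1.enorm.pow_const 2)]
  filter_upwards [h2] with p hp
  have : F p = 0 := inner_self_eq_zero.1 hp
  simp [this]

section Uniqueness

variable {s : Phase} {η : Horiz d → ℝ} {b : Option (Horiz d → ℝ)} {Lη Lβ h : ℝ}

/-- The gradient of the solution of the Dirichlet problem is unique. -/
lemma IsDirichletSolution.ae_eq (hη : Continuous η) (hb : ∀ β ∈ b, Continuous β) (hh : 0 < h)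
    (hdep : ∀ β ∈ b, ∀ x, h ≤ s.sgn * (β x - η x)) {f : Horiz d → ℝ} {φ φ' : Pt d → ℝ}
    {Φ Φ' : Pt d → Vec d} (h1 : IsDirichletSolution s η b f φ Φ)
    (h2 : IsDirichletSolution s η b f φ' Φ') :
    Φ =ᵐ[volume.restrict (fluidDomain s η b)] Φ' := by
  have hd := h1.1.sub h2.1
  have ht := h1.2.1.sub hh hdep (h1.1.1.aestronglyMeasurable (isOpen_fluidDomain s hη hb)) h2.2.1
  simp only [sub_self] at ht
  have e1 := h1.2.2 _ _ hd ht
  have e2 := h2.2.2 _ _ hd ht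
  have e3 : ∫ p in fluidDomain s η b, inner ℝ (Φ p - Φ' p) (Φ p - Φ' p) = 0 := by
    simp only [inner_sub_left (Φ _)]
    rw [integral_sub (integrable_inner_of_memLp h1.1.2.1 hd.2.1)
      (integrable_inner_of_memLp h2.1.2.1 hd.2.1), e1, e2, sub_zero]
  have e4 := ae_eq_zero_of_integral_inner_self hd.2.1 e3
  rw [lintegral_eq_zero_iff' (hd.2.1.1.enorm.pow_const 2)] at e4
  filter_upwards [e4] with p hp
  simpa [sub_eq_zero] using hp

/-- A function with vanishing energy has a constant trace. -/
lemma HasTrace.exists_ae_eq_const (hLη : ∀ x y, |η x - η y| ≤ Lη * ‖x - y‖)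
    (hLβ : ∀ β ∈ b, ∀ x y, |β x - β y| ≤ Lβ * ‖x - y‖) (hLη0 : 0 ≤ Lη) (hLβ0 : 0 ≤ Lβ)
    (hh : 0 < h) (hdep : ∀ β ∈ b, ∀ x, h ≤ s.sgn * (β x - η x)) {u : Pt d → ℝ}
    {G : Pt d → Vec d} {f : Horiz d → ℝ} (hu : MemHDotOne (fluidDomain s η b) u G)
    (hf : HasTrace s η u f) (hG : ∫⁻ p in fluidDomain s η b, ‖G p‖ₑ ^ 2 = 0) :
    ∃ c : ℝ, f =ᵐ[volume] fun _ => c := by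
  obtain ⟨r, hr, C, hC, hpoin⟩ := exists_weighted_trace_inequality hLη hLβ hLη0 hLβ0 hh hdep
  have h1 := hpoin u G f hu hf
  rw [hG, mul_zero, nonpos_iff_eq_zero, lintegral_eq_zero_iff'] at h1
  · refine ⟨localMean r f 0, ?_⟩
    filter_upwards [h1] with x hx
    have h2 : f x - localMean r f 0 = 0 := by
      simpa [(decayWeight_pos x).ne'] using hx
    exact sub_eq_zero.1 h2
  · exact (continuous_decayWeight.aestronglyMeasurable.mul
      (hf.1.sub aestronglyMeasurable_const)).enorm.pow_const 2

/-- The weighted bound controls the trace minus a constant, and the weight is itself square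
integrable, so the constant can be added back. -/
lemma HasTrace.isTempered (hLη : ∀ x y, |η x - η y| ≤ Lη * ‖x - y‖)
    (hLβ : ∀ β ∈ b, ∀ x y, |β x - β y| ≤ Lβ * ‖x - y‖) (hLη0 : 0 ≤ Lη) (hLβ0 : 0 ≤ Lβ)
    (hh : 0 < h) (hdep : ∀ β ∈ b, ∀ x, h ≤ s.sgn * (β x - η x)) {u : Pt d → ℝ}
    {G : Pt d → Vec d} {f : Horiz d → ℝ} (hu : MemHDotOne (fluidDomain s η b) u G)
    (hf : HasTrace s η u f) : IsTempered f := by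
  obtain ⟨r, hr, C, hC, hpoin⟩ := exists_weighted_trace_inequality hLη hLβ hLη0 hLβ0 hh hdep
  refine isTempered_of_memLp ?_
  have h1 : MemLp (fun x => decayWeight d x * (f x - localMean r f 0)) 2 volume :=
    memLp_two_iff.2 ⟨continuous_decayWeight.aestronglyMeasurable.mul
      (hf.1.sub aestronglyMeasurable_const), (hpoin u G f hu hf).trans_lt
        (ENNReal.mul_lt_top hC.lt_top (memLp_two_iff.1 hu.2.1).2)⟩
  have h2 := h1.add (memLp_decayWeight.const_mul (localMean r f 0))
  refine (memLp_congr_ae (ae_of_all _ fun x => ?_)).1 h2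
  simp only [Pi.add_apply]
  ring

end Uniqueness

section Transmission

variable {μ ρ : Phase → ℝ} {η : Horiz d → ℝ} {b : Phase → Option (Horiz d → ℝ)} {Lη Lβ h : ℝ}

/-- The normal points into `Ω⁺` and out of `Ω⁻`, so the difference of the two pairings is, up to
sign, a sum of energies. This gives the positivity behind uniqueness. -/
lemma IsTransmissionSolution.integral_eq_zero {f : Phase → Horiz d → ℝ}
    (hf : IsTransmissionSolution μ ρ η b f) {φ : Phase → Pt d → ℝ} {Φ : Phase → Pt d → Vec d}
    (hφ : ∀ s, IsDirichletSolution s η (b s) (f s) (φ s) (Φ s)) {v : Phase → Pt d → ℝ}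
    {V : Phase → Pt d → Vec d} {g : Horiz d → ℝ}
    (hv : ∀ s, MemHDotOne (fluidDomain s η (b s)) (v s) (V s)) (hg : ∀ s, HasTrace s η (v s) g) :
    1 / μ .upper * (∫ p in fluidDomain .upper η (b .upper), inner ℝ (Φ .upper p) (V .upper p)) +
    1 / μ .lower * (∫ p in fluidDomain .lower η (b .lower), inner ℝ (Φ .lower p) (V .lower p)) =
      0 := by
  have h1 := hf.2.2 g _ _ ⟨_, _, _, _, hφ .upper, hv .upper, hg .upper, rfl⟩
    ⟨_, _, _, _, hφ .lower, hv .lower, hg .lower, rfl⟩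
  simp only [Phase.sgn] at h1
  linarith

/-- The difference of the two solutions solves the problem without jump and may be tested with
itself. Both energies are nonnegative and their weighted sum is zero, so the traces of the
difference are constant. -/
theorem IsTransmissionSolution.eqModConst (hμ : ∀ s, 0 < μ s)
    (hLη : ∀ x y, |η x - η y| ≤ Lη * ‖x - y‖)
    (hLβ : ∀ s, ∀ β ∈ b s, ∀ x y, |β x - β y| ≤ Lβ * ‖x - y‖) (hLη0 : 0 ≤ Lη) (hLβ0 : 0 ≤ Lβ)
    (hh : 0 < h) (hdep : ∀ s, ∀ β ∈ b s, ∀ x, h ≤ s.sgn * (β x - η x))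
    {f f' : Phase → Horiz d → ℝ} (hf : IsTransmissionSolution μ ρ η b f)
    (hf' : IsTransmissionSolution μ ρ η b f') (s : Phase) : EqModConst (f' s) (f s) := by
  have hη := continuous_of_abs_sub_le hLη
  have hb : ∀ s, ∀ β ∈ b s, Continuous β := fun s β hβ => continuous_of_abs_sub_le (hLβ s β hβ)
  have hΩo : ∀ s, IsOpen (fluidDomain s η (b s)) := fun s => isOpen_fluidDomain s hη (hb s)
  choose φ Φ hφ using hf.2.1
  choose φ' Φ' hφ' using hf'.2.1
  obtain ⟨c, hc⟩ := hf.1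
  obtain ⟨c', hc'⟩ := hf'.1
  have hdiff : ∀ s, MemHDotOne (fluidDomain s η (b s)) (fun p => φ' s p - φ s p)
      (fun p => Φ' s p - Φ s p) := fun s => (hφ' s).1.sub (hφ s).1
  have hdm : ∀ s, AEStronglyMeasurable (fun p => φ' s p - φ s p)
      (volume.restrict (fluidDomain s η (b s))) :=
    fun s => (hdiff s).1.aestronglyMeasurable (hΩo s)
  have htr : ∀ s, HasTrace s η (fun p => φ' s p - φ s p) (fun x => f' s x - f s x) := fun s =>
    (hφ' s).2.1.sub hh (hdep s) ((hφ' s).1.1.aestronglyMeasurable (hΩo s)) (hφ s).2.1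
  -- The jump is prescribed only modulo constants, so the traces of the difference may disagree by
  -- `c' - c`. Subtracting this in the upper phase restores compatibility without altering
  -- gradients.
  set k : Phase → ℝ := fun s => match s with
    | .upper => c' - c
    | .lower => 0 with hk
  set g : Horiz d → ℝ := fun x => f' .lower x - f .lower x with hg
  have hv : ∀ s, MemHDotOne (fluidDomain s η (b s)) (fun p => φ' s p - φ s p - k s)
      (fun p => Φ' s p - Φ s p) := fun s => by
    simpa using (hdiff s).sub (memHDotOne_const (k s))
  have hvg : ∀ s, HasTrace s η (fun p => φ' s p - φ s p - k s) g := by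
    intro s
    refine ((htr s).sub hh (hdep s) (hdm s) (hasTrace_const s η (k s))).congr ?_
    cases s with
    | upper =>
      filter_upwards [hc, hc'] with x hx hx'
      simp only [hk, hg]
      linarith
    | lower => simp [hk, hg]
  have e1 := hf.integral_eq_zero hφ hv hvg
  have e2 := hf'.integral_eq_zero hφ' hv hvg
  have e3 : ∀ s, ∫ p in fluidDomain s η (b s), inner ℝ (Φ' s p - Φ s p) (Φ' s p - Φ s p) =
      (∫ p in fluidDomain s η (b s), inner ℝ (Φ' s p) (Φ' s p - Φ s p)) -
      ∫ p in fluidDomain s η (b s), inner ℝ (Φ s p) (Φ' s p - Φ s p) := fun s => by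
    simp only [inner_sub_left (Φ' s _)]
    rw [integral_sub (integrable_inner_of_memLp (hφ' s).1.2.1 (hdiff s).2.1)
      (integrable_inner_of_memLp (hφ s).1.2.1 (hdiff s).2.1)]
  have e4 : ∀ s, 0 ≤ ∫ p in fluidDomain s η (b s), inner ℝ (Φ' s p - Φ s p) (Φ' s p - Φ s p) :=
    fun s => integral_nonneg fun p => real_inner_self_nonneg
  have hμ' : ∀ s, 0 < 1 / μ s := fun s => one_div_pos.2 (hμ s)
  have e5 : 1 / μ .upper * (∫ p in fluidDomain .upper η (b .upper),
      inner ℝ (Φ' .upper p - Φ .upper p) (Φ' .upper p - Φ .upper p)) +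
      1 / μ .lower * (∫ p in fluidDomain .lower η (b .lower),
      inner ℝ (Φ' .lower p - Φ .lower p) (Φ' .lower p - Φ .lower p)) = 0 := by
    rw [e3, e3]; linarith
  have e6 : ∀ s, ∫ p in fluidDomain s η (b s), inner ℝ (Φ' s p - Φ s p) (Φ' s p - Φ s p) = 0 := by
    have p1 := mul_nonneg (hμ' .upper).le (e4 .upper)
    have p2 := mul_nonneg (hμ' .lower).le (e4 .lower)
    rintro (_ | _)
    · exact (mul_eq_zero.1 (by linarith)).resolve_left (hμ' .upper).ne'
    · exact (mul_eq_zero.1 (by linarith)).resolve_left (hμ' .lower).ne'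
  obtain ⟨a, ha⟩ := (htr s).exists_ae_eq_const hLη (hLβ s) hLη0 hLβ0 hh (hdep s) (hdiff s)
    (ae_eq_zero_of_integral_inner_self (hdiff s).2.1 (e6 s))
  exact ⟨a, ha.mono fun x hx => by linarith⟩

/-- The weak form of the transmission problem implies the variational formulation. -/
lemma isTransmissionSolution_of_field (hη : Continuous η) (hb : ∀ s, ∀ β ∈ b s, Continuous β)
    (hμ : ∀ s, 0 < μ s) (hh : 0 < h) (hdep : ∀ s, ∀ β ∈ b s, ∀ x, h ≤ s.sgn * (β x - η x))
    {f : Phase → Horiz d → ℝ} {φ : Phase → Pt d → ℝ} {Φ : Pt d → Vec d}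
    (hφ : ∀ s, MemHDotOne (fluidDomain s η (b s)) (φ s) Φ) (hf : ∀ s, HasTrace s η (φ s) (f s))
    (hjump : ∀ x, f .upper x - f .lower x = (ρ .upper - ρ .lower) * η x)
    (hweak : ∀ (v : Phase → Pt d → ℝ) (V : Phase → Pt d → Vec d) (g : Horiz d → ℝ),
      (∀ s, MemHDotOne (fluidDomain s η (b s)) (v s) (V s)) → (∀ s, HasTrace s η (v s) g) →
      1 / μ .upper * (∫ p in fluidDomain .upper η (b .upper), inner ℝ (Φ p) (V .upper p)) +
      1 / μ .lower * (∫ p in fluidDomain .lower η (b .lower), inner ℝ (Φ p) (V .lower p)) = 0) :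
    IsTransmissionSolution μ ρ η b f := by
  have hΩo : ∀ s, IsOpen (fluidDomain s η (b s)) := fun s => isOpen_fluidDomain s hη (hb s)
  have hμ' : ∀ s, 1 / μ s ≠ 0 := fun s => (one_div_pos.2 (hμ s)).ne'
  -- A function with zero trace in one phase, continued by zero to the other, is a compatible pair.
  have hdir : ∀ s, IsDirichletSolution s η (b s) (f s) (φ s) Φ := by
    intro s
    refine ⟨hφ s, hf s, fun v V hv hv0 => ?_⟩
    cases s with
    | upper =>
      have h1 := hweak (fun s => match s with | .upper => v | .lower => fun _ => 0)
        (fun s => match s with | .upper => V | .lower => fun _ => 0) (fun _ => 0)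
        (by rintro (_ | _); exacts [hv, memHDotOne_const 0])
        (by rintro (_ | _); exacts [hv0, hasTrace_const _ η 0])
      simpa [(hμ .upper).ne'] using h1
    | lower =>
      have h1 := hweak (fun s => match s with | .lower => v | .upper => fun _ => 0)
        (fun s => match s with | .lower => V | .upper => fun _ => 0) (fun _ => 0)
        (by rintro (_ | _); exacts [memHDotOne_const 0, hv])
        (by rintro (_ | _); exacts [hasTrace_const _ η 0, hv0])
      simpa [(hμ .lower).ne'] using h1
  refine ⟨⟨0, ae_of_all _ fun x => by simp [hjump]⟩, fun s => ⟨_, _, hdir s⟩, ?_⟩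
  rintro g a a' ⟨φ₁, Φ₁, v₁, V₁, h1, hv1, hg1, rfl⟩ ⟨φ₂, Φ₂, v₂, V₂, h2, hv2, hg2, rfl⟩
  have h3 := hweak (fun s => match s with | .upper => v₁ | .lower => v₂)
    (fun s => match s with | .upper => V₁ | .lower => V₂) g
    (by rintro (_ | _); exacts [hv1, hv2]) (by rintro (_ | _); exacts [hg1, hg2])
  -- The pairing may be realized by another solution of the Dirichlet problem, whose gradient is
  -- nevertheless the same almost everywhere.
  have e1 : ∫ p in fluidDomain .upper η (b .upper), inner ℝ (Φ₁ p) (V₁ p) =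
      ∫ p in fluidDomain .upper η (b .upper), inner ℝ (Φ p) (V₁ p) :=
    integral_congr_ae ((h1.ae_eq hη (hb _) hh (hdep _) (hdir _)).mono fun p hp => by
      simp only [hp])
  have e2 : ∫ p in fluidDomain .lower η (b .lower), inner ℝ (Φ₂ p) (V₂ p) =
      ∫ p in fluidDomain .lower η (b .lower), inner ℝ (Φ p) (V₂ p) :=
    integral_congr_ae ((h2.ae_eq hη (hb _) hh (hdep _) (hdir _)).mono fun p hp => by
      simp only [hp])
  rw [e1, e2]
  simp only [Phase.sgn]
  simp only at h3
  linarith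

end Transmission

/-! ### The screening functions -/

section Screen

variable {s : Phase} {η : Horiz d → ℝ} {b : Option (Horiz d → ℝ)}

lemma measurable_depth (hη : Continuous η) (hb : ∀ β ∈ b, Continuous β) :
    Measurable (depth s η b) := by
  cases b with
  | none => exact measurable_const
  | some β =>
    have hβ := (hb β rfl).measurable
    have hη' := hη.measurable
    unfold depth
    fun_prop

lemma measurable_screen (hη : Continuous η) (hb : ∀ β ∈ b, Continuous β) :
    Measurable (screen s η b) := by
  cases b with
  | none => exact measurable_const
  | some β => exact (measurable_depth (b := some β) (s := s) hη hb).div_const _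

lemma norm_lt_of_lt_depth {x k : Horiz d} (h : ‖k‖ₑ < depth s η b x) {β : Horiz d → ℝ}
    (hβ : β ∈ b) : ‖k‖ < s.sgn * (β x - η x) := by
  cases hβ
  simp only [depth] at h
  rw [← ofReal_norm] at h
  exact (ENNReal.ofReal_lt_ofReal_iff').1 h |>.1

lemma mul_norm_le_of_lt_screen {x k : Horiz d} (h : ‖k‖ₑ < screen s η b x) {β : Horiz d → ℝ}
    (hβ : β ∈ b) (hpos : 0 ≤ s.sgn * (β x - η x)) :
    2 * slope η b * ‖k‖ ≤ s.sgn * (β x - η x) := by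
  cases hβ
  simp only [screen] at h
  -- For zero slope the screening function is infinite and gives no information, but the claim then
  -- reduces to nonnegativity of the depth.
  rcases (slope_nonneg η (some β)).eq_or_lt with h0 | h0
  · rw [← h0]; simpa using hpos
  · rw [← ENNReal.ofReal_div_of_pos (by positivity), ← ofReal_norm] at h
    have h1 := (ENNReal.ofReal_lt_ofReal_iff').1 h |>.1
    rw [lt_div_iff₀ (by positivity)] at h1
    linarith

end Screen

/-! ### The estimates of the solution -/

lemma enorm_le_of_sq_le {N H T Cl : ℝ≥0∞} {x y z X : ℝ} (hT : T ≠ ⊤) (hCl : Cl ≠ ⊤)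
    (hx : 0 ≤ x) (hy : 0 ≤ y) (hX : 0 ≤ X)
    (hN : N ^ 2 ≤ T * ENNReal.ofReal x * (ENNReal.ofReal y * (Cl * ENNReal.ofReal z * H ^ 2)))
    (hle : T.toReal * x * (y * (Cl.toReal * z)) ≤ X ^ 2) : N ≤ ENNReal.ofReal X * H := by
  refine le_of_not_gt fun hlt => not_le.2 (ENNReal.pow_lt_pow_left two_ne_zero hlt) (hN.trans ?_)
  calc _ = ENNReal.ofReal (T.toReal * x * (y * (Cl.toReal * z))) * H ^ 2 := by
        rw [ENNReal.ofReal_mul (mul_nonneg ENNReal.toReal_nonneg hx),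
          ENNReal.ofReal_mul ENNReal.toReal_nonneg, ENNReal.ofReal_mul hy,
          ENNReal.ofReal_mul ENNReal.toReal_nonneg, ENNReal.ofReal_toReal hT,
          ENNReal.ofReal_toReal hCl]
        ring
    _ ≤ ENNReal.ofReal (X ^ 2) * H ^ 2 := mul_le_mul' (ENNReal.ofReal_le_ofReal hle) le_rfl
    _ = _ := by rw [ENNReal.ofReal_pow hX, mul_pow]

lemma trace_factor_le {K L : ℝ} (hK : 0 ≤ K) (hKL : K ≤ L) :
    2 * (K + 1 / 4) / (1 / 4) ^ 2 ≤ 40 * ((1 + L) ^ 2 * 1 ^ 2) := by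
  have h : 2 * (K + 1 / 4) / (1 / 4) ^ 2 = 32 * K + 8 := by ring
  rw [h]
  nlinarith [sq_nonneg L]

/-- For `L ≥ 1` this is the case `c = 1/4`. For `L ≤ 1` the choice `c = L/4` and `K ≤ L` give at
most `40/L`, and `1/L` is the square of `1/√L`. -/
lemma trace_factor_min_le {K L : ℝ} (hK : 0 ≤ K) (hKL : K ≤ L) (hL : 0 < L) :
    2 * (K + min (1 / 4) (L / 4)) / min (1 / 4) (L / 4) ^ 2 ≤
      40 * ((1 + L) ^ 2 * max 1 (1 / √L) ^ 2) := by
  have h1 : 1 ≤ max 1 (1 / √L) ^ 2 := one_le_pow₀ (le_max_left _ _)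
  have h2 : 1 / L ≤ max 1 (1 / √L) ^ 2 := by
    calc 1 / L = (1 / √L) ^ 2 := by rw [div_pow, Real.sq_sqrt hL.le, one_pow]
      _ ≤ _ := pow_le_pow_left₀ (by positivity) (le_max_right _ _) 2
  have h3 : 1 ≤ (1 + L) ^ 2 := one_le_pow₀ (by linarith)
  rcases le_total 1 L with h | h
  · rw [min_eq_left (by linarith)]
    refine (trace_factor_le hK hKL).trans ?_
    gcongr
    exact le_max_left _ _
  · rw [min_eq_right (by linarith)]
    calc 2 * (K + L / 4) / (L / 4) ^ 2 ≤ 2 * (L + L / 4) / (L / 4) ^ 2 := by gcongr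
      _ = 40 * (1 * (1 / L)) := by field_simp; ring
      _ ≤ _ := by gcongr

/-- The square of the final estimate, with `x` the factor of the trace inequality, `q` the ratio of
viscosities and `Cl` the constant of the lift. Since `C ≥ 1`, a bound by `C` is also one by `C²`. -/
lemma final_bound_le {T Cl x q J K L m S C : ℝ} (hT : 0 ≤ T) (hCl : 0 ≤ Cl) (hq : 0 ≤ q)
    (hK : 0 ≤ K) (hS : 0 ≤ S) (hC : 1 ≤ C) (hC' : T * Cl * 40 * q ≤ C)
    (hx : x ≤ 40 * ((1 + L) ^ 2 * m ^ 2)) :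
    T * x * (q * J ^ 2 * (Cl * (1 + K) ^ 2)) ≤ (C * (1 + (S + K)) * (1 + L) * m * |J|) ^ 2 := by
  have h1 : (1 + K) ^ 2 ≤ (1 + (S + K)) ^ 2 := pow_le_pow_left₀ (by linarith) (by linarith) 2
  have h2 : T * Cl * 40 * q ≤ C ^ 2 := hC'.trans (le_self_pow₀ hC two_ne_zero)
  calc T * x * (q * J ^ 2 * (Cl * (1 + K) ^ 2))
      ≤ T * (40 * ((1 + L) ^ 2 * m ^ 2)) * (q * J ^ 2 * (Cl * (1 + K) ^ 2)) := by gcongr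
    _ = (T * Cl * 40 * q) * ((1 + L) ^ 2 * m ^ 2 * J ^ 2) * (1 + K) ^ 2 := by ring
    _ ≤ C ^ 2 * ((1 + L) ^ 2 * m ^ 2 * J ^ 2) * (1 + (S + K)) ^ 2 := by gcongr
    _ = (C * (1 + (S + K)) * (1 + L) * m) ^ 2 * |J| ^ 2 := by rw [sq_abs]; ring
    _ = _ := by ring

end Muskat

end

/-! ### Existence, uniqueness and the two screened bounds -/

open Muskat in
theorem proposition4p9 (d : ℕ) (hd : 1 ≤ d) (h : ℝ) (hh : 0 < h)
    (μ : Phase → ℝ) (hμ : ∀ s, 0 < μ s) :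
    ∃ C : ℝ, 0 < C ∧
      ∀ (ρ : Phase → ℝ) (η : Horiz d → ℝ) (b : Phase → Option (Horiz d → ℝ)),
        MemWOneInfty η → MemHHalf η → (∀ s, AdmissibleBoundary s h η (b s)) →
        ∃ f : Phase → Horiz d → ℝ,
          (∀ s, MemScreened (screen s η (b s)) (f s)) ∧
          IsTransmissionSolution μ ρ η b f ∧
          (∀ f' : Phase → Horiz d → ℝ,
            (∀ s, MemScreened (screen s η (b s)) (f' s)) →
            IsTransmissionSolution μ ρ η b f' → ∀ s, EqModConst (f' s) (f s)) ∧
          (∀ s, screenedNorm (fun x => min (screen s η (b s) x) (depth s η (b s) x)) (f s) ≤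
            ENNReal.ofReal (C * (1 + (supNorm η + gradSupNorm η)) * (1 + slope η (b s)) *
              |ρ .lower - ρ .upper|) * hHalfNorm η) ∧
          (∀ s, screenedNorm (screen s η (b s)) (f s) ≤
            ENNReal.ofReal (C * (1 + (supNorm η + gradSupNorm η)) * (1 + slope η (b s)) *
              max 1 (1 / √(slope η (b s))) *
              |ρ .lower - ρ .upper|) * hHalfNorm η) := by
  obtain ⟨Cl, hCl, hlift⟩ := exists_lift d
  set T := traceConst d with hT
  have hTtop : T ≠ ⊤ := traceConst_lt_top.ne
  -- Trace constant, lift constant, the numerical factor of the trace estimate, and the ratio `μ s /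
  -- μ⁺` from the energy bound: only `d` and `μ` enter.
  set A : Phase → ℝ := fun s => T.toReal * Cl.toReal * 40 * (μ s / μ .upper) with hA
  have hq : ∀ s, 0 ≤ μ s / μ .upper := fun s => (div_pos (hμ s) (hμ .upper)).le
  have hA0 : ∀ s, 0 ≤ A s := fun s => mul_nonneg (by positivity) (hq s)
  set C := 1 + A .upper + A .lower with hC
  have hC1 : 1 ≤ C := by linarith [hA0 .upper, hA0 .lower]
  have hAC : ∀ s, A s ≤ C := by
    rintro (_ | _) <;> linarith [hA0 .upper, hA0 .lower]
  refine ⟨C, by linarith, fun ρ η b hηW hηH hadm => ?_⟩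
  obtain ⟨⟨M, hM⟩, hηL⟩ := hηW
  have hLη := abs_sub_le_gradSupNorm hηL
  have hK0 := gradSupNorm_nonneg η
  have hdep : ∀ s, ∀ β ∈ b s, ∀ x, h ≤ s.sgn * (β x - η x) := fun s => (hadm s).le_depth
  have hslope : ∀ s, 0 ≤ slope η (b s) := fun s => slope_nonneg _ _
  have hKslope : ∀ s, gradSupNorm η ≤ slope η (b s) := fun s => gradSupNorm_le_slope _ _
  -- The Lipschitz constant of the rigid boundary, or zero if there is none. The bound for phase `s`
  -- must use this one; the common constant `Lβ` below serves the qualitative lemmas.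
  set Lb : Phase → ℝ := fun s => slope η (b s) - gradSupNorm η with hLb
  have hLb0 : ∀ s, 0 ≤ Lb s := fun s => sub_nonneg.2 (hKslope s)
  have hLβs : ∀ s, ∀ β ∈ b s, ∀ x y, |β x - β y| ≤ Lb s * ‖x - y‖ := by
    intro s β hβ x y
    have h1 : slope η (b s) = gradSupNorm η + gradSupNorm β := by
      rw [Option.mem_def] at hβ; rw [hβ]; rfl
    have h2 : Lb s = gradSupNorm β := by simp only [hLb, h1]; ring
    rw [h2]
    exact abs_sub_le_gradSupNorm (hadm s β hβ).1 x y
  set Lβ := Lb .upper + Lb .lower with hLβdef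
  have hLβ0 : 0 ≤ Lβ := add_nonneg (hLb0 _) (hLb0 _)
  have hLβ : ∀ s, ∀ β ∈ b s, ∀ x y, |β x - β y| ≤ Lβ * ‖x - y‖ := by
    intro s β hβ x y
    refine (hLβs s β hβ x y).trans (mul_le_mul_of_nonneg_right ?_ (norm_nonneg _))
    cases s <;> linarith [hLb0 .upper, hLb0 .lower]
  have hη := continuous_of_abs_sub_le hLη
  have hb : ∀ s, ∀ β ∈ b s, Continuous β := fun s β hβ => continuous_of_abs_sub_le (hLβ s β hβ)
  obtain ⟨u, G, hu, hug, hGE⟩ := hlift η (gradSupNorm η) M hK0 hLη hM hηH.2 (b .upper) (hb .upper)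
  obtain ⟨f, φ, Φ, hφ, hf, hjump, hweak, henergy⟩ := exists_transmission_field hμ hLη hLβ hK0 hLβ0
    hh hdep hu hug (ρ .upper - ρ .lower)
  have hsol : IsTransmissionSolution μ ρ η b f :=
    isTransmissionSolution_of_field hη hb hμ hh hdep hφ hf hjump hweak
  have hE : ∀ s, ∫⁻ p in fluidDomain s η (b s), ‖Φ p‖ₑ ^ 2 ≤
      ENNReal.ofReal (μ s / μ .upper * (ρ .upper - ρ .lower) ^ 2) *
        (Cl * ENNReal.ofReal ((1 + gradSupNorm η) ^ 2) * hHalfNorm η ^ 2) := fun s =>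
    (henergy s).trans (mul_le_mul' le_rfl hGE)
  have habs : |ρ .lower - ρ .upper| = |ρ .upper - ρ .lower| := abs_sub_comm _ _
  have hsum : ∀ s, gradSupNorm η + Lb s = slope η (b s) := fun s => by simp [hLb]
  have hS0 := supNorm_nonneg η
  -- Both bounds are the trace inequality for different `Θ` and `c`; `m` is the extra factor that
  -- the choice of `c` costs.
  have estimate : ∀ (s : Phase) (Θ : Horiz d → ℝ≥0∞) (c m : ℝ), Measurable Θ → 0 < c → c ≤ 1 →
      0 ≤ m → (∀ (x k : Horiz d), ‖k‖ₑ < Θ x → ∀ β ∈ b s,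
        (slope η (b s) + 2 * c) * ‖k‖ ≤ s.sgn * (β x - η x)) →
      2 * (gradSupNorm η + c) / c ^ 2 ≤ 40 * ((1 + slope η (b s)) ^ 2 * m ^ 2) →
      screenedNorm Θ (f s) ≤ ENNReal.ofReal (C * (1 + (supNorm η + gradSupNorm η)) *
        (1 + slope η (b s)) * m * |ρ .lower - ρ .upper|) * hHalfNorm η := by
    intro s Θ c m hΘ hc hc1 hm hW hx
    have h1 := (hf s).screenedNorm_sq_le hLη (hLβs s) hK0 hc hc1 (hφ s) hΘ
      (by simpa only [hsum s] using hW)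
    rw [habs]
    refine enorm_le_of_sq_le hTtop hCl (by positivity) (mul_nonneg (hq s) (sq_nonneg _)) ?_
      (h1.trans (mul_le_mul' le_rfl (hE s))) (final_bound_le ENNReal.toReal_nonneg
        ENNReal.toReal_nonneg (hq s) hK0 hS0 hC1 (hAC s) hx)
    have := hslope s
    positivity
  have hpos : ∀ s, ∀ β ∈ b s, ∀ x, 0 ≤ s.sgn * (β x - η x) := fun s β hβ x =>
    hh.le.trans (hdep s β hβ x)
  have hbound2 : ∀ s, screenedNorm (screen s η (b s)) (f s) ≤
      ENNReal.ofReal (C * (1 + (supNorm η + gradSupNorm η)) * (1 + slope η (b s)) *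
        max 1 (1 / √(slope η (b s))) * |ρ .lower - ρ .upper|) * hHalfNorm η := by
    intro s
    rcases (hslope s).eq_or_lt with h0 | h0
    · have hη0 : η = 0 := eq_zero_of_gradSupNorm_eq_zero hd hηL hηH.1
        (le_antisymm (h0 ▸ hKslope s) hK0)
      have hH0 : hHalfNorm η = 0 := by
        rw [hη0, hHalfNorm]
        have : screenedNorm (fun _ => ⊤) (0 : Horiz d → ℝ) = 0 := screenedNorm_const _ 0
        simp [this]
      have hE0 := hE s
      rw [hH0, zero_pow two_ne_zero, mul_zero, mul_zero, nonpos_iff_eq_zero] at hE0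
      obtain ⟨a, ha⟩ := (hf s).exists_ae_eq_const hLη (hLβ s) hK0 hLβ0 hh (hdep s) (hφ s) hE0
      rw [screenedNorm_congr _ ha, screenedNorm_const]
      exact zero_le
    · refine estimate s _ (min (1 / 4) (slope η (b s) / 4)) _ (measurable_screen hη (hb s))
        (lt_min (by norm_num) (by linarith)) ((min_le_left _ _).trans (by norm_num))
        (zero_le_one.trans (le_max_left _ _)) ?_ (trace_factor_min_le hK0 (hKslope s) h0)
      intro x k hk β hβ
      refine le_trans ?_ (mul_norm_le_of_lt_screen hk hβ (hpos s β hβ x))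
      refine mul_le_mul_of_nonneg_right ?_ (norm_nonneg _)
      linarith [min_le_right (1 / 4) (slope η (b s) / 4)]
  refine ⟨f, fun s => ⟨(hf s).isTempered hLη (hLβ s) hK0 hLβ0 hh (hdep s) (hφ s),
    (hf s).memL2Loc hη hh (hdep s) (hφ s).1, (hbound2 s).trans_lt
      (ENNReal.mul_lt_top ENNReal.ofReal_lt_top hηH.2)⟩, hsol, fun f' _ hf' s =>
      hsol.eqModConst hμ hLη hLβ hK0 hLβ0 hh hdep hf' s, fun s => ?_, hbound2⟩
  -- Averaging `2L|k| ≤ depth` and `|k| ≤ depth` gives `(L + 1/2)|k| ≤ depth`, so `c = 1/4` is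
  -- admissible whatever the slope and no factor is lost.
  have h1 := estimate s (fun x => min (screen s η (b s) x) (depth s η (b s) x)) (1 / 4) 1
    ((measurable_screen hη (hb s)).min (measurable_depth hη (hb s))) (by norm_num) (by norm_num)
    zero_le_one (by
      intro x k hk β hβ
      have h2 := mul_norm_le_of_lt_screen (hk.trans_le (min_le_left _ _)) hβ (hpos s β hβ x)
      have h3 := norm_lt_of_lt_depth (hk.trans_le (min_le_right _ _)) hβ
      linarith) (trace_factor_le hK0 (hKslope s))
  rwa [mul_one] at h1
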